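/- Let $0<T\le\infty$, let $\alpha\ge 1$, $\beta,\theta\ge 0$ with $\tfrac12\le\beta+\theta\le 1$, and let $\Lambda=(-\Delta)^{1/2}$ on $\mathbb R^3$. Let $L^2_\sigma(\mathbb R^3)$ be the space of divergence-free vector fields in $L^2(\mathbb R^3;\mathbb R^3)$, and let $u_0\in L^2_\sigma(\mathbb R^3)$. Let $u\in L^\infty(0,T;L^2_\sigma(\mathbb R^3))\cap L^2(0,T;H^\alpha(\mathbb R^3))$ be a Leray–Hopf weak solution of the fractional Navier–Stokes equations $$u_t+(-\Delta)^\alpha u+(u\cdot\nabla)u+\nabla p=0,\qquad \operatorname{div}u=0,\qquad u(\cdot,0)=u_0\qquad\text{on }\mathbb R^3\times(0,T),$$ that is, (i) $\displaystyle\int_0^T\Big(\big(\psi_\tau+(u\cdot\nabla)\psi,\,u\big)-\big(u,\Lambda^{2\alpha}\psi\big)\Big)\,d\tau=-(u_0,\psi(0))$ for all divergence-free vector fields $\psi\in C_c^\infty([0,T)\times\mathbb R^3;\mathbb R^3)$, where $(\cdot,\cdot)$ is the $L^2(\mathbb R^3)$ inner product; (ii) $\tfrac12\|u(t)\|_{L^2}^2+\int_0^t\|\Lambda^\alpha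 u(\tau)\|_{L^2}^2\,d\tau\le\tfrac12\|u_0\|_{L^2}^2$ for all $t\in(0,T)$; (iii) $\|u(t)-u_0\|_{L^2}\to0$ as $t\to0^+$. For $0\le s<\tfrac32$ and a measurable real function $\varphi$ on $\mathbb R^3$ put $\|\varphi\|_{\mathcal M(\dot H^s\to L^p)}=\sup_{0\ne f\in\dot H^s}\|\varphi f\|_{L^p}/\|f\|_{\dot H^s}$, where $\dot H^s=\dot H^s(\mathbb R^3)$ is the homogeneous Sobolev space of real functions with norm $\|\Lambda^s f\|_{L^2}$, and for a vector field $\varphi=(\varphi^1,\varphi^2,\varphi^3)$ put $\|\varphi\|^2_{\mathcal M^3(\dot H^s\to L^p)}=\sum_{i=1}^3\|\varphi^i\|^2_{\mathcal M(\dot H^s\to L^p)}$. Suppose that $$|u|^{\frac{2}{\beta+\theta}-2}u\in L^{\frac{2\alpha(\beta+\theta)}{\alpha-\theta}}\Big(0,T;\mathcal M^3\big(\dot H^{\frac{\theta}{\beta+\theta}}\to L^{2(\beta+\theta)}\big)\Big),$$ where the exponent in time is read as $\infty$ if $\alpha=\theta$ (that is, if $\alpha=\theta=1$ and $\beta=0$).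 Then $u$ has, after redefinition on a set of times of measure zero, a representative that is weakly continuous from $[0,T)$ to $L^2(\mathbb R^3)$, and every such representative, again written $u$, satisfies the energy equality $$\tfrac12\|u(t)\|_{L^2}^2+\int_0^t\|\Lambda^\alpha u(\tau)\|_{L^2}^2\,d\tau=\tfrac12\|u_0\|_{L^2}^2\qquad\text{for all }0\le t<T.$$ -/

import Mathlib

open MeasureTheory Filter Topology FourierTransform
open scoped ENNReal NNReal ContDiff SchwartzMap

noncomputable section

namespace FracNS

/-- Euclidean space `ℝ³`. -/
abbrev E3 : Type := EuclideanSpace ℝ (Fin 3)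

/-- The complexification `ℂ³`, in which Fourier transforms of vector fields take values. -/
abbrev C3 : Type := EuclideanSpace ℂ (Fin 3)

/-- The space `L²(ℝ³)³` of real square integrable vector fields. -/
abbrev L2 : Type := Lp E3 2 (volume : Measure E3)

/-- The inclusion `ℝ³ → ℂ³`. -/
def complexify : E3 →L[ℝ] C3 :=
  LinearMap.toContinuousLinearMap
    { toFun := fun v => WithLp.toLp 2 (fun i => ((v i : ℝ) : ℂ))
      map_add' := fun v w => by ext i; simp
      map_smul' := fun c v => by ext i; simp }

/-- The componentwise real part `ℂ³ → ℝ³`. -/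
def realPart (z : C3) : E3 := WithLp.toLp 2 (fun i => (z i).re)

/-- The `L²` (Plancherel) Fourier transform of a square integrable vector field, with Mathlib's
normalization `∫ e^{-2πi x·ξ} w(x) dx`; the classical frequency is therefore `2πξ`. -/
def fourierL2 (w : L2) : Lp C3 2 (volume : Measure E3) := 𝓕 (complexify.compLp w)

/-- For `g` the Fourier transform of `f`, this is `‖Λˢ f‖_{L²}`, `Λ = (-Δ)^{1/2}`, the operator
`Λˢ` having the symbol `(2π|ξ|)ˢ` in Mathlib's normalization. -/
def rieszNorm {V : Type*} [NormedAddCommGroup V] [NormedSpace ℝ V] (s : ℝ) (g : E3 → V) : ℝ≥0∞ :=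
  eLpNorm (fun ξ => (2 * Real.pi * ‖ξ‖) ^ s • g ξ) 2 volume

/-- `‖Λˢ w‖_{L²} ∈ [0,∞]` for `w ∈ L²`. -/
def lambdaNorm (s : ℝ) (w : L2) : ℝ≥0∞ := rieszNorm s (fourierL2 w)

/-- The inhomogeneous Sobolev norm `‖w‖_{H^s} ∈ [0,∞]` of `w ∈ L²`; one has `w ∈ H^s(ℝ³)`
(`= H^s_0(ℝ³)`) if and only if it is finite. -/
def sobolevNorm (s : ℝ) (w : L2) : ℝ≥0∞ :=
  eLpNorm (fun ξ => (1 + (2 * Real.pi * ‖ξ‖) ^ 2) ^ (s / 2) • fourierL2 w ξ) 2 volume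

/-- `Λˢ f` for a test field `f`: the multiplier `(2π|ξ|)ˢ` between the classical Fourier
transform and its inverse. The symbol is even, so the result is real; `realPart` only changes
its type. -/
def fracLambda (s : ℝ) (f : E3 → E3) (x : E3) : E3 :=
  realPart (𝓕⁻ (fun ξ : E3 => (2 * Real.pi * ‖ξ‖) ^ s • 𝓕 (fun y : E3 => complexify (f y)) ξ) x)

/-- The vector field `w` is divergence free in the sense of distributions, i.e. `w ∈ L²_σ`. -/
def IsDivFree (w : L2) : Prop :=
  ∀ φ : E3 → ℝ, ContDiff ℝ ∞ φ → HasCompactSupport φ → ∫ x, fderiv ℝ φ x (w x) = 0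

/-! ### Multiplier spaces -/

/-- The tempered distribution `F` is the function `f`. -/
def Represents (f : E3 → ℂ) (F : 𝓢'(E3, ℂ)) : Prop :=
  LocallyIntegrable f volume ∧
    ∀ ψ : 𝓢(E3, ℂ), Integrable (fun x => ψ x * f x) volume ∧ F ψ = ∫ x, ψ x * f x

/-- The function `f` is a tempered distribution whose Fourier transform is the (locally
integrable) function `g`. -/
def IsFourierPair (f : E3 → ℝ) (g : E3 → ℂ) : Prop :=
  ∃ F : 𝓢'(E3, ℂ), Represents (fun x => (f x : ℂ)) F ∧ Represents g (𝓕 F)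

/-- The norm of the homogeneous Sobolev space `Ḣˢ(ℝ³)`, `s < 3/2`. Since the Fourier transform `g`
of `f` is unique up to null sets, the infimum runs over a single value, or over nothing, in which
case the norm is `∞`. -/
def homSobolevNorm (s : ℝ) (f : E3 → ℝ) : ℝ≥0∞ :=
  ⨅ (g : E3 → ℂ) (_ : IsFourierPair f g), rieszNorm s g

/-- The space `Ḣˢ(ℝ³)` of functions, `s < 3/2`. -/
def homSobolev (s : ℝ) : Set (E3 → ℝ) := {f | homSobolevNorm s f < ⊤}

/-- The norm of `φ` in the multiplier space `𝓜(Ḣˢ → Lᵖ)`: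
the supremum of `‖φ f‖_{Lᵖ} / ‖f‖_{Ḣˢ}` over the non-zero `f ∈ Ḣˢ`. -/
def multiplierNorm (s : ℝ) (p : ℝ≥0∞) (φ : E3 → ℝ) : ℝ≥0∞ :=
  ⨆ (f : E3 → ℝ) (_ : f ∈ homSobolev s ∧ ¬ f =ᵐ[volume] 0),
    eLpNorm (fun x => φ x * f x) p volume / homSobolevNorm s f

/-- The norm of a vector field in `𝓜³(Ḣˢ → Lᵖ)`: the Euclidean norm of the vector of the
multiplier norms of its components. -/
def multiplierNorm3 (s : ℝ) (p : ℝ≥0∞) (φ : E3 → E3) : ℝ≥0∞ :=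
  (∑ i : Fin 3, multiplierNorm s p (fun x => φ x i) ^ 2) ^ (1 / 2 : ℝ)

/-- The open time interval `(0,T)`, `0 < T ≤ ∞`. -/
def timeInterval (T : ℝ≥0∞) : Set ℝ := {t | 0 < t ∧ ENNReal.ofReal t < T}

/-- `φ ∈ L^q(0,T; 𝓜³(Ḣˢ → Lᵖ))`. -/
def MemLqMultiplier (T q : ℝ≥0∞) (s : ℝ) (p : ℝ≥0∞) (φ : ℝ → E3 → E3) : Prop :=
  (∀ᵐ t ∂volume.restrict (timeInterval T), AEStronglyMeasurable (φ t) volume) ∧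
    MemLp (fun t => multiplierNorm3 s p (φ t)) q (volume.restrict (timeInterval T))

/-! ### Leray–Hopf weak solutions -/

/-- Test fields in `C_c^∞([0,T); C_{c,σ}^∞(ℝ³))`, given by an extension to `ℝ × ℝ³`. -/
structure IsTestField (T : ℝ≥0∞) (ψ : ℝ × E3 → E3) : Prop where
  smooth : ContDiff ℝ ∞ ψ
  compact : HasCompactSupport ψ
  support : ∀ z ∈ tsupport ψ, ENNReal.ofReal z.1 < T
  divFree : ∀ t : ℝ, 0 ≤ t → ∀ x : E3,
    ∑ i : Fin 3, (fderiv ℝ (fun y => ψ (t, y)) x (EuclideanSpace.single i 1)) i = 0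

/-- The weak form, tested with divergence free fields, of
`u_t + (-Δ)^α u + (u·∇)u + ∇p = 0`, `div u = 0`, `u(0) = u₀` on `ℝ³ × (0,T)`. -/
def IsDistributionalSolution (α : ℝ) (T : ℝ≥0∞) (u₀ : L2) (u : ℝ → L2) : Prop :=
  ∀ ψ : ℝ × E3 → E3, IsTestField T ψ →
    ∫ τ in timeInterval T,
      ((∫ x, inner ℝ (deriv (fun s => ψ (s, x)) τ
          + fderiv ℝ (fun y => ψ (τ, y)) x (u τ x)) (u τ x))
        - ∫ x, inner ℝ (u τ x) (fracLambda (2 * α) (fun y => ψ (τ, y)) x))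
      = - ∫ x, inner ℝ (u₀ x) (ψ (0, x))

/-- Leray–Hopf weak solutions of the fractional Navier–Stokes equations on `ℝ³ × (0,T)` with
initial value `u₀ ∈ L²_σ`. -/
structure IsLerayHopf (α : ℝ) (T : ℝ≥0∞) (u₀ : L2) (u : ℝ → L2) : Prop where
  /-- `u ∈ L^∞(0,T; L²)` -/
  memLinf : MemLp u ⊤ (volume.restrict (timeInterval T))
  /-- `u(t) ∈ L²_σ` -/
  divFree : ∀ᵐ t ∂volume.restrict (timeInterval T), IsDivFree (u t)
  /-- `u ∈ L²(0,T; H^α)` -/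
  memL2H : MemLp (fun t => sobolevNorm α (u t)) 2 (volume.restrict (timeInterval T))
  /-- `u₀ ∈ L²_σ` -/
  initDivFree : IsDivFree u₀
  weak : IsDistributionalSolution α T u₀ u
  energyIneq : ∀ t ∈ timeInterval T,
    ‖u t‖ₑ ^ 2 / 2 + ∫⁻ τ in Set.Ioo 0 t, lambdaNorm α (u τ) ^ 2 ≤ ‖u₀‖ₑ ^ 2 / 2
  initial : Tendsto u (𝓝[>] 0) (𝓝 u₀)

/-- `v` is a weakly `L²`-continuous representative on `[0,T)` of the class `u` of functions
defined almost everywhere on `(0,T)`. -/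
def IsWeaklyContinuousRep (T : ℝ≥0∞) (u v : ℝ → L2) : Prop :=
  v =ᵐ[volume.restrict (timeInterval T)] u ∧
    ∀ w : L2, ContinuousOn (fun t => inner ℝ (v t) w) {t : ℝ | 0 ≤ t ∧ ENNReal.ofReal t < T}

end FracNS

end

/-! Test the equation with the truncation `u_n` of `u` to frequencies `|ξ| ≤ n`. Half the energy of
`u_n` changes at the rate `∫ (u·∇)u_n · u − ∫_{|ξ|≤n} |(Λ^α u)^|²`, so the energy equality follows
once the time integral of the nonlinear term tends to zero. At almost every time the term itself
does: `∫ (u·∇)u_n · u_n = 0` because `u` is divergence free, so the last factor may be replaced by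
`u − u_n`, and Hölder gives the bound `‖∇u_n‖₂ ‖u‖₄ ‖u − u_n‖₄`. Since `α ≥ 1` the gradient is
controlled, and `u − u_n → 0` in `L⁴` by interpolation between `L²` and `L⁶`
(`tendsto_trilin_lowField`). Dominated convergence in time asks for the majorant `‖u‖²_{H^α} +
‖u‖₄⁴` (`enorm_energyFlux_le`), so everything reduces to `u ∈ L⁴(0,T;L⁴)`.

This is where the multiplier condition enters. Put `γ = β + θ` and `φ = |u|^{2/γ−2} u`. Then `|u|⁴ =
(|φ| |u|)^{2γ}`, hence `‖u‖₄⁴ ≤ C (M ‖u‖_{Ḣ^{θ/γ}})^{2γ}` with `M` the multiplier norm of `φ`.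
Interpolation between `L²` and `H^α` bounds this by a constant times `M^{2γ} ‖u‖_{H^α}^{2θ/α}`, and
Young's inequality by `M^{2αγ/(α−θ)} + ‖u‖²_{H^α}`, which is integrable (`exists_dominating`).

Testing with `u_n` has to be justified although `u` has no regularity in time. Multiplied by the
weight `(1+|ξ|²)^{-(α+2)}`, the Fourier transform of `u` satisfies an evolution equation in a
Hilbert space with bounded right-hand side: the weight absorbs the symbol of the dissipation and
makes gradients of test fields bounded (`fluxVec`). The weak form fixes this right-hand side only up
to fields parallel to `ξ`, the transforms of gradients; projecting onto their orthogonal complement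
removes the pressure (`wtOp_ae_eq_primitive`). The weighted transform is thus almost everywhere
equal to a Lipschitz primitive. On `|ξ| ≤ n` the weight can be divided out by a bounded operator, so
the truncated energy identity holds at every time (`norm_sq_primitive`).

As `n → ∞` the norms of the truncations converge; by orthogonality so do the truncations, and their
limit is a weakly continuous representative with the energy equality (`exists_energy_solution`).
Weakly continuous functions that agree almost everywhere agree everywhere
(`eqOn_of_weaklyContinuous`), so the equality holds for every such representative. -/

noncomputable section

namespace FracNS

/-! ### Complexification and the Fourier transform on `L²` -/

/-- Square integrable `ℂ³`-valued fields. -/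
abbrev LC : Type := Lp C3 2 (volume : Measure E3)

lemma norm_complexify (v : E3) : ‖complexify v‖ = ‖v‖ := by
  simp [complexify, EuclideanSpace.norm_eq]

lemma realPart_complexify (v : E3) : realPart (complexify v) = v := by
  ext i; simp [complexify, realPart]

lemma norm_realPart_le (z : C3) : ‖realPart z‖ ≤ ‖z‖ := by
  rw [EuclideanSpace.norm_eq, EuclideanSpace.norm_eq]
  refine Real.sqrt_le_sqrt (Finset.sum_le_sum fun i _ => ?_)
  have := Complex.abs_re_le_norm (z i)
  simp only [realPart, Real.norm_eq_abs]
  gcongr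

/-- The componentwise real part as a continuous linear map. -/
def realPartCLM : C3 →L[ℝ] E3 :=
  LinearMap.toContinuousLinearMap
    { toFun := realPart
      map_add' := fun v w => by ext i; simp [realPart]
      map_smul' := fun c v => by ext i; simp [realPart] }

@[simp] lemma realPartCLM_apply (z : C3) : realPartCLM z = realPart z := rfl

lemma inner_complexify (v : E3) (z : C3) : inner ℝ (complexify v) z = inner ℝ v (realPart z) := by
  simp [PiLp.inner_apply, complexify, realPart, Complex.inner]

lemma inner_real_eq_re (F G : LC) : inner ℝ F G = (inner ℂ F G).re := by
  rw [L2.inner_def, L2.inner_def]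
  exact integral_re (L2.integrable_inner (𝕜 := ℂ) F G)

/-- The Fourier transform of real square integrable fields as a bounded linear operator. -/
def fourierL2CLM : L2 →L[ℝ] LC :=
  ((Lp.fourierTransformₗᵢ E3 C3).toContinuousLinearEquiv.toContinuousLinearMap.restrictScalars ℝ).comp
    (complexify.compLpL 2 volume)

lemma norm_fourierL2 (w : L2) : ‖fourierL2 w‖ = ‖w‖ := by
  rw [fourierL2, Lp.norm_fourier_eq, Lp.norm_def, Lp.norm_def]
  congr 1
  refine eLpNorm_congr_norm_ae ?_
  filter_upwards [complexify.coeFn_compLp w] with x hx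
  rw [hx, norm_complexify]

/-- The real part of the inverse Fourier transform of a square integrable field. -/
def realLp : LC →L[ℝ] L2 :=
  (realPartCLM.compLpL 2 volume).comp
    ((Lp.fourierTransformₗᵢ E3 C3).symm.toContinuousLinearEquiv.toContinuousLinearMap.restrictScalars ℝ)

lemma coeFn_realLp (F : LC) : realLp F =ᵐ[volume] fun x => realPart ((𝓕⁻ F : LC) x) :=
  realPartCLM.coeFn_compLp (𝓕⁻ F : LC)

lemma realLp_fourierL2 (u : L2) : realLp (fourierL2 u) = u := by
  refine Lp.ext ?_
  have h : (𝓕⁻ (fourierL2 u) : LC) = complexify.compLp u := by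
    rw [fourierL2]; exact fourierInv_fourier_eq _
  filter_upwards [coeFn_realLp (fourierL2 u), complexify.coeFn_compLp u] with x hx hy
  rw [hx, h, hy, realPart_complexify]

lemma inner_fourier_real (F G : LC) : inner ℝ (𝓕 F : LC) (𝓕 G : LC) = inner ℝ F G := by
  rw [inner_real_eq_re, inner_real_eq_re, Lp.inner_fourier_eq]

/-- Parseval, together with the fact that a real vector sees only the real part of a complex one.
Hence `realLp` is the adjoint of `fourierL2`, which moves pairings with real fields to frequency
space. -/
lemma inner_realLp (u : L2) (F : LC) : inner ℝ u (realLp F) = inner ℝ (fourierL2 u) F := by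
  have h : F = 𝓕 (𝓕⁻ F : LC) := (fourier_fourierInv_eq F).symm
  conv_rhs => rw [h]
  rw [fourierL2, inner_fourier_real, L2.inner_def, L2.inner_def]
  refine integral_congr_ae ?_
  filter_upwards [coeFn_realLp F, complexify.coeFn_compLp u] with x hx hy
  rw [hx, hy, inner_complexify]

lemma continuous_neg_innerₗ : Continuous fun p : E3 × E3 => (-innerₗ E3) p.1 p.2 :=
  (continuous_inner (𝕜 := ℝ) (E := E3)).neg

/-- On `L¹ ∩ L²` the classical and the Plancherel inverse Fourier transforms agree. -/
lemma fourierInv_ae_eq {F : E3 → C3} (hF : Integrable F) (h2 : MemLp F 2) :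
    (𝓕⁻ (h2.toLp F) : LC) =ᵐ[volume] 𝓕⁻ F := by
  have hcont : Continuous (𝓕⁻ F) :=
    VectorFourier.fourierIntegral_continuous Real.continuous_fourierChar
      continuous_neg_innerₗ hF
  have hloc : LocallyIntegrable (fun x => (𝓕⁻ (h2.toLp F) : LC) x - 𝓕⁻ F x) volume :=
    ((Lp.memLp _).locallyIntegrable (by norm_num)).sub hcont.locallyIntegrable
  have key := ae_eq_zero_of_integral_contDiff_smul_eq_zero hloc ?_
  · filter_upwards [key] with x hx using sub_eq_zero.1 hx
  intro g hg hgc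
  have hgC : HasCompactSupport fun x => (g x : ℂ) := hgc.comp_left (g := fun r : ℝ => (r : ℂ)) (by simp)
  let G : 𝓢(E3, ℂ) := hgC.toSchwartzMap (Complex.ofRealCLM.contDiff.comp hg)
  have hG : ∀ x, G x = (g x : ℂ) := fun x => rfl
  -- The two transforms are compared as distributions: both can be shifted onto the test function,
  -- the Plancherel one by the definition for tempered distributions, the classical one by Fubini.
  have e1 : ∫ x, g x • (𝓕⁻ (h2.toLp F) : LC) x = ∫ x, 𝓕⁻ G x • F x := by
    have := congrArg (fun T : 𝓢'(E3, C3) => T G) (Lp.fourierInv_toTemperedDistribution_eq (h2.toLp F))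
    simp only [TemperedDistribution.fourierInv_apply, Lp.toTemperedDistribution_apply] at this
    rw [show (fun x => g x • (𝓕⁻ (h2.toLp F) : LC) x) = fun x => G x • (𝓕⁻ (h2.toLp F) : LC) x from
      funext fun x => by rw [hG]; simp, ← this]
    refine integral_congr_ae ?_
    filter_upwards [h2.coeFn_toLp] with x hx
    rw [hx]
  have e2 : ∫ x, g x • 𝓕⁻ F x = ∫ x, 𝓕⁻ G x • F x := by
    have := VectorFourier.integral_bilin_fourierIntegral_eq_flip (μ := volume) (ν := volume)
      (L := -innerₗ E3) (f := F) (g := G) (ContinuousLinearMap.lsmul ℂ ℂ (E := C3)).flip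
      Real.continuous_fourierChar
      continuous_neg_innerₗ hF G.integrable
    have hfl : (-innerₗ E3).flip = -innerₗ E3 := by
      ext x y; simp [real_inner_comm]
    rw [hfl] at this
    rw [SchwartzMap.fourierInv_coe]
    rw [show (fun x => g x • 𝓕⁻ F x) = fun x => G x • 𝓕⁻ F x from
      funext fun x => by rw [hG]; simp]
    exact this
  simp_rw [smul_sub]
  rw [integral_sub, e1, e2, sub_self]
  · exact ((Lp.memLp (𝓕⁻ (h2.toLp F) : LC)).locallyIntegrable (by norm_num)
      ).integrable_smul_left_of_hasCompactSupport hg.continuous hgc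
  · exact hcont.locallyIntegrable.integrable_smul_left_of_hasCompactSupport hg.continuous hgc

/-! ### Synthesis of real fields -/

/-- The real field with frequency density `F`. -/
def synth (F : E3 → C3) (x : E3) : E3 := realPart (𝓕⁻ F x)

lemma synth_ae_eq {F : E3 → C3} (hF : Integrable F) (h2 : MemLp F 2) :
    synth F =ᵐ[volume] realLp (h2.toLp F) := by
  filter_upwards [fourierInv_ae_eq hF h2, coeFn_realLp (h2.toLp F)] with x hx hy
  rw [hy, hx, synth]

lemma continuous_fourierInv {F : E3 → C3} (hF : Integrable F) : Continuous (𝓕⁻ F) :=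
  VectorFourier.fourierIntegral_continuous Real.continuous_fourierChar
    continuous_neg_innerₗ hF

lemma continuous_synth {F : E3 → C3} (hF : Integrable F) : Continuous (synth F) :=
  realPartCLM.continuous.comp (continuous_fourierInv hF)

lemma norm_fourierInv_le (F : E3 → C3) (x : E3) : ‖𝓕⁻ F x‖ ≤ ∫ ξ, ‖F ξ‖ :=
  VectorFourier.norm_fourierIntegral_le_integral_norm _ _ _ _ _

lemma norm_synth_le (F : E3 → C3) (x : E3) : ‖synth F x‖ ≤ ∫ ξ, ‖F ξ‖ :=
  (norm_realPart_le _).trans (norm_fourierInv_le F x)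

/-- The frequency density of the derivative in the direction `v`. -/
def dirSymbol (v : E3) (F : E3 → C3) (ξ : E3) : C3 :=
  (2 * Real.pi * Complex.I * (inner ℝ ξ v : ℝ)) • F ξ

lemma norm_dirSymbol_le (v : E3) (F : E3 → C3) (ξ : E3) :
    ‖dirSymbol v F ξ‖ ≤ ‖v‖ * (2 * Real.pi * ‖ξ‖ * ‖F ξ‖) := by
  rw [dirSymbol, norm_smul]
  simp only [norm_mul, Complex.norm_I, Complex.norm_real, Complex.norm_ofNat, mul_one,
    Real.norm_eq_abs, abs_of_pos Real.pi_pos]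
  have := abs_real_inner_le_norm ξ v
  calc 2 * Real.pi * |inner ℝ ξ v| * ‖F ξ‖ ≤ 2 * Real.pi * (‖ξ‖ * ‖v‖) * ‖F ξ‖ := by gcongr
    _ = _ := by ring

lemma aestronglyMeasurable_dirSymbol (v : E3) {F : E3 → C3} (hF : AEStronglyMeasurable F volume) :
    AEStronglyMeasurable (dirSymbol v F) volume := by
  have : Continuous fun ξ : E3 => (2 * Real.pi * Complex.I * (inner ℝ ξ v : ℝ) : ℂ) := by fun_prop
  exact this.aestronglyMeasurable.smul hF

lemma integrable_dirSymbol (v : E3) {F : E3 → C3} (hF : AEStronglyMeasurable F volume)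
    (h1 : Integrable fun ξ => ‖ξ‖ * ‖F ξ‖) : Integrable (dirSymbol v F) := by
  refine Integrable.mono' (h1.const_mul (‖v‖ * (2 * Real.pi))) (aestronglyMeasurable_dirSymbol v hF) ?_
  filter_upwards with ξ
  refine (norm_dirSymbol_le v F ξ).trans_eq ?_
  ring

lemma hasFDerivAt_fourierInv {F : E3 → C3} (hF : Integrable F)
    (h1 : Integrable fun ξ => ‖ξ‖ * ‖F ξ‖) (x : E3) :
    ∃ D : E3 →L[ℝ] C3, HasFDerivAt (𝓕⁻ F) D x ∧ ∀ v, D v = 𝓕⁻ (dirSymbol v F) x := by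
  have hint : Integrable (VectorFourier.fourierSMulRight (-innerSL ℝ) F) := by
    refine Integrable.mono' (h1.const_mul (2 * Real.pi * ‖(-innerSL ℝ : E3 →L[ℝ] E3 →L[ℝ] ℝ)‖))
      hF.1.fourierSMulRight ?_
    filter_upwards with ξ
    exact (VectorFourier.norm_fourierSMulRight_le _ _ _).trans_eq (by ring)
  refine ⟨_, VectorFourier.hasFDerivAt_fourierIntegral (-innerSL ℝ) hF h1 x, fun v => ?_⟩
  rw [VectorFourier.fourierIntegral_continuousLinearMap_apply Real.continuous_fourierChar hint]
  change _ = VectorFourier.fourierIntegral _ _ (-innerₗ E3) _ x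
  have : (-innerSL ℝ : E3 →L[ℝ] E3 →L[ℝ] ℝ).toLinearMap₁₂ = -innerₗ E3 := by
    ext; simp
  rw [this]
  congr 1
  ext ξ i
  have e : (-innerSL ℝ : E3 →L[ℝ] E3 →L[ℝ] ℝ) ξ v = -inner ℝ ξ v := rfl
  rw [VectorFourier.fourierSMulRight_apply, e]
  simp [dirSymbol]
  ring

lemma hasFDerivAt_synth {F : E3 → C3} (hF : Integrable F)
    (h1 : Integrable fun ξ => ‖ξ‖ * ‖F ξ‖) (x : E3) :
    HasFDerivAt (synth F) (fderiv ℝ (synth F) x) x := by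
  obtain ⟨D, hD, -⟩ := hasFDerivAt_fourierInv hF h1 x
  exact (realPartCLM.hasFDerivAt.comp x hD).differentiableAt.hasFDerivAt

lemma fderiv_synth {F : E3 → C3} (hF : Integrable F)
    (h1 : Integrable fun ξ => ‖ξ‖ * ‖F ξ‖) (x v : E3) :
    fderiv ℝ (synth F) x v = synth (dirSymbol v F) x := by
  obtain ⟨D, hD, hv⟩ := hasFDerivAt_fourierInv hF h1 x
  have : HasFDerivAt (synth F) (realPartCLM.comp D) x := realPartCLM.hasFDerivAt.comp x hD
  rw [this.fderiv, ContinuousLinearMap.comp_apply, hv]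
  rfl

lemma norm_fderiv_synth_le {F : E3 → C3} (hF : Integrable F)
    (h1 : Integrable fun ξ => ‖ξ‖ * ‖F ξ‖) (x : E3) :
    ‖fderiv ℝ (synth F) x‖ ≤ 2 * Real.pi * ∫ ξ, ‖ξ‖ * ‖F ξ‖ := by
  refine ContinuousLinearMap.opNorm_le_bound _ (by positivity) fun v => ?_
  rw [fderiv_synth hF h1]
  refine (norm_synth_le _ _).trans ?_
  rw [← integral_const_mul, ← integral_mul_const]
  refine integral_mono (integrable_dirSymbol v hF.1 h1).norm ((h1.const_mul _).mul_const _) fun ξ => ?_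
  refine (norm_dirSymbol_le v F ξ).trans_eq ?_
  ring

/-! ### Multiplication operators in frequency -/

lemma integral_norm_mul_norm_le {X V W : Type*} [MeasurableSpace X] {ν : Measure X}
    [NormedAddCommGroup V] [NormedAddCommGroup W] {f : X → V} {g : X → W}
    (hf : MemLp f 2 ν) (hg : MemLp g 2 ν) :
    Integrable (fun x => ‖f x‖ * ‖g x‖) ν ∧
      ∫ x, ‖f x‖ * ‖g x‖ ∂ν ≤ (eLpNorm f 2 ν).toReal * (eLpNorm g 2 ν).toReal := by
  refine ⟨hf.norm.integrable_mul hg.norm, ?_⟩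
  have h := abs_real_inner_le_norm (hf.norm.toLp) (hg.norm.toLp)
  rw [Lp.norm_toLp, Lp.norm_toLp, eLpNorm_norm, eLpNorm_norm, L2.inner_def] at h
  refine le_trans (le_trans (le_of_eq ?_) (le_abs_self _)) h
  refine integral_congr_ae ?_
  filter_upwards [hf.norm.coeFn_toLp, hg.norm.coeFn_toLp] with x hx hy
  rw [hx, hy]
  simp [mul_comm]

lemma memLp_smul_of_bdd {m : E3 → ℝ} (hm : Measurable m) {C : ℝ} (hC : ∀ ξ, |m ξ| ≤ C) (F : LC) :
    MemLp (fun ξ => m ξ • F ξ) 2 volume := by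
  refine (Lp.memLp F).of_le_mul (c := C) (hm.aestronglyMeasurable.smul (Lp.aestronglyMeasurable F)) ?_
  filter_upwards with ξ
  rw [norm_smul, Real.norm_eq_abs]
  gcongr
  exact hC ξ

/-- Multiplication by a bounded measurable real function. -/
def mulOp (m : E3 → ℝ) (hm : Measurable m) (C : ℝ) (hC : ∀ ξ, |m ξ| ≤ C) : LC →L[ℝ] LC :=
  LinearMap.mkContinuous
    { toFun := fun F => (memLp_smul_of_bdd hm hC F).toLp
      map_add' := fun F G => by
        refine Lp.ext ?_
        filter_upwards [(memLp_smul_of_bdd hm hC (F + G)).coeFn_toLp,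
          (memLp_smul_of_bdd hm hC F).coeFn_toLp, (memLp_smul_of_bdd hm hC G).coeFn_toLp,
          Lp.coeFn_add F G, Lp.coeFn_add (memLp_smul_of_bdd hm hC F).toLp
          (memLp_smul_of_bdd hm hC G).toLp] with ξ h1 h2 h3 h4 h5
        rw [h1, h5, Pi.add_apply, h2, h3, h4, Pi.add_apply, smul_add]
      map_smul' := fun c F => by
        refine Lp.ext ?_
        filter_upwards [(memLp_smul_of_bdd hm hC (c • F)).coeFn_toLp,
          (memLp_smul_of_bdd hm hC F).coeFn_toLp,
          Lp.coeFn_smul c F, Lp.coeFn_smul c (memLp_smul_of_bdd hm hC F).toLp] with ξ h1 h2 h3 h4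
        rw [h1, RingHom.id_apply, h4, Pi.smul_apply, h2, h3, Pi.smul_apply, smul_comm] }
    C fun F => by
      have hC0 : 0 ≤ C := (abs_nonneg _).trans (hC 0)
      refine Lp.norm_le_mul_norm_of_ae_le_mul ?_
      filter_upwards [(memLp_smul_of_bdd hm hC F).coeFn_toLp] with ξ h
      simp only [LinearMap.coe_mk, AddHom.coe_mk]
      rw [h, norm_smul, Real.norm_eq_abs]
      gcongr
      exact hC ξ

lemma coeFn_mulOp (m : E3 → ℝ) (hm : Measurable m) (C : ℝ) (hC : ∀ ξ, |m ξ| ≤ C) (F : LC) :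
    mulOp m hm C hC F =ᵐ[volume] fun ξ => m ξ • F ξ :=
  (memLp_smul_of_bdd hm hC F).coeFn_toLp

lemma inner_mulOp_left (m : E3 → ℝ) (hm : Measurable m) (C : ℝ) (hC : ∀ ξ, |m ξ| ≤ C) (F G : LC) :
    inner ℝ (mulOp m hm C hC F) G = inner ℝ F (mulOp m hm C hC G) := by
  rw [L2.inner_def, L2.inner_def]
  refine integral_congr_ae ?_
  filter_upwards [coeFn_mulOp m hm C hC F, coeFn_mulOp m hm C hC G] with ξ h1 h2
  rw [h1, h2, real_inner_smul_left, real_inner_smul_right]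

/-! ### Derivatives of synthesized fields -/

lemma eLpNorm_synth_le {F : E3 → C3} (hF : Integrable F) (h2 : MemLp F 2) :
    eLpNorm (synth F) 2 volume ≤ eLpNorm F 2 volume := by
  have h : eLpNorm (synth F) 2 volume ≤ eLpNorm (𝓕⁻ F) 2 volume :=
    eLpNorm_mono fun x => norm_realPart_le _
  refine h.trans_eq ?_
  rw [← eLpNorm_congr_ae (fourierInv_ae_eq hF h2)]
  have e : ‖(𝓕⁻ (h2.toLp F) : LC)‖ = ‖h2.toLp F‖ := (Lp.fourierTransformₗᵢ E3 C3).symm.norm_map _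
  rw [Lp.norm_def, Lp.norm_def] at e
  rw [(ENNReal.toReal_eq_toReal_iff' (Lp.eLpNorm_ne_top _) (Lp.eLpNorm_ne_top _)).1 e]
  exact eLpNorm_congr_ae h2.coeFn_toLp

lemma memLp_synth {F : E3 → C3} (hF : Integrable F) (h2 : MemLp F 2) : MemLp (synth F) 2 volume :=
  ⟨(continuous_synth hF).aestronglyMeasurable, (eLpNorm_synth_le hF h2).trans_lt h2.2⟩

lemma norm_clm_le_sum (D : E3 →L[ℝ] E3) :
    ‖D‖ ≤ ∑ j : Fin 3, ‖D (EuclideanSpace.single j 1)‖ := by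
  refine ContinuousLinearMap.opNorm_le_bound _ (by positivity) fun v => ?_
  have hv : v = ∑ j : Fin 3, v j • (EuclideanSpace.single j (1 : ℝ) : E3) := by
    ext i
    fin_cases i <;> simp [Fin.sum_univ_three]
  conv_lhs => rw [hv, map_sum]
  refine (norm_sum_le _ _).trans ?_
  rw [Finset.sum_mul]
  refine Finset.sum_le_sum fun j _ => ?_
  rw [map_smul, norm_smul, mul_comm]
  gcongr
  exact PiLp.norm_apply_le v j

lemma measurable_fderiv_synth (F : E3 → C3) :
    AEStronglyMeasurable (fderiv ℝ (synth F)) volume :=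
  (measurable_fderiv ℝ (synth F)).aestronglyMeasurable

/-- Plancherel for each coordinate derivative, with `|ξ_j| ≤ |ξ|`; the factor 3 counts the
directions. -/
lemma eLpNorm_fderiv_synth_le {F : E3 → C3} (hF : Integrable F)
    (h1 : Integrable fun ξ => ‖ξ‖ * ‖F ξ‖) (h2 : MemLp (fun ξ => (2 * Real.pi * ‖ξ‖) • F ξ) 2) :
    eLpNorm (fderiv ℝ (synth F)) 2 volume
      ≤ 3 * eLpNorm (fun ξ => (2 * Real.pi * ‖ξ‖) • F ξ) 2 volume := by
  have hle : ∀ j : Fin 3, ∀ ξ, ‖dirSymbol (EuclideanSpace.single j 1) F ξ‖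
      ≤ ‖(2 * Real.pi * ‖ξ‖) • F ξ‖ := fun j ξ => by
    refine (norm_dirSymbol_le _ F ξ).trans_eq ?_
    rw [norm_smul, Real.norm_of_nonneg (by positivity)]
    simp
  have hm : ∀ j : Fin 3, MemLp (dirSymbol (EuclideanSpace.single j 1) F) 2 volume := fun j =>
    h2.mono (aestronglyMeasurable_dirSymbol _ hF.1) (ae_of_all _ (hle j))
  have hi : ∀ j : Fin 3, Integrable (dirSymbol (EuclideanSpace.single j 1) F) volume := fun j =>
    integrable_dirSymbol _ hF.1 h1
  calc eLpNorm (fderiv ℝ (synth F)) 2 volume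
      ≤ eLpNorm (fun x => ∑ j : Fin 3, ‖synth (dirSymbol (EuclideanSpace.single j 1) F) x‖) 2 volume := by
        refine eLpNorm_mono_real fun x => ?_
        refine (norm_clm_le_sum _).trans_eq ?_
        simp_rw [fderiv_synth hF h1]
    _ ≤ ∑ j : Fin 3, eLpNorm (fun x => ‖synth (dirSymbol (EuclideanSpace.single j 1) F) x‖) 2 volume := by
        have := eLpNorm_sum_le (μ := volume) (p := 2) (s := Finset.univ)
          (f := fun (j : Fin 3) x => ‖synth (dirSymbol (EuclideanSpace.single j 1) F) x‖)
          (fun j _ => (continuous_synth (hi j)).norm.aestronglyMeasurable) (by norm_num)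
        refine le_trans (le_of_eq ?_) this
        congr 1
    _ ≤ ∑ j : Fin 3, eLpNorm (fun ξ => (2 * Real.pi * ‖ξ‖) • F ξ) 2 volume := by
        refine Finset.sum_le_sum fun j _ => ?_
        rw [eLpNorm_norm]
        exact (eLpNorm_synth_le (hi j) (hm j)).trans (eLpNorm_mono (hle j))
    _ = _ := by simp

lemma contDiff_synth {N : ℕ∞} {F : E3 → C3}
    (h : ∀ n : ℕ, (n : ℕ∞) ≤ N → Integrable fun ξ => ‖ξ‖ ^ n * ‖F ξ‖) :
    ContDiff ℝ N (synth F) := by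
  have h1 := Real.contDiff_fourier h
  have h2 : synth F = fun x => realPartCLM (𝓕 F (-x)) := by
    ext1 x
    rw [synth, Real.fourierInv_eq_fourier_neg]
    rfl
  rw [h2]
  exact realPartCLM.contDiff.comp (h1.comp contDiff_neg)

/-! ### The weight -/

/-- The weight `(1 + |ξ|²)^{-(α+2)}`. -/
def wt (α : ℝ) (ξ : E3) : ℝ := (1 + ‖ξ‖ ^ 2) ^ (-(α + 2))

lemma wt_pos (α : ℝ) (ξ : E3) : 0 < wt α ξ := by unfold wt; positivity

lemma continuous_wt (α : ℝ) : Continuous (wt α) := by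
  unfold wt
  refine Continuous.rpow_const (by fun_prop) fun ξ => Or.inl ?_
  positivity

lemma wt_le (α : ℝ) (hα : 0 ≤ α) (ξ : E3) : wt α ξ ≤ (1 + ‖ξ‖ ^ 2) ^ (-(2 : ℝ)) := by
  unfold wt
  exact Real.rpow_le_rpow_of_exponent_le (by nlinarith [sq_nonneg ‖ξ‖]) (by linarith)

lemma wt_le_one (α : ℝ) (hα : 0 ≤ α) (ξ : E3) : wt α ξ ≤ 1 :=
  Real.rpow_le_one_of_one_le_of_nonpos (by nlinarith [sq_nonneg ‖ξ‖]) (by linarith)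

/-- First requirement on the weight. The square is at most `2 (1+|ξ|²)^{-3}`, which is integrable on
`ℝ³`. By Cauchy–Schwarz the field with density `wt α • E` then has a bounded gradient for every
square integrable `E`. -/
lemma memLp_norm_wt (α : ℝ) (hα : 0 ≤ α) : MemLp (fun ξ => (1 + ‖ξ‖) * wt α ξ) 2 volume := by
  have hmeas : AEStronglyMeasurable (fun ξ => (1 + ‖ξ‖) * wt α ξ) volume :=
    ((by fun_prop : Continuous fun ξ : E3 => 1 + ‖ξ‖).mul (continuous_wt α)).aestronglyMeasurable
  rw [memLp_two_iff_integrable_sq_norm hmeas]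
  have hint : Integrable (fun ξ : E3 => (1 + ‖ξ‖ ^ 2) ^ (-(6 : ℝ) / 2)) volume :=
    integrable_rpow_neg_one_add_norm_sq (by simp; norm_num)
  refine (hint.const_mul 2).mono' (hmeas.norm.pow 2) ?_
  filter_upwards with ξ
  have hp : (0 : ℝ) < 1 + ‖ξ‖ ^ 2 := by positivity
  have h1 := wt_le α hα ξ
  have h0 := (wt_pos α ξ).le
  rw [norm_pow, norm_norm, norm_mul, Real.norm_of_nonneg h0, Real.norm_of_nonneg (by positivity)]
  have h2 : ((1 + ‖ξ‖ ^ 2) ^ (-(6 : ℝ) / 2)) = (1 + ‖ξ‖ ^ 2) * ((1 + ‖ξ‖ ^ 2) ^ (-(2 : ℝ))) ^ 2 := by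
    rw [← Real.rpow_mul_natCast hp.le, ← Real.rpow_one_add' hp.le (by norm_num)]
    norm_num
  rw [h2, mul_pow, ← mul_assoc]
  gcongr
  nlinarith [sq_nonneg (‖ξ‖ - 1)]

/-- Second requirement on the weight: it absorbs the order `2α` of the dissipation, so that `dissOp`
is bounded on `LC`. -/
lemma riesz_mul_wt_le (α : ℝ) (hα : 0 ≤ α) (ξ : E3) :
    (2 * Real.pi * ‖ξ‖) ^ (2 * α) * wt α ξ ≤ (2 * Real.pi) ^ (2 * α) := by
  have hp : (1 : ℝ) ≤ 1 + ‖ξ‖ ^ 2 := by nlinarith [sq_nonneg ‖ξ‖]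
  rw [Real.mul_rpow (by positivity) (norm_nonneg _), mul_assoc]
  refine mul_le_of_le_one_right (by positivity) ?_
  have h1 : ‖ξ‖ ^ (2 * α) ≤ (1 + ‖ξ‖ ^ 2) ^ α := by
    rw [Real.rpow_mul (norm_nonneg _)]
    refine Real.rpow_le_rpow (by positivity) ?_ hα
    norm_num
  calc ‖ξ‖ ^ (2 * α) * wt α ξ ≤ (1 + ‖ξ‖ ^ 2) ^ α * (1 + ‖ξ‖ ^ 2) ^ (-(α + 2)) := by
        unfold wt; gcongr
    _ = (1 + ‖ξ‖ ^ 2) ^ (-(2 : ℝ)) := by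
        rw [← Real.rpow_add (by positivity)]; congr 1; ring
    _ ≤ 1 := Real.rpow_le_one_of_one_le_of_nonpos hp (by norm_num)

/-- The density `(1 + |ξ|²)^{-(α+2)} E(ξ)`. -/
def wtDensity (α : ℝ) (E : LC) (ξ : E3) : C3 := wt α ξ • E ξ

lemma memLp_wt (α : ℝ) (hα : 0 ≤ α) : MemLp (wt α) 2 volume := by
  refine (memLp_norm_wt α hα).mono (continuous_wt α).aestronglyMeasurable (ae_of_all _ fun ξ => ?_)
  rw [norm_mul, Real.norm_of_nonneg (by positivity : (0 : ℝ) ≤ 1 + ‖ξ‖)]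
  exact le_mul_of_one_le_left (norm_nonneg _) (by linarith [norm_nonneg ξ])

lemma aestronglyMeasurable_wtDensity (α : ℝ) (E : LC) :
    AEStronglyMeasurable (wtDensity α E) volume :=
  (continuous_wt α).aestronglyMeasurable.smul (Lp.aestronglyMeasurable E)

lemma integrable_wtDensity (α : ℝ) (hα : 0 ≤ α) (E : LC) : Integrable (wtDensity α E) := by
  refine (integral_norm_mul_norm_le (memLp_wt α hα) (Lp.memLp E)).1.mono'
    (aestronglyMeasurable_wtDensity α E) (ae_of_all _ fun ξ => ?_)
  rw [wtDensity, norm_smul]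

lemma norm_mul_wtDensity_le (α : ℝ) (E : LC) (ξ : E3) :
    ‖ξ‖ * ‖wtDensity α E ξ‖ ≤ ‖(1 + ‖ξ‖) * wt α ξ‖ * ‖E ξ‖ := by
  rw [wtDensity, norm_smul, norm_mul, Real.norm_of_nonneg (by positivity : (0 : ℝ) ≤ 1 + ‖ξ‖),
    ← mul_assoc]
  gcongr
  linarith

lemma integrable_norm_mul_wtDensity (α : ℝ) (hα : 0 ≤ α) (E : LC) :
    Integrable fun ξ => ‖ξ‖ * ‖wtDensity α E ξ‖ := by
  refine (integral_norm_mul_norm_le (memLp_norm_wt α hα) (Lp.memLp E)).1.mono'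
    (continuous_norm.aestronglyMeasurable.mul (aestronglyMeasurable_wtDensity α E).norm)
    (ae_of_all _ fun ξ => ?_)
  rw [Real.norm_of_nonneg (by positivity)]
  exact norm_mul_wtDensity_le α E ξ

/-- The constant in the bound of the gradient. -/
def gradConst (α : ℝ) : ℝ := 2 * Real.pi * (eLpNorm (fun ξ : E3 => (1 + ‖ξ‖) * wt α ξ) 2 volume).toReal

/-- This uniform bound makes the nonlinear term a bounded functional of `E` when the velocities are
merely in `L²`. -/
lemma norm_fderiv_synth_wt_le (α : ℝ) (hα : 0 ≤ α) (E : LC) (x : E3) :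
    ‖fderiv ℝ (synth (wtDensity α E)) x‖ ≤ gradConst α * ‖E‖ := by
  refine (norm_fderiv_synth_le (integrable_wtDensity α hα E)
    (integrable_norm_mul_wtDensity α hα E) x).trans ?_
  rw [gradConst, mul_assoc (2 * Real.pi)]
  refine mul_le_mul_of_nonneg_left ?_ (by positivity)
  have h := integral_norm_mul_norm_le (memLp_norm_wt α hα) (Lp.memLp E)
  rw [Lp.norm_def]
  exact (integral_mono (integrable_norm_mul_wtDensity α hα E) h.1
    (norm_mul_wtDensity_le α E)).trans h.2

lemma memLp_wtDensity (α : ℝ) (hα : 0 ≤ α) (E : LC) : MemLp (wtDensity α E) 2 volume :=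
  memLp_smul_of_bdd (continuous_wt α).measurable
    (fun ξ => by rw [abs_of_pos (wt_pos α ξ)]; exact wt_le_one α hα ξ) E

lemma synth_congr_ae {F G : E3 → C3} (h : F =ᵐ[volume] G) : synth F = synth G := by
  ext1 x
  rw [synth, synth, Real.fourierInv_congr_ae h]

lemma synth_add {F G : E3 → C3} (hF : Integrable F) (hG : Integrable G) :
    synth (F + G) = synth F + synth G := by
  ext1 x
  have : 𝓕⁻ (F + G) x = 𝓕⁻ F x + 𝓕⁻ G x :=
    congrFun (VectorFourier.fourierIntegral_add Real.continuous_fourierChar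
      continuous_neg_innerₗ hF hG) x
  rw [synth, this, Pi.add_apply, synth, synth, ← realPartCLM_apply, map_add]
  rfl

lemma synth_smul (c : ℝ) (F : E3 → C3) : synth (c • F) = c • synth F := by
  ext1 x
  have h : 𝓕⁻ (c • F) x = c • 𝓕⁻ F x := by
    rw [Real.fourierInv_eq, Real.fourierInv_eq, ← integral_smul]
    refine integral_congr_ae (ae_of_all _ fun ξ => ?_)
    simp only [Pi.smul_apply]
    rw [smul_comm]
  rw [synth, h, Pi.smul_apply, synth, ← realPartCLM_apply, map_smul]
  rfl

lemma wtDensity_add (α : ℝ) (E G : LC) :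
    wtDensity α (E + G) =ᵐ[volume] wtDensity α E + wtDensity α G := by
  filter_upwards [Lp.coeFn_add E G] with ξ h
  simp only [wtDensity, Pi.add_apply]
  rw [h, Pi.add_apply, smul_add]

lemma wtDensity_smul (α : ℝ) (c : ℝ) (E : LC) :
    wtDensity α (c • E) =ᵐ[volume] c • wtDensity α E := by
  filter_upwards [Lp.coeFn_smul c E] with ξ h
  simp only [wtDensity, h, Pi.smul_apply]
  rw [smul_comm]

/-! ### The trilinear form -/

/-- The trilinear form `∫ (u·∇)φ · v`. -/
def trilin (φ : E3 → E3) (u v : E3 → E3) : ℝ := ∫ x, inner ℝ (fderiv ℝ φ x (u x)) (v x)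

lemma integrable_trilin {φ : E3 → E3} (hφ : AEStronglyMeasurable (fderiv ℝ φ) volume) {C : ℝ}
    (hC : ∀ x, ‖fderiv ℝ φ x‖ ≤ C) {u v : E3 → E3} (hu : MemLp u 2 volume) (hv : MemLp v 2 volume) :
    Integrable (fun x => inner ℝ (fderiv ℝ φ x (u x)) (v x)) := by
  refine ((integral_norm_mul_norm_le hu hv).1.const_mul C).mono' ?_ (ae_of_all _ fun x => ?_)
  · have h1 : AEStronglyMeasurable (fun x => fderiv ℝ φ x (u x)) volume :=
      Continuous.comp_aestronglyMeasurable
        (g := fun p : (E3 →L[ℝ] E3) × E3 => p.1 p.2) (by fun_prop) (hφ.prodMk hu.1)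
    exact h1.inner (𝕜 := ℝ) hv.1
  · refine (norm_inner_le_norm (𝕜 := ℝ) _ _).trans ?_
    calc _ ≤ ‖fderiv ℝ φ x‖ * ‖u x‖ * ‖v x‖ := by gcongr; exact ContinuousLinearMap.le_opNorm _ _
      _ ≤ C * ‖u x‖ * ‖v x‖ := by gcongr; exact hC x
      _ = _ := by ring

lemma abs_trilin_le {φ : E3 → E3} {C : ℝ}
    (hC : ∀ x, ‖fderiv ℝ φ x‖ ≤ C) {u v : E3 → E3} (hu : MemLp u 2 volume) (hv : MemLp v 2 volume) :
    |trilin φ u v| ≤ C * ((eLpNorm u 2 volume).toReal * (eLpNorm v 2 volume).toReal) := by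
  have h := integral_norm_mul_norm_le hu hv
  have hC0 : 0 ≤ C := (norm_nonneg _).trans (hC 0)
  refine (norm_integral_le_of_norm_le (f := fun x => (inner ℝ (fderiv ℝ φ x (u x)) (v x) : ℝ))
    (h.1.const_mul C) (ae_of_all _ fun x => ?_)).trans ?_
  · refine (norm_inner_le_norm (𝕜 := ℝ) _ _).trans ?_
    calc _ ≤ ‖fderiv ℝ φ x‖ * ‖u x‖ * ‖v x‖ := by gcongr; exact ContinuousLinearMap.le_opNorm _ _
      _ ≤ C * ‖u x‖ * ‖v x‖ := by gcongr; exact hC x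
      _ = _ := by ring
  · rw [integral_const_mul]
    gcongr
    exact h.2

/-! ### Evolution equations in a Hilbert space -/

lemma locallyIntegrable_of_bdd {H : Type*} [NormedAddCommGroup H] {g : ℝ → H}
    (hg : AEStronglyMeasurable g volume) {C : ℝ}
    (hC : ∀ᵐ t, ‖g t‖ ≤ C) : LocallyIntegrable g volume := by
  have : MemLp g ⊤ volume := memLp_top_of_bound hg C hC
  exact this.locallyIntegrable le_top

lemma intervalIntegrable_of_bdd {H : Type*} [NormedAddCommGroup H] {g : ℝ → H}
    (hg : AEStronglyMeasurable g volume) {C : ℝ}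
    (hC : ∀ᵐ t, ‖g t‖ ≤ C) (a b : ℝ) : IntervalIntegrable g volume a b :=
  intervalIntegrable_iff.2 (((locallyIntegrable_of_bdd hg hC).integrableOn_isCompact
    isCompact_uIcc).mono_set Set.uIoc_subset_uIcc)

section Evolution

variable {H : Type*} [NormedAddCommGroup H] [InnerProductSpace ℝ H]

/-- The primitive of `g` with initial value `v₀`. -/
def primitive (v₀ : H) (g : ℝ → H) (t : ℝ) : H := v₀ + ∫ τ in (0 : ℝ)..t, g τ

lemma norm_primitive_sub_le {g : ℝ → H} (hg : AEStronglyMeasurable g volume) {C : ℝ}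
    (hC : ∀ᵐ t, ‖g t‖ ≤ C) (v₀ : H) (s t : ℝ) :
    ‖primitive v₀ g s - primitive v₀ g t‖ ≤ C * |s - t| := by
  have hi := intervalIntegrable_of_bdd hg hC
  rw [primitive, primitive, add_sub_add_left_eq_sub,
    intervalIntegral.integral_interval_sub_left (hi _ _) (hi _ _)]
  exact intervalIntegral.norm_integral_le_of_norm_le_const_ae (hC.mono fun x hx _ => hx)

lemma continuous_primitive {g : ℝ → H} (hg : AEStronglyMeasurable g volume) {C : ℝ}
    (hC : ∀ᵐ t, ‖g t‖ ≤ C) (v₀ : H) : Continuous (primitive v₀ g) :=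
  continuous_const.add
    (intervalIntegral.continuous_primitive (intervalIntegrable_of_bdd hg hC) 0)

lemma hasDerivAt_primitive [CompleteSpace H] {g : ℝ → H} (hg : AEStronglyMeasurable g volume) {C : ℝ}
    (hC : ∀ᵐ t, ‖g t‖ ≤ C) (v₀ : H) : ∀ᵐ t, HasDerivAt (primitive v₀ g) (g t) t := by
  filter_upwards [LocallyIntegrable.ae_hasDerivAt_integral (locallyIntegrable_of_bdd hg hC)] with t ht
  exact (ht 0).const_add v₀

lemma lipschitz_absolutelyContinuous {f : ℝ → ℝ} {a b K : ℝ}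
    (hf : ∀ s ∈ Set.uIcc a b, ∀ t ∈ Set.uIcc a b, |f s - f t| ≤ K * |s - t|) :
    AbsolutelyContinuousOnInterval f a b := by
  refine LipschitzOnWith.absolutelyContinuousOnInterval (K := K.toNNReal) ?_
  refine LipschitzOnWith.of_dist_le_mul fun s hs t ht => ?_
  rw [Real.dist_eq, Real.dist_eq]
  refine (hf s hs t ht).trans ?_
  gcongr
  exact Real.le_coe_toNNReal K

/-- The energy identity for primitives. -/
theorem norm_sq_primitive [CompleteSpace H] {g : ℝ → H} (hg : AEStronglyMeasurable g volume) {C : ℝ}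
    (hC : ∀ᵐ t, ‖g t‖ ≤ C) (v₀ : H) (t : ℝ) :
    ‖primitive v₀ g t‖ ^ 2
      = ‖v₀‖ ^ 2 + 2 * ∫ τ in (0 : ℝ)..t, inner ℝ (g τ) (primitive v₀ g τ) := by
  have hcont := continuous_primitive hg hC v₀
  obtain ⟨M, hM⟩ := (isCompact_uIcc (a := (0 : ℝ)) (b := t)).exists_bound_of_continuousOn
    hcont.continuousOn
  have hM0 : 0 ≤ M := (norm_nonneg _).trans (hM 0 Set.left_mem_uIcc)
  -- The squared norm is Lipschitz on the interval. The fundamental theorem for absolutely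
  -- continuous functions then needs the derivative only almost everywhere, which is all that a
  -- bounded measurable `g` provides.
  have hac : AbsolutelyContinuousOnInterval (fun τ => ‖primitive v₀ g τ‖ ^ 2) 0 t := by
    refine lipschitz_absolutelyContinuous (K := 2 * M * C) fun r hr s hs => ?_
    have h1 := norm_primitive_sub_le hg hC v₀ r s
    have h2 := abs_norm_sub_norm_le (primitive v₀ g r) (primitive v₀ g s)
    have h3 : |‖primitive v₀ g r‖ + ‖primitive v₀ g s‖| ≤ 2 * M := by
      rw [abs_of_nonneg (by positivity)]
      linarith [hM r hr, hM s hs]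
    rw [sq_sub_sq, abs_mul, mul_assoc]
    exact mul_le_mul h3 (h2.trans h1) (abs_nonneg _) (by positivity)
  have h := hac.integral_deriv_eq_sub
  have h0 : primitive v₀ g 0 = v₀ := by simp [primitive]
  rw [h0] at h
  rw [← intervalIntegral.integral_const_mul]
  rw [← sub_eq_iff_eq_add', ← h]
  refine intervalIntegral.integral_congr_ae ?_
  filter_upwards [hasDerivAt_primitive hg hC v₀] with τ hτ _
  rw [hτ.norm_sq.deriv, real_inner_comm]

/-! ### Bounded weak solutions on the time interval are primitives -/

lemma isOpen_timeInterval (T : ℝ≥0∞) : IsOpen (timeInterval T) :=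
  (isOpen_lt continuous_const continuous_id).inter
    (isOpen_lt ENNReal.continuous_ofReal continuous_const)

lemma Ioc_subset_timeInterval {T : ℝ≥0∞} {b : ℝ} (hb : ENNReal.ofReal b < T) :
    Set.Ioc 0 b ⊆ timeInterval T := fun _ ht =>
  ⟨ht.1, (ENNReal.ofReal_le_ofReal ht.2).trans_lt hb⟩

/-- A smooth compactly supported function on `(0,T)` is on `[0,∞)` the derivative of a smooth
function with compact support in `(-∞,T)`. -/
lemma exists_antiderivative {T : ℝ≥0∞} (hT : 0 < T) {ζ : ℝ → ℝ} (hζ : ContDiff ℝ ∞ ζ)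
    (hc : HasCompactSupport ζ) (hs : tsupport ζ ⊆ timeInterval T) :
    ∃ η : ℝ → ℝ, ∃ b : ℝ, 0 ≤ b ∧ ENNReal.ofReal b < T ∧ ContDiff ℝ ∞ η ∧ HasCompactSupport η ∧
      (∀ t ∈ tsupport η, ENNReal.ofReal t < T) ∧ (∀ t, 0 < t → deriv η t = ζ t) ∧
      (∀ t, b ≤ t → η t = 0) ∧ (∀ t, b < t → ζ t = 0) := by
  obtain ⟨b, hb0, hbT, hb⟩ : ∃ b : ℝ, 0 ≤ b ∧ ENNReal.ofReal b < T ∧ ∀ t ∈ tsupport ζ, t ≤ b := by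
    by_cases hne : (tsupport ζ).Nonempty
    · have hmem := hc.isCompact.sSup_mem hne
      exact ⟨_, (hs hmem).1.le, (hs hmem).2, fun t ht => le_csSup hc.isCompact.bddAbove ht⟩
    · refine ⟨0, le_rfl, by simpa using hT, fun t ht => ?_⟩
      exact (hne ⟨t, ht⟩).elim
  have hζb : ∀ t, b < t → ζ t = 0 := fun t ht => by
    by_contra h
    exact absurd (hb t (subset_tsupport _ h)) (not_le.2 ht)
  -- Normalised to vanish at `b`, and hence on `[b,∞)`, where `ζ` has ended.
  set P : ℝ → ℝ := fun t => (∫ τ in (0 : ℝ)..t, ζ τ) - ∫ τ in (0 : ℝ)..b, ζ τ with hP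
  have hPd : ∀ t, HasDerivAt P (ζ t) t := fun t =>
    (intervalIntegral.integral_hasDerivAt_right (hζ.continuous.intervalIntegrable _ _)
      (hζ.continuous.stronglyMeasurableAtFilter _ _) hζ.continuous.continuousAt).sub_const _
  have hPs : ContDiff ℝ ∞ P := by
    refine contDiff_infty_iff_deriv.2 ⟨fun t => (hPd t).differentiableAt, ?_⟩
    rwa [show deriv P = ζ from funext fun t => (hPd t).deriv]
  have hPb : ∀ t, b ≤ t → P t = 0 := fun t ht => by
    simp only [hP]
    rw [intervalIntegral.integral_interval_sub_left (hζ.continuous.intervalIntegrable _ _)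
      (hζ.continuous.intervalIntegrable _ _)]
    refine intervalIntegral.integral_zero_ae (ae_of_all _ fun τ hτ => hζb τ ?_)
    rw [Set.uIoc_of_le ht] at hτ
    exact hτ.1
  -- To the left of 0 the primitive is in general a non-zero constant. The transition between `-1`
  -- and `0` cuts it off and changes nothing on `t ≥ 0`; `η 0` is kept, and it carries the initial
  -- value.
  set η : ℝ → ℝ := fun t => Real.smoothTransition (t + 1) * P t with hη
  have hηb : ∀ t, b ≤ t → η t = 0 := fun t ht => by simp [hη, hPb t ht]
  have hsupp : Function.support η ⊆ Set.Icc (-1) b := fun t ht => by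
    refine ⟨?_, ?_⟩
    · by_contra h
      exact ht (by simp [hη, Real.smoothTransition.zero_of_nonpos (by linarith : t + 1 ≤ 0)])
    · by_contra h
      exact ht (hηb t (not_le.1 h).le)
  have hts : tsupport η ⊆ Set.Icc (-1) b := closure_minimal hsupp isClosed_Icc
  refine ⟨η, b, hb0, hbT, ?_, HasCompactSupport.of_support_subset_isCompact isCompact_Icc hsupp,
    fun t ht => ?_, fun t ht => ?_, hηb, hζb⟩
  · exact (Real.smoothTransition.contDiff.comp (contDiff_id.add contDiff_const)).mul hPs
  · exact (ENNReal.ofReal_le_ofReal (hts ht).2).trans_lt hbT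
  · have : η =ᶠ[𝓝 t] P := by
      filter_upwards [lt_mem_nhds ht] with s hs
      simp [hη, Real.smoothTransition.one_of_one_le (by linarith : 1 ≤ s + 1)]
    rw [this.deriv_eq, (hPd t).deriv]

/-- A bounded weak solution of `v' = g`, `v(0) = v₀`, on `(0,T)` is the primitive of `g`. -/
theorem ae_eq_primitive [CompleteSpace H] {T : ℝ≥0∞} (hT : 0 < T) {g : ℝ → H} (hg : AEStronglyMeasurable g volume)
    {C : ℝ} (hC : ∀ᵐ t, ‖g t‖ ≤ C) {v : ℝ → H}
    (hv : MemLp v ⊤ (volume.restrict (timeInterval T))) (v₀ : H)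
    (hweak : ∀ η : ℝ → ℝ, ContDiff ℝ ∞ η → HasCompactSupport η →
      (∀ t ∈ tsupport η, ENNReal.ofReal t < T) → ∀ E : H,
      ∫ τ in timeInterval T, (deriv η τ * inner ℝ (v τ) E + η τ * inner ℝ (g τ) E)
        = - (η 0 * inner ℝ v₀ E)) :
    v =ᵐ[volume.restrict (timeInterval T)] primitive v₀ g := by
  have hU := isOpen_timeInterval T
  set V := primitive v₀ g with hVdef
  have hVc : Continuous V := continuous_primitive hg hC v₀
  have hloc : LocallyIntegrableOn (fun t => v t - V t) (timeInterval T) volume := by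
    refine LocallyIntegrableOn.sub ?_ (hVc.locallyIntegrable.locallyIntegrableOn _)
    refine (locallyIntegrableOn_iff hU.isLocallyClosed).2 fun k hk hkc => ?_
    have hvk : MemLp v ⊤ (volume.restrict k) := hv.mono_measure (Measure.restrict_mono hk le_rfl)
    have : IsFiniteMeasure (volume.restrict k) := ⟨by simpa using hkc.measure_lt_top⟩
    exact hvk.integrable le_top
  have key := hU.ae_eq_zero_of_integral_contDiff_smul_eq_zero hloc ?_
  · rw [EventuallyEq, ae_restrict_iff' hU.measurableSet]
    filter_upwards [key] with t ht htU using sub_eq_zero.1 (ht htU)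
  intro ζ hζ hζc hζs
  obtain ⟨η, b, hb0, hbT, hη, hηc, hηT, hηd, hηb, hζb⟩ := exists_antiderivative hT hζ hζc hζs
  have hint : Integrable (fun t => ζ t • (v t - V t)) volume := by
    have h1 := hloc.integrableOn_compact_subset hζs hζc.isCompact
    have h2 : IntegrableOn (fun t => ζ t • (v t - V t)) (tsupport ζ) volume :=
      h1.continuousOn_smul hζ.continuous.continuousOn hζc.isCompact
    refine (integrableOn_iff_integrable_of_support_subset ?_).1 h2
    intro t ht
    refine subset_tsupport _ fun h => ht ?_
    simp [h]
  refine ext_inner_right ℝ fun E => ?_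
  rw [inner_zero_left, real_inner_comm, ← integral_inner hint E]
  have hIoc := Ioc_subset_timeInterval (T := T) hbT
  -- integrability on the bounded interval
  have hvE : IntegrableOn (fun t => inner ℝ (v t) E) (Set.Ioc 0 b) volume := by
    have : MemLp v ⊤ (volume.restrict (Set.Ioc 0 b)) :=
      hv.mono_measure (Measure.restrict_mono hIoc le_rfl)
    exact (this.integrable le_top).inner_const E
  have hgE : IntegrableOn (fun t => inner ℝ (g t) E) (Set.Ioc 0 b) volume := by
    have h := (intervalIntegrable_of_bdd hg hC 0 b).1
    exact Integrable.inner_const h E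
  have hηE : IntegrableOn (fun t => η t * inner ℝ (g t) E) (Set.Ioc 0 b) volume :=
    (hgE.integrable.bdd_mul (c := (hηc.exists_bound_of_continuous hη.continuous).choose)
      hη.continuous.aestronglyMeasurable
      (ae_of_all _ (hηc.exists_bound_of_continuous hη.continuous).choose_spec))
  have hζE : IntegrableOn (fun t => ζ t * inner ℝ (v t) E) (Set.Ioc 0 b) volume :=
    (hvE.integrable.bdd_mul (c := (hζc.exists_bound_of_continuous hζ.continuous).choose)
      hζ.continuous.aestronglyMeasurable
      (ae_of_all _ (hζc.exists_bound_of_continuous hζ.continuous).choose_spec))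
  have hVE : IntegrableOn (fun t => ζ t * inner ℝ (V t) E) (Set.Ioc 0 b) volume :=
    ((hζ.continuous.mul (hVc.inner continuous_const)).continuousOn.integrableOn_Icc).mono_set
      Set.Ioc_subset_Icc_self
  -- The weak equation for `v` and integration by parts for `V` give the same right-hand side.
  -- Subtraction cancels the terms with `g` and leaves `∫ ζ ⟨v − V, E⟩ = 0`.
  have e1 : (∫ t in Set.Ioc 0 b, ζ t * inner ℝ (v t) E) + ∫ t in Set.Ioc 0 b, η t * inner ℝ (g t) E
      = - (η 0 * inner ℝ v₀ E) := by
    rw [← hweak η hη hηc hηT E, ← integral_add hζE hηE]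
    rw [setIntegral_eq_of_subset_of_forall_sdiff_eq_zero hU.measurableSet hIoc]
    · refine setIntegral_congr_fun measurableSet_Ioc fun t ht => ?_
      simp only [hηd t ht.1]
    · intro t ht
      have htb : b < t := by
        by_contra h
        exact ht.2 ⟨ht.1.1, not_lt.1 h⟩
      rw [hηd t ht.1.1, hζb t htb, hηb t htb.le, zero_mul, zero_mul, add_zero]
  have e2 : (∫ t in Set.Ioc 0 b, ζ t * inner ℝ (V t) E) + ∫ t in Set.Ioc 0 b, η t * inner ℝ (g t) E
      = - (η 0 * inner ℝ v₀ E) := by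
    have hac1 : AbsolutelyContinuousOnInterval η 0 b :=
      ContDiffOn.absolutelyContinuousOnInterval ((hη.of_le (by simp)).contDiffOn)
    have hac2 : AbsolutelyContinuousOnInterval (fun t => inner ℝ (V t) E) 0 b := by
      refine lipschitz_absolutelyContinuous (K := C * ‖E‖) fun r _ s _ => ?_
      rw [← inner_sub_left]
      refine (abs_real_inner_le_norm _ _).trans ?_
      rw [mul_right_comm]
      gcongr
      exact norm_primitive_sub_le hg hC v₀ r s
    have h := hac1.integral_deriv_mul_eq_sub hac2
    have hV0 : V 0 = v₀ := by simp [hVdef, primitive]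
    rw [hηb b le_rfl, hV0, zero_mul, zero_sub] at h
    rw [← h, ← integral_add hVE hηE, intervalIntegral.integral_of_le hb0]
    refine setIntegral_congr_ae measurableSet_Ioc ?_
    filter_upwards [hasDerivAt_primitive hg hC v₀] with t ht ht0
    have hd : HasDerivAt (fun t => inner ℝ (V t) E) (inner ℝ (g t) E) t := by
      simpa using ht.inner ℝ (hasDerivAt_const t E)
    rw [hd.deriv, hηd t ht0.1]
  have e3 : ∫ t, inner ℝ E (ζ t • (v t - V t))
      = ∫ t in Set.Ioc 0 b, (ζ t * inner ℝ (v t) E - ζ t * inner ℝ (V t) E) := by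
    rw [← setIntegral_eq_integral_of_forall_compl_eq_zero (s := Set.Ioc 0 b)]
    · refine setIntegral_congr_fun measurableSet_Ioc fun t _ => ?_
      rw [real_inner_smul_right, real_inner_comm, inner_sub_left, mul_sub]
    · intro t ht
      have : ζ t = 0 := by
        by_contra h
        have hm := hζs (subset_tsupport _ h)
        by_cases htb : t ≤ b
        · exact ht ⟨hm.1, htb⟩
        · exact h (hζb t (not_le.1 htb))
      simp [this]
  rw [e3, integral_sub hζE hVE]
  linarith

end Evolution

/-! ### Density of compactly supported smooth functions in the Schwartz space -/

/-- Derivatives of a bump have compact support, and the constant `-1` contributes only at order 0,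
at most 1. -/
lemma exists_bound_iteratedFDeriv_bump_sub_one (χ : ContDiffBump (0 : E3)) (i : ℕ) :
    ∃ B : ℝ, 0 ≤ B ∧ ∀ x, ‖iteratedFDeriv ℝ i (fun y => χ y - 1) x‖ ≤ B := by
  have hc : HasCompactSupport (iteratedFDeriv ℝ i χ) := χ.hasCompactSupport.iteratedFDeriv i
  have hχ : ContDiff ℝ i χ := χ.contDiff
  obtain ⟨B, hB⟩ := hc.exists_bound_of_continuous (hχ.continuous_iteratedFDeriv le_rfl)
  refine ⟨B + 1, ?_, fun x => ?_⟩
  · linarith [(norm_nonneg _).trans (hB 0)]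
  have h : (fun y => χ y - 1) = (χ : E3 → ℝ) + fun _ => (-1 : ℝ) := by
    ext y; simp [sub_eq_add_neg]
  rw [h, iteratedFDeriv_add_apply hχ.contDiffAt contDiff_const.contDiffAt]
  refine (norm_add_le _ _).trans (add_le_add (hB x) ?_)
  rcases Nat.eq_zero_or_pos i with rfl | hi
  · rw [norm_iteratedFDeriv_zero]; simp
  · rw [iteratedFDeriv_const_of_ne hi.ne']; simp

/-- Every Schwartz function is the limit of compactly supported Schwartz functions. -/
theorem exists_tendsto_hasCompactSupport (w : 𝓢(E3, ℂ)) :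
    ∃ W : ℕ → 𝓢(E3, ℂ), (∀ k, HasCompactSupport (W k)) ∧ Tendsto W atTop (𝓝 w) := by
  let χ : ContDiffBump (0 : E3) := ⟨1, 2, by norm_num, by norm_num⟩
  set r : ℕ → ℝ := fun k => ((k : ℝ) + 1)⁻¹ with hr
  have hr0 : ∀ k, 0 < r k := fun k => by simp only [hr]; positivity
  have hr1 : ∀ k, r k ≤ 1 := fun k => inv_le_one_of_one_le₀ (by linarith [(k.cast_nonneg : (0 : ℝ) ≤ k)])
  have hcs : ∀ k, HasCompactSupport fun x : E3 => χ (r k • x) := fun k =>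
    χ.hasCompactSupport.comp_smul (hr0 k).ne'
  have hsm : ∀ k, ContDiff ℝ ∞ fun x : E3 => χ (r k • x) := fun k =>
    χ.contDiff.comp (contDiff_const_smul _)
  have htg : ∀ k, (fun x : E3 => χ (r k • x)).HasTemperateGrowth := fun k =>
    (hcs k).hasTemperateGrowth (hsm k)
  refine ⟨fun k => SchwartzMap.smulLeftCLM ℂ (fun x : E3 => χ (r k • x)) w, fun k => ?_, ?_⟩
  · have : (SchwartzMap.smulLeftCLM ℂ (fun x : E3 => χ (r k • x)) w : E3 → ℂ)
        = fun x => χ (r k • x) • w x := by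
      ext x; rw [SchwartzMap.smulLeftCLM_apply_apply (htg k)]
    rw [this]
    exact (hcs k).smul_right
  rw [(schwartz_withSeminorms ℝ E3 ℂ).tendsto_nhds]
  rintro ⟨m, n⟩ ε hε
  choose B hB0 hB using exists_bound_iteratedFDeriv_bump_sub_one χ
  set S : ℝ := ∑ i ∈ Finset.range (n + 1), (n.choose i : ℝ) * B i *
    SchwartzMap.seminorm ℝ (m + 1) (n - i) w with hS
  have hS0 : 0 ≤ S := Finset.sum_nonneg fun i _ =>
    mul_nonneg (mul_nonneg (by positivity) (hB0 i)) (apply_nonneg _ _)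
  have hbound : ∀ k, SchwartzMap.seminorm ℝ m n
      (SchwartzMap.smulLeftCLM ℂ (fun x : E3 => χ (r k • x)) w - w) ≤ r k * S := by
    intro k
    refine SchwartzMap.seminorm_le_bound ℝ m n _ (mul_nonneg (hr0 k).le hS0) fun x => ?_
    set f : E3 → ℝ := fun x => χ (r k • x) - 1 with hf
    have hfw : ((SchwartzMap.smulLeftCLM ℂ (fun x : E3 => χ (r k • x)) w - w : 𝓢(E3, ℂ)) : E3 → ℂ)
        = fun x => f x • w x := by
      ext x
      rw [sub_apply, SchwartzMap.smulLeftCLM_apply_apply (htg k), hf]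
      simp only [sub_smul, one_smul]
    rw [hfw]
    -- Where `|r_k x| < 1` the factor `χ(r_k ·) − 1` vanishes identically near `x`. Elsewhere `1 ≤
    -- r_k |x|`: this gains the small factor `r_k` for one more power of `|x|`, which the seminorm
    -- of order `m + 1` absorbs.
    by_cases hx : ‖r k • x‖ < 1
    · have hev : (fun x => f x • w x) =ᶠ[𝓝 x] fun _ => (0 : ℂ) := by
        have : ∀ᶠ y in 𝓝 x, ‖r k • y‖ < 1 :=
          (by fun_prop : Continuous fun y : E3 => ‖r k • y‖).continuousAt.eventually_lt
            continuousAt_const hx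
        filter_upwards [this] with y hy
        have : χ (r k • y) = 1 := χ.one_of_mem_closedBall (by
          rw [mem_closedBall_zero_iff]; exact hy.le)
        simp [hf, this]
      have hz : iteratedFDeriv ℝ n (fun x => f x • w x) x = 0 := by
        rw [(hev.iteratedFDeriv ℝ n).eq_of_nhds]
        exact congrFun (iteratedFDeriv_fun_zero) x
      rw [hz]
      simp only [norm_zero, mul_zero]
      exact mul_nonneg (hr0 k).le hS0
    · have hx1 : 1 ≤ r k * ‖x‖ := by
        rw [norm_smul, Real.norm_of_nonneg (hr0 k).le] at hx
        exact not_lt.1 hx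
      have hfs : ContDiff ℝ n f := ((hsm k).sub contDiff_const).of_le (by exact_mod_cast le_top)
      have hfB : ∀ i ≤ n, ‖iteratedFDeriv ℝ i f x‖ ≤ B i := fun i hi => by
        have hs : ContDiff ℝ i fun y : E3 => χ y - 1 := χ.contDiff.sub contDiff_const
        have e : iteratedFDeriv ℝ i f x
            = r k ^ i • iteratedFDeriv ℝ i (fun y : E3 => χ y - 1) (r k • x) :=
          congrFun (iteratedFDeriv_comp_const_smul (r k) hs) x
        rw [e, norm_smul, norm_pow, Real.norm_of_nonneg (hr0 k).le]
        exact (mul_le_of_le_one_left (norm_nonneg _) (pow_le_one₀ (hr0 k).le (hr1 k))).trans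
          (hB i _)
      have hl := norm_iteratedFDeriv_smul_le hfs (w.smooth n) x (n := n) le_rfl
      calc ‖x‖ ^ m * ‖iteratedFDeriv ℝ n (fun x => f x • w x) x‖
          ≤ ‖x‖ ^ m * ∑ i ∈ Finset.range (n + 1), (n.choose i : ℝ) * ‖iteratedFDeriv ℝ i f x‖ *
            ‖iteratedFDeriv ℝ (n - i) w x‖ := by gcongr
        _ ≤ (r k * ‖x‖) * (‖x‖ ^ m * ∑ i ∈ Finset.range (n + 1), (n.choose i : ℝ) * B i *
            ‖iteratedFDeriv ℝ (n - i) w x‖) := by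
            refine (mul_le_mul_of_nonneg_left ?_ (by positivity)).trans
              (le_mul_of_one_le_left ?_ hx1)
            · refine Finset.sum_le_sum fun i hi => ?_
              have := hfB i (Nat.lt_succ_iff.1 (Finset.mem_range.1 hi))
              gcongr
            · exact mul_nonneg (by positivity) (Finset.sum_nonneg fun i _ =>
                mul_nonneg (mul_nonneg (by positivity) (hB0 i)) (norm_nonneg _))
        _ = r k * ∑ i ∈ Finset.range (n + 1), (n.choose i : ℝ) * B i *
            (‖x‖ ^ (m + 1) * ‖iteratedFDeriv ℝ (n - i) w x‖) := by
            rw [mul_assoc, ← mul_assoc ‖x‖, ← pow_succ', Finset.mul_sum]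
            congr 1
            refine Finset.sum_congr rfl fun i _ => ?_
            ring
        _ ≤ r k * S := by
            rw [hS]
            refine mul_le_mul_of_nonneg_left (Finset.sum_le_sum fun i _ => ?_) (hr0 k).le
            exact mul_le_mul_of_nonneg_left (SchwartzMap.le_seminorm ℝ _ _ w x)
              (mul_nonneg (by positivity) (hB0 i))
  have hlim : Tendsto (fun k => r k * S) atTop (𝓝 0) := by
    have : Tendsto r atTop (𝓝 0) := by
      simpa [hr, one_div] using tendsto_one_div_add_atTop_nhds_zero_nat (𝕜 := ℝ)
    simpa using this.mul_const S
  filter_upwards [hlim.eventually (gt_mem_nhds hε)] with k hk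
  exact (hbound k).trans_lt hk

/-! ### Schwartz fields in frequency space -/

/-- Multiplication by the weight. -/
def wtOp (α : ℝ) (hα : 0 ≤ α) : LC →L[ℝ] LC :=
  mulOp (wt α) (continuous_wt α).measurable 1
    fun ξ => by rw [abs_of_pos (wt_pos α ξ)]; exact wt_le_one α hα ξ

lemma coeFn_wtOp (α : ℝ) (hα : 0 ≤ α) (E : LC) : wtOp α hα E =ᵐ[volume] wtDensity α E :=
  coeFn_mulOp _ _ _ _ E

/-- The symbol `(2π|ξ|)^s` of `Λˢ`. -/
def rieszSymbol (s : ℝ) (ξ : E3) : ℝ := (2 * Real.pi * ‖ξ‖) ^ s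

lemma rieszSymbol_nonneg (s : ℝ) (ξ : E3) : 0 ≤ rieszSymbol s ξ := by
  unfold rieszSymbol; positivity

lemma measurable_rieszSymbol (s : ℝ) : Measurable (rieszSymbol s) := by
  unfold rieszSymbol; fun_prop

/-- Multiplication by the symbol of `Λ^{2α}` and by the weight. -/
def dissOp (α : ℝ) (hα : 0 ≤ α) : LC →L[ℝ] LC :=
  mulOp (fun ξ => rieszSymbol (2 * α) ξ * wt α ξ)
    ((measurable_rieszSymbol _).mul (continuous_wt α).measurable) ((2 * Real.pi) ^ (2 * α))
    fun ξ => by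
      rw [abs_of_nonneg (mul_nonneg (rieszSymbol_nonneg _ _) (wt_pos α ξ).le)]
      exact riesz_mul_wt_le α hα ξ

/-- The real multiplier is symmetric and moves onto `E`. A vector `E` of `LC` thus acts as the test
field `synth (wtDensity α E)`. -/
lemma inner_wtOp (α : ℝ) (hα : 0 ≤ α) (u : L2) (E : LC) :
    inner ℝ (wtOp α hα (fourierL2 u)) E = ∫ x, inner ℝ (u x) (synth (wtDensity α E) x) := by
  rw [wtOp, inner_mulOp_left, ← inner_realLp, L2.inner_def]
  refine integral_congr_ae ?_
  filter_upwards [synth_ae_eq (integrable_wtDensity α hα E) (memLp_wtDensity α hα E)] with x hx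
  rw [hx]
  rfl

/-- The reciprocal of the weight. -/
def invWt (α : ℝ) (ξ : E3) : ℝ := (1 + ‖ξ‖ ^ 2) ^ (α + 2)

lemma invWt_mul_wt (α : ℝ) (ξ : E3) : invWt α ξ * wt α ξ = 1 := by
  rw [invWt, wt, ← Real.rpow_add (by positivity), add_neg_cancel, Real.rpow_zero]

lemma wt_mul_invWt (α : ℝ) (ξ : E3) : wt α ξ * invWt α ξ = 1 := by
  rw [mul_comm, invWt_mul_wt]

lemma hasTemperateGrowth_invWt (α : ℝ) : (invWt α).HasTemperateGrowth :=
  Function.hasTemperateGrowth_one_add_norm_sq_rpow E3 (α + 2)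

lemma hasTemperateGrowth_wt (α : ℝ) : (wt α).HasTemperateGrowth :=
  Function.hasTemperateGrowth_one_add_norm_sq_rpow E3 (-(α + 2))

/-- The Fourier transform of a Schwartz field divided by the weight. -/
def embed (α : ℝ) : 𝓢(E3, C3) →L[ℝ] LC :=
  (SchwartzMap.toLpCLM ℝ C3 2 volume).comp
    ((SchwartzMap.smulLeftCLM C3 (invWt α)).comp (fourierCLM ℝ 𝓢(E3, C3)))

lemma coeFn_embed (α : ℝ) (G : 𝓢(E3, C3)) :
    embed α G =ᵐ[volume] fun ξ => invWt α ξ • (𝓕 G) ξ := by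
  filter_upwards [(SchwartzMap.smulLeftCLM C3 (invWt α) (𝓕 G)).coeFn_toLp 2 volume] with ξ h
  rw [← SchwartzMap.smulLeftCLM_apply_apply (hasTemperateGrowth_invWt α)]
  exact h

lemma wtDensity_embed (α : ℝ) (G : 𝓢(E3, C3)) :
    wtDensity α (embed α G) =ᵐ[volume] fun ξ => (𝓕 G) ξ := by
  filter_upwards [coeFn_embed α G] with ξ h
  rw [wtDensity, h, smul_smul, wt_mul_invWt, one_smul]

/-- The weight and its reciprocal cancel: `embed α G` is the vector of `LC` that represents the test
field `Re G`. -/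
lemma synth_wtDensity_embed (α : ℝ) (G : 𝓢(E3, C3)) :
    synth (wtDensity α (embed α G)) = fun x => realPart (G x) := by
  rw [synth_congr_ae (wtDensity_embed α G)]
  ext1 x
  rw [synth]
  congr 1
  rw [← SchwartzMap.fourierInv_coe, fourierInv_fourier_eq]

/-- The symbol need not be smooth at the origin, so the product need not be a Schwartz function. It
is dominated by one, which gives integrability and square integrability. -/
lemma rieszSymbol_fourier_bound (α : ℝ) (hα : 0 ≤ α) (G : 𝓢(E3, C3)) (ξ : E3) :
    ‖rieszSymbol (2 * α) ξ • (𝓕 G) ξ‖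
      ≤ (2 * Real.pi) ^ (2 * α) * ‖SchwartzMap.smulLeftCLM C3 (invWt α) (𝓕 G) ξ‖ := by
  rw [SchwartzMap.smulLeftCLM_apply_apply (hasTemperateGrowth_invWt α), norm_smul, norm_smul,
    Real.norm_of_nonneg (rieszSymbol_nonneg _ _), Real.norm_of_nonneg (by unfold invWt; positivity),
    ← mul_assoc]
  gcongr
  calc rieszSymbol (2 * α) ξ = (rieszSymbol (2 * α) ξ * wt α ξ) * invWt α ξ := by
        rw [mul_assoc, wt_mul_invWt, mul_one]
    _ ≤ _ := by
        gcongr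
        · unfold invWt; positivity
        · exact riesz_mul_wt_le α hα ξ

lemma aestronglyMeasurable_rieszSymbol_fourier (s : ℝ) (G : 𝓢(E3, C3)) :
    AEStronglyMeasurable (fun ξ => rieszSymbol s ξ • (𝓕 G) ξ) volume :=
  (measurable_rieszSymbol s).aestronglyMeasurable.smul (𝓕 G).continuous.aestronglyMeasurable

lemma integrable_rieszSymbol_fourier (α : ℝ) (hα : 0 ≤ α) (G : 𝓢(E3, C3)) :
    Integrable (fun ξ => rieszSymbol (2 * α) ξ • (𝓕 G) ξ) :=
  ((SchwartzMap.integrable (SchwartzMap.smulLeftCLM C3 (invWt α) (𝓕 G))).norm.const_mul _).mono'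
    (aestronglyMeasurable_rieszSymbol_fourier _ G)
    (ae_of_all _ (rieszSymbol_fourier_bound α hα G))

lemma memLp_rieszSymbol_fourier (α : ℝ) (hα : 0 ≤ α) (G : 𝓢(E3, C3)) :
    MemLp (fun ξ => rieszSymbol (2 * α) ξ • (𝓕 G) ξ) 2 volume :=
  (SchwartzMap.memLp (SchwartzMap.smulLeftCLM C3 (invWt α) (𝓕 G)) 2 volume).of_le_mul
    (aestronglyMeasurable_rieszSymbol_fourier _ G)
    (ae_of_all _ (rieszSymbol_fourier_bound α hα G))

lemma inner_dissOp (α : ℝ) (hα : 0 ≤ α) (u : L2) (G : 𝓢(E3, C3)) :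
    inner ℝ (dissOp α hα (fourierL2 u)) (embed α G)
      = ∫ x, inner ℝ (u x) (synth (fun ξ => rieszSymbol (2 * α) ξ • (𝓕 G) ξ) x) := by
  have e : dissOp α hα (embed α G) = (memLp_rieszSymbol_fourier α hα G).toLp := by
    refine Lp.ext ?_
    filter_upwards [coeFn_mulOp _ _ _ _ (embed α G), coeFn_embed α G,
      (memLp_rieszSymbol_fourier α hα G).coeFn_toLp] with ξ h1 h2 h3
    rw [h3, dissOp, h1, h2, smul_smul, mul_assoc, wt_mul_invWt, mul_one]
  rw [dissOp, inner_mulOp_left]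
  change inner ℝ (fourierL2 u) (dissOp α hα (embed α G)) = _
  rw [e, ← inner_realLp, L2.inner_def]
  refine integral_congr_ae ?_
  filter_upwards [synth_ae_eq (integrable_rieszSymbol_fourier α hα G)
    (memLp_rieszSymbol_fourier α hα G)] with x hx
  rw [hx]

/-! ### Conjugation -/

/-- Componentwise conjugation. -/
def conjC3 : C3 →L[ℝ] C3 :=
  LinearMap.toContinuousLinearMap
    { toFun := fun z => WithLp.toLp 2 (fun i => (starRingEnd ℂ) (z i))
      map_add' := fun v w => by ext i; simp
      map_smul' := fun c v => by ext i; simp }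

@[simp] lemma conjC3_apply (z : C3) (i : Fin 3) : conjC3 z i = (starRingEnd ℂ) (z i) := rfl

lemma conjC3_circle_smul (e : Circle) (z : C3) : conjC3 (e • z) = e⁻¹ • conjC3 z := by
  ext i
  simp only [conjC3_apply, PiLp.smul_apply, Circle.smul_def, smul_eq_mul, map_mul,
    Circle.coe_inv_eq_conj]

lemma realPart_conjC3 (z : C3) : realPart (conjC3 z) = realPart z := by
  ext i; simp [realPart]

lemma complexify_realPart (z : C3) :
    complexify (realPart z) = (2⁻¹ : ℝ) • (z + conjC3 z) := by
  ext i
  simp [complexify, realPart, Complex.re_eq_add_conj]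
  ring

lemma fourier_conj {f : E3 → C3} (hf : Integrable f) (x : E3) :
    𝓕 (fun y => conjC3 (f y)) x = conjC3 (𝓕⁻ f x) := by
  rw [Real.fourier_eq, Real.fourierInv_eq, ← ContinuousLinearMap.integral_comp_comm]
  · refine integral_congr_ae (ae_of_all _ fun y => ?_)
    simp only
    rw [conjC3_circle_smul, ← AddChar.map_neg_eq_inv]
  · have := (VectorFourier.fourierIntegral_convergent_iff Real.continuous_fourierChar
      continuous_neg_innerₗ x (μ := volume) (f := f)).2 hf
    simpa using this

lemma fourierInv_conj {f : E3 → C3} (hf : Integrable f) (x : E3) :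
    𝓕⁻ (fun y => conjC3 (f y)) x = conjC3 (𝓕 f x) := by
  rw [Real.fourierInv_eq_fourier_neg, fourier_conj hf, Real.fourierInv_eq_fourier_neg, neg_neg]

/-- The symbol is even, so the reflection `ξ ↦ -ξ` exchanges the two transforms. -/
lemma fourier_rieszSymbol_fourierInv (s : ℝ) (G : E3 → C3) (x : E3) :
    𝓕 (fun ξ => rieszSymbol s ξ • 𝓕⁻ G ξ) x = 𝓕⁻ (fun ξ => rieszSymbol s ξ • 𝓕 G ξ) x := by
  have h := congrFun (Real.fourierInv_eq_fourier_comp_neg (fun ξ => rieszSymbol s ξ • 𝓕 G ξ)) x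
  rw [h]
  simp_rw [Real.fourierInv_eq_fourier_neg]
  simp [rieszSymbol]

/-- Write `Re G` as half the sum of `G` and its conjugate. Since the symbol is real and even, both
halves contribute the same real part. -/
lemma fracLambda_realPart (α : ℝ) (hα : 0 ≤ α) (G : 𝓢(E3, C3)) (x : E3) :
    fracLambda (2 * α) (fun y => realPart (G y)) x
      = synth (fun ξ => rieszSymbol (2 * α) ξ • (𝓕 G) ξ) x := by
  have hG : Integrable (G : E3 → C3) volume := G.integrable
  have hcG : Integrable (fun y => conjC3 (G y)) volume := conjC3.integrable_comp hG
  have h1 : ∀ ξ, 𝓕 (fun y => complexify (realPart (G y))) ξ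
      = (2⁻¹ : ℝ) • (𝓕 (G : E3 → C3) ξ + conjC3 (𝓕⁻ (G : E3 → C3) ξ)) := by
    intro ξ
    simp_rw [complexify_realPart]
    rw [← fourier_conj hG]
    have ha : 𝓕 ((G : E3 → C3) + fun y => conjC3 (G y)) ξ
        = 𝓕 (G : E3 → C3) ξ + 𝓕 (fun y => conjC3 (G y)) ξ :=
      congrFun (VectorFourier.fourierIntegral_add (L := innerₗ E3) Real.continuous_fourierChar
        continuous_inner hG hcG) ξ
    rw [← ha, Real.fourier_eq, Real.fourier_eq, ← integral_smul]
    refine integral_congr_ae (ae_of_all _ fun y => ?_)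
    simp only [Pi.add_apply]
    rw [smul_comm]
  have hint := integrable_rieszSymbol_fourier α hα G
  have hint2 : Integrable (fun ξ => rieszSymbol (2 * α) ξ • 𝓕⁻ (G : E3 → C3) ξ) := by
    refine (hint.comp_neg).congr (ae_of_all _ fun ξ => ?_)
    simp only
    rw [Real.fourierInv_eq_fourier_neg, SchwartzMap.fourier_coe]
    simp [rieszSymbol]
  have h2 : (fun ξ : E3 => (2 * Real.pi * ‖ξ‖) ^ (2 * α) •
      𝓕 (fun y : E3 => complexify (realPart (G y))) ξ)
      = (2⁻¹ : ℝ) • ((fun ξ => rieszSymbol (2 * α) ξ • (𝓕 G) ξ) +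
        fun ξ => conjC3 (rieszSymbol (2 * α) ξ • 𝓕⁻ (G : E3 → C3) ξ)) := by
    ext1 ξ
    rw [h1, Pi.smul_apply, Pi.add_apply, map_smul, ← smul_add, smul_comm]
    rfl
  rw [fracLambda, h2]
  change synth _ x = _
  rw [synth_smul, synth_add hint (conjC3.integrable_comp hint2), Pi.smul_apply, Pi.add_apply]
  have h3 : synth (fun ξ => conjC3 (rieszSymbol (2 * α) ξ • 𝓕⁻ (G : E3 → C3) ξ)) x
      = synth (fun ξ => rieszSymbol (2 * α) ξ • (𝓕 G) ξ) x := by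
    rw [synth, fourierInv_conj hint2, realPart_conjC3, fourier_rieszSymbol_fourierInv, synth]
    rfl
  rw [h3, ← two_smul ℝ, smul_smul]
  norm_num

/-! ### The flux -/

lemma memLp_coe (u : L2) : MemLp u 2 (volume : Measure E3) := Lp.memLp u

lemma norm_eq_toReal_eLpNorm (u : L2) : ‖u‖ = (eLpNorm u 2 (volume : Measure E3)).toReal :=
  Lp.norm_def u

lemma integrable_trilin_wt (α : ℝ) (hα : 0 ≤ α) (u v : L2) (E : LC) :
    Integrable fun x => (inner ℝ (fderiv ℝ (synth (wtDensity α E)) x (u x)) (v x) : ℝ) :=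
  integrable_trilin (measurable_fderiv_synth _) (norm_fderiv_synth_wt_le α hα E)
    (memLp_coe u) (memLp_coe v)

lemma fderiv_synth_wt_add (α : ℝ) (hα : 0 ≤ α) (E G : LC) (x : E3) :
    fderiv ℝ (synth (wtDensity α (E + G))) x
      = fderiv ℝ (synth (wtDensity α E)) x + fderiv ℝ (synth (wtDensity α G)) x := by
  rw [synth_congr_ae (wtDensity_add α E G),
    synth_add (integrable_wtDensity α hα E) (integrable_wtDensity α hα G)]
  exact ((hasFDerivAt_synth (integrable_wtDensity α hα E) (integrable_norm_mul_wtDensity α hα E) x).add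
    (hasFDerivAt_synth (integrable_wtDensity α hα G) (integrable_norm_mul_wtDensity α hα G) x)).fderiv

lemma fderiv_synth_wt_smul (α : ℝ) (hα : 0 ≤ α) (c : ℝ) (E : LC) (x : E3) :
    fderiv ℝ (synth (wtDensity α (c • E))) x = c • fderiv ℝ (synth (wtDensity α E)) x := by
  rw [synth_congr_ae (wtDensity_smul α c E), synth_smul]
  exact ((hasFDerivAt_synth (integrable_wtDensity α hα E)
    (integrable_norm_mul_wtDensity α hα E) x).const_smul c).fderiv

/-- The functional `E ↦ ∫ (u·∇)φ_E · v`. -/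
def triFunctional (α : ℝ) (hα : 0 ≤ α) (u v : L2) : LC →L[ℝ] ℝ :=
  LinearMap.mkContinuous
    { toFun := fun E => trilin (synth (wtDensity α E)) u v
      map_add' := fun E G => by
        simp only [trilin]
        rw [← integral_add (integrable_trilin_wt α hα u v E) (integrable_trilin_wt α hα u v G)]
        simp_rw [fderiv_synth_wt_add α hα, add_apply, inner_add_left]
      map_smul' := fun c E => by
        simp only [trilin, RingHom.id_apply, smul_eq_mul]
        rw [← integral_const_mul]
        simp_rw [fderiv_synth_wt_smul α hα, smul_apply, real_inner_smul_left] }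
    (gradConst α * ‖u‖ * ‖v‖) fun E => by
      simp only [LinearMap.coe_mk, AddHom.coe_mk, Real.norm_eq_abs]
      refine (abs_trilin_le (norm_fderiv_synth_wt_le α hα E) (memLp_coe u) (memLp_coe v)).trans_eq ?_
      rw [← norm_eq_toReal_eLpNorm, ← norm_eq_toReal_eLpNorm]
      ring

lemma norm_triFunctional_le (α : ℝ) (hα : 0 ≤ α) (u v : L2) :
    ‖triFunctional α hα u v‖ ≤ gradConst α * ‖u‖ * ‖v‖ := by
  have h : 0 ≤ gradConst α := by unfold gradConst; positivity
  exact LinearMap.mkContinuous_norm_le _ (by positivity) _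

@[simp] lemma triFunctional_apply (α : ℝ) (hα : 0 ≤ α) (u v : L2) (E : LC) :
    triFunctional α hα u v E = trilin (synth (wtDensity α E)) u v := rfl

/-- The bilinear map `(u, v) ↦ (E ↦ ∫ (u·∇)φ_E · v)`. -/
def triMap (α : ℝ) (hα : 0 ≤ α) : L2 →L[ℝ] L2 →L[ℝ] (LC →L[ℝ] ℝ) :=
  LinearMap.mkContinuous₂
    (LinearMap.mk₂ ℝ (triFunctional α hα)
      (fun u u' v => by
        ext E
        simp only [add_apply, triFunctional_apply, trilin]
        rw [← integral_add (integrable_trilin_wt α hα u v E) (integrable_trilin_wt α hα u' v E)]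
        refine integral_congr_ae ?_
        filter_upwards [Lp.coeFn_add u u'] with x hx
        rw [hx, Pi.add_apply, map_add, inner_add_left])
      (fun c u v => by
        ext E
        simp only [smul_apply, triFunctional_apply, trilin, smul_eq_mul]
        rw [← integral_const_mul]
        refine integral_congr_ae ?_
        filter_upwards [Lp.coeFn_smul c u] with x hx
        rw [hx, Pi.smul_apply, map_smul, real_inner_smul_left])
      (fun u v v' => by
        ext E
        simp only [add_apply, triFunctional_apply, trilin]
        rw [← integral_add (integrable_trilin_wt α hα u v E) (integrable_trilin_wt α hα u v' E)]
        refine integral_congr_ae ?_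
        filter_upwards [Lp.coeFn_add v v'] with x hx
        rw [hx, Pi.add_apply, inner_add_right])
      (fun c u v => by
        ext E
        simp only [smul_apply, triFunctional_apply, trilin, smul_eq_mul]
        rw [← integral_const_mul]
        refine integral_congr_ae ?_
        filter_upwards [Lp.coeFn_smul c v] with x hx
        rw [hx, Pi.smul_apply, real_inner_smul_right]))
    (gradConst α) (norm_triFunctional_le α hα)

lemma triMap_apply (α : ℝ) (hα : 0 ≤ α) (u v : L2) (E : LC) :
    triMap α hα u v E = trilin (synth (wtDensity α E)) u v := rfl

/-- The right-hand side of the momentum equation in weighted frequency space. -/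
def fluxVec (α : ℝ) (hα : 0 ≤ α) (u : L2) : LC :=
  (InnerProductSpace.toDual ℝ LC).symm (triMap α hα u u) - dissOp α hα (fourierL2 u)

lemma inner_fluxVec (α : ℝ) (hα : 0 ≤ α) (u : L2) (E : LC) :
    inner ℝ (fluxVec α hα u) E
      = trilin (synth (wtDensity α E)) u u - inner ℝ (dissOp α hα (fourierL2 u)) E := by
  rw [fluxVec, inner_sub_left, InnerProductSpace.toDual_symm_apply, triMap_apply]

/-- Continuity in `u` makes the flux along a merely measurable trajectory measurable in time. -/
lemma continuous_fluxVec (α : ℝ) (hα : 0 ≤ α) : Continuous (fluxVec α hα) := by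
  refine Continuous.sub ?_ ((dissOp α hα).continuous.comp fourierL2CLM.continuous)
  refine (InnerProductSpace.toDual ℝ LC).symm.continuous.comp ?_
  exact (triMap α hα).continuous.clm_apply continuous_id

lemma norm_fluxVec_le (α : ℝ) (hα : 0 ≤ α) (u : L2) :
    ‖fluxVec α hα u‖ ≤ gradConst α * ‖u‖ * ‖u‖ + ‖dissOp α hα‖ * ‖u‖ := by
  refine (norm_sub_le _ _).trans (add_le_add ?_ ?_)
  · rw [LinearIsometryEquiv.norm_map]
    exact norm_triFunctional_le α hα u u
  · refine (ContinuousLinearMap.le_opNorm _ _).trans_eq ?_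
    rw [norm_fourierL2]

/-! ### Testing the equation -/

lemma fracLambda_smul (s c : ℝ) (f : E3 → E3) (x : E3) :
    fracLambda s (fun y => c • f y) x = c • fracLambda s f x := by
  have h1 : ∀ ξ, 𝓕 (fun y : E3 => complexify (c • f y)) ξ
      = c • 𝓕 (fun y : E3 => complexify (f y)) ξ := fun ξ => by
    rw [Real.fourier_eq, Real.fourier_eq, ← integral_smul]
    refine integral_congr_ae (ae_of_all _ fun y => ?_)
    simp only [map_smul]
    rw [smul_comm]
  have h2 : (fun ξ : E3 => (2 * Real.pi * ‖ξ‖) ^ s • 𝓕 (fun y : E3 => complexify (c • f y)) ξ)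
      = c • fun ξ : E3 => (2 * Real.pi * ‖ξ‖) ^ s • 𝓕 (fun y : E3 => complexify (f y)) ξ := by
    ext1 ξ
    rw [h1, Pi.smul_apply, smul_comm]
  rw [fracLambda, h2]
  exact congrFun (synth_smul c _) x

lemma contDiff_realPart_schwartz (G : 𝓢(E3, C3)) : ContDiff ℝ ∞ fun x => realPart (G x) :=
  realPartCLM.contDiff.comp (G.smooth ⊤)

lemma isTestField_smul {T : ℝ≥0∞} {φ : E3 → E3} (hφ : ContDiff ℝ ∞ φ) (hc : HasCompactSupport φ)
    (hdiv : ∀ x, ∑ i : Fin 3, (fderiv ℝ φ x (EuclideanSpace.single i 1)) i = 0)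
    {η : ℝ → ℝ} (hη : ContDiff ℝ ∞ η) (hηc : HasCompactSupport η)
    (hηT : ∀ t ∈ tsupport η, ENNReal.ofReal t < T) :
    IsTestField T (fun z : ℝ × E3 => η z.1 • φ z.2) where
  smooth := (hη.comp contDiff_fst).smul (hφ.comp contDiff_snd)
  compact := by
    refine HasCompactSupport.of_support_subset_isCompact (hηc.isCompact.prod hc.isCompact) ?_
    intro z hz
    refine ⟨subset_tsupport _ fun h => hz ?_, subset_tsupport _ fun h => hz ?_⟩ <;> simp [h]
  support := by
    intro z hz
    refine hηT z.1 ?_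
    have h : tsupport (fun z : ℝ × E3 => η z.1 • φ z.2) ⊆ Prod.fst ⁻¹' tsupport η := by
      refine closure_minimal (fun w hw => subset_tsupport _ fun h => hw ?_)
        ((isClosed_tsupport η).preimage continuous_fst)
      simp [h]
    exact h hz
  divFree := by
    intro t _ x
    have h : fderiv ℝ (fun y => η t • φ y) x = η t • fderiv ℝ φ x :=
      fderiv_const_smul (hφ.differentiable (by simp)).differentiableAt (η t)
    simp only [h, smul_apply, PiLp.smul_apply, smul_eq_mul, ← Finset.mul_sum,
      hdiv x, mul_zero]

/-- The weak formulation tested with `η(t) Re G(x)`. -/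
theorem weak_embed {α : ℝ} (hα : 0 ≤ α) {T : ℝ≥0∞} {u₀ : L2} {u : ℝ → L2}
    (hsol : IsDistributionalSolution α T u₀ u) (G : 𝓢(E3, C3)) (hG : HasCompactSupport G)
    (hdiv : ∀ x, ∑ i : Fin 3,
      (fderiv ℝ (fun y => realPart (G y)) x (EuclideanSpace.single i 1)) i = 0)
    {η : ℝ → ℝ} (hη : ContDiff ℝ ∞ η) (hηc : HasCompactSupport η)
    (hηT : ∀ t ∈ tsupport η, ENNReal.ofReal t < T) :
    ∫ τ in timeInterval T,
      (deriv η τ * inner ℝ (wtOp α hα (fourierL2 (u τ))) (embed α G)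
        + η τ * inner ℝ (fluxVec α hα (u τ)) (embed α G))
      = - (η 0 * inner ℝ (wtOp α hα (fourierL2 u₀)) (embed α G)) := by
  set φ : E3 → E3 := fun x => realPart (G x) with hφ
  have hφs : synth (wtDensity α (embed α G)) = φ := synth_wtDensity_embed α G
  have hφc : HasCompactSupport φ := hG.comp_left (g := realPart) (by ext i; simp [realPart])
  have hφd : ContDiff ℝ ∞ φ := contDiff_realPart_schwartz G
  have hφm : MemLp φ 2 volume := by
    rw [← hφs]
    exact memLp_synth (integrable_wtDensity α hα _) (memLp_wtDensity α hα _)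
  have hin : ∀ w : L2, ∫ x, inner ℝ (w x) (φ x) = inner ℝ (wtOp α hα (fourierL2 w)) (embed α G) :=
    fun w => by rw [inner_wtOp, hφs]
  have hin' : ∀ w : L2, Integrable fun x => (inner ℝ (w x) (φ x) : ℝ) := fun w =>
    (integral_norm_mul_norm_le (memLp_coe w) hφm).1.mono' ((memLp_coe w).1.inner hφm.1)
      (ae_of_all _ fun x => norm_inner_le_norm (𝕜 := ℝ) _ _)
  have h := hsol _ (isTestField_smul hφd hφc hdiv hη hηc hηT)
  have e0 : ∫ x, inner ℝ (u₀ x) (η 0 • φ x)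
      = η 0 * inner ℝ (wtOp α hα (fourierL2 u₀)) (embed α G) := by
    simp_rw [real_inner_smul_right]
    rw [integral_const_mul, hin]
  rw [e0] at h
  rw [← h]
  congr 1
  ext τ
  have hd : ∀ x, deriv (fun s => η s • φ x) τ = deriv η τ • φ x := fun x =>
    ((hη.differentiable (by simp)).differentiableAt.hasDerivAt.smul_const (φ x)).deriv
  have hf : ∀ x, fderiv ℝ (fun y => η τ • φ y) x = η τ • fderiv ℝ φ x := fun x =>
    fderiv_const_smul (hφd.differentiable (by simp)).differentiableAt (η τ)
  have e1 : ∫ x, inner ℝ (deriv (fun s => η s • φ x) τ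
        + fderiv ℝ (fun y => η τ • φ y) x (u τ x)) (u τ x)
      = deriv η τ * inner ℝ (wtOp α hα (fourierL2 (u τ))) (embed α G)
        + η τ * trilin φ (u τ) (u τ) := by
    simp_rw [hd, hf, smul_apply, inner_add_left, real_inner_smul_left]
    have ht := integrable_trilin_wt α hα (u τ) (u τ) (embed α G)
    rw [hφs] at ht
    have hc : ∀ x, (inner ℝ (φ x) (u τ x) : ℝ) = inner ℝ (u τ x) (φ x) := fun x =>
      real_inner_comm _ _
    simp_rw [hc]
    rw [integral_add ((hin' (u τ)).const_mul _) (ht.const_mul _), integral_const_mul,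
      integral_const_mul, hin]
    rfl
  have e2 : ∫ x, inner ℝ (u τ x) (fracLambda (2 * α) (fun y => η τ • φ y) x)
      = η τ * inner ℝ (dissOp α hα (fourierL2 (u τ))) (embed α G) := by
    rw [inner_dissOp, ← integral_const_mul]
    refine integral_congr_ae (ae_of_all _ fun x => ?_)
    simp only
    rw [fracLambda_smul, hφ, fracLambda_realPart α hα G, real_inner_smul_right]
  rw [e1, e2, inner_fluxVec, hφs]
  ring

section GradField

open LineDeriv

/-! ### Gradients and rotations as test fields -/

/-- The field whose `k`-th component is the derivative of `w` in direction `a k`. -/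
def gradField (a : Fin 3 → E3) : 𝓢(E3, ℂ) →L[ℝ] 𝓢(E3, C3) :=
  ∑ k, (SchwartzMap.postcompCLM ((ContinuousLinearMap.id ℂ ℂ).smulRight
    (EuclideanSpace.single k (1 : ℂ)) |>.restrictScalars ℝ)).comp (lineDerivOpCLM ℝ 𝓢(E3, ℂ) (a k))

lemma gradField_apply (a : Fin 3 → E3) (w : 𝓢(E3, ℂ)) (x : E3) (k : Fin 3) :
    gradField a w x k = fderiv ℝ w x (a k) := by
  simp only [gradField, Finset.sum_apply,
    ContinuousLinearMap.comp_apply, lineDerivOpCLM_apply, sum_apply,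
    SchwartzMap.postcompCLM_apply, WithLp.ofLp_sum, ContinuousLinearMap.coe_restrictScalars',
    ContinuousLinearMap.smulRight_apply]
  simp [SchwartzMap.lineDerivOp_apply_eq_fderiv]

lemma fourier_coord (G : 𝓢(E3, C3)) (ξ : E3) (k : Fin 3) :
    (𝓕 G) ξ k = 𝓕 (fun x => G x k) ξ := by
  rw [SchwartzMap.fourier_coe, Real.fourier_eq, Real.fourier_eq]
  have hint : Integrable fun v : E3 => Real.fourierChar (-(inner ℝ v ξ)) • G v :=
    (Real.fourierIntegral_convergent_iff ξ).2 G.integrable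
  exact ((EuclideanSpace.proj k : C3 →L[ℂ] ℂ).integral_comp_comm hint).symm

lemma fourier_gradField (a : Fin 3 → E3) (w : 𝓢(E3, ℂ)) (ξ : E3) (k : Fin 3) :
    (𝓕 (gradField a w)) ξ k
      = (2 * Real.pi * Complex.I) * ((inner ℝ ξ (a k) : ℝ) * (𝓕 w) ξ) := by
  have h : (fun x => gradField a w x k) = ⇑(∂_{a k} w : 𝓢(E3, ℂ)) := by
    ext1 x
    rw [gradField_apply, SchwartzMap.lineDerivOp_apply_eq_fderiv]
  have hg : (fun ξ : E3 => inner ℝ ξ (a k)).HasTemperateGrowth := by fun_prop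
  rw [fourier_coord, h, ← SchwartzMap.fourier_coe, SchwartzMap.fourier_lineDerivOp_eq,
    smul_apply, SchwartzMap.smulLeftCLM_apply_apply hg, smul_eq_mul,
    Complex.real_smul]

lemma hasCompactSupport_gradField (a : Fin 3 → E3) {w : 𝓢(E3, ℂ)} (hw : HasCompactSupport w) :
    HasCompactSupport (gradField a w) := by
  refine hw.fderiv (𝕜 := ℝ) |>.mono fun x hx h => hx ?_
  ext k
  rw [gradField_apply, h]
  simp

lemma inner_embed_gradField (α : ℝ) (Θ : LC) (a : Fin 3 → E3) (w : 𝓢(E3, ℂ)) :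
    inner ℝ Θ (embed α (gradField a w))
      = ∫ ξ, ((starRingEnd ℂ) (∑ k, (inner ℝ ξ (a k) : ℝ) • Θ ξ k)
        * (2 * Real.pi * Complex.I * (invWt α ξ * (𝓕 w) ξ))).re := by
  rw [L2.inner_def]
  refine integral_congr_ae ?_
  filter_upwards [coeFn_embed α (gradField a w)] with ξ h
  rw [h]
  simp only [PiLp.inner_apply, PiLp.smul_apply, fourier_gradField, map_sum, Finset.sum_mul,
    Complex.re_sum]
  refine Finset.sum_congr rfl fun k _ => ?_
  rw [Complex.inner]
  congr 1
  simp only [Complex.real_smul, map_mul, Complex.conj_ofReal]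
  ring

/-- A frequency field orthogonal to all fields `gradField a w` satisfies a pointwise linear
relation. -/
theorem sum_inner_smul_eq_zero {α : ℝ} {Θ : LC} {a : Fin 3 → E3}
    (h : ∀ w : 𝓢(E3, ℂ), HasCompactSupport w → inner ℝ Θ (embed α (gradField a w)) = 0) :
    ∀ᵐ ξ, ∑ k, (inner ℝ ξ (a k) : ℝ) • Θ ξ k = 0 := by
  -- The functions `w` used below have a compactly supported Fourier transform, so they cannot have
  -- compact support themselves unless they vanish; density extends the hypothesis to them.
  have hall : ∀ w : 𝓢(E3, ℂ), inner ℝ Θ (embed α (gradField a w)) = 0 := fun w => by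
    obtain ⟨W, hWc, hW⟩ := exists_tendsto_hasCompactSupport w
    have hcont : Continuous fun w : 𝓢(E3, ℂ) => inner ℝ Θ (embed α (gradField a w)) :=
      continuous_const.inner ((embed α).continuous.comp (gradField a).continuous)
    refine tendsto_nhds_unique ((hcont.tendsto w).comp hW) ?_
    simp only [Function.comp_def, h _ (hWc _)]
    exact tendsto_const_nhds
  set S : E3 → ℂ := fun ξ => ∑ k, (inner ℝ ξ (a k) : ℝ) • Θ ξ k with hS
  have hloc : LocallyIntegrable S := by
    have hΘ : LocallyIntegrable Θ (volume : Measure E3) :=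
      (Lp.memLp Θ).locallyIntegrable (by norm_num)
    refine locallyIntegrable_finsetSum _ fun k _ => ?_
    rw [← locallyIntegrableOn_univ] at hΘ ⊢
    refine LocallyIntegrableOn.continuousOn_smul isOpen_univ.isLocallyClosed ?_ (by fun_prop)
    intro x hx
    obtain ⟨s, hs, hi⟩ := hΘ x hx
    exact ⟨s, hs, (EuclideanSpace.proj k : C3 →L[ℂ] ℂ).integrable_comp hi⟩
  refine ae_eq_zero_of_integral_contDiff_smul_eq_zero hloc fun g hg hgc => ?_
  have hint : Integrable fun ξ => g ξ • S ξ :=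
    hloc.integrable_smul_left_of_hasCompactSupport hg.continuous hgc
  have key : ∀ c : ℂ, ∫ ξ, ((starRingEnd ℂ) (g ξ • S ξ) * c).re = 0 := fun c => by
    have hsm : ContDiff ℝ ∞ fun ξ : E3 => (g ξ : ℂ) * (c / (2 * Real.pi * Complex.I)) :=
      (Complex.ofRealCLM.contDiff.comp hg).mul contDiff_const
    have hcs : HasCompactSupport fun ξ : E3 => (g ξ : ℂ) * (c / (2 * Real.pi * Complex.I)) :=
      (hgc.comp_left (g := fun r : ℝ => (r : ℂ)) rfl).mul_right
    -- Chosen so that the factor `2πi` of differentiation and the reciprocal weight in `embed`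
    -- cancel and `g c` remains. The values `c = 1` and `c = i` then give the real and the imaginary
    -- part of `∫ g S`.
    have h0 := hall (𝓕⁻ (SchwartzMap.smulLeftCLM ℂ (wt α) (hcs.toSchwartzMap hsm)))
    rw [inner_embed_gradField, fourier_fourierInv_eq] at h0
    rw [← h0]
    refine integral_congr_ae (ae_of_all _ fun ξ => ?_)
    simp only
    rw [SchwartzMap.smulLeftCLM_apply_apply (hasTemperateGrowth_wt α)]
    change _ = ((starRingEnd ℂ) (S ξ) * (2 * Real.pi * Complex.I * (invWt α ξ *
      (wt α ξ • ((g ξ : ℂ) * (c / (2 * Real.pi * Complex.I))))))).re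
    congr 1
    have hw : (invWt α ξ : ℂ) * (wt α ξ : ℂ) = 1 := by
      rw [← Complex.ofReal_mul, invWt_mul_wt, Complex.ofReal_one]
    have hpi : (2 * Real.pi * Complex.I : ℂ) ≠ 0 := Complex.two_pi_I_ne_zero
    rw [Complex.real_smul, Complex.real_smul, map_mul, Complex.conj_ofReal,
      ← mul_assoc (invWt α ξ : ℂ), hw]
    field_simp
  refine Complex.ext ?_ ?_
  · rw [Complex.zero_re, ← key 1]
    exact (integral_congr_ae (ae_of_all _ fun ξ => by simp)).trans
      (Complex.reCLM.integral_comp_comm hint) |>.symm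
  · rw [Complex.zero_im, ← key Complex.I]
    exact (integral_congr_ae (ae_of_all _ fun ξ => by simp)).trans
      (Complex.imCLM.integral_comp_comm hint) |>.symm

end GradField

lemma two_le_smooth : (2 : WithTop ℕ∞) ≤ ((⊤ : ℕ∞) : WithTop ℕ∞) :=
  WithTop.coe_le_coe.2 (le_top (a := (2 : ℕ∞)))

lemma fderiv_realPart_gradField_apply (a : Fin 3 → E3) (w : 𝓢(E3, ℂ)) (x : E3) (k : Fin 3) (v : E3) :
    (fderiv ℝ (fun y => realPart (gradField a w y)) x v) k
      = (fderiv ℝ (fderiv ℝ w) x v (a k)).re := by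
  have h1 : HasFDerivAt (fun y => realPart (gradField a w y))
      (fderiv ℝ (fun y => realPart (gradField a w y)) x) x :=
    ((contDiff_realPart_schwartz (gradField a w)).differentiable (by simp)).differentiableAt.hasFDerivAt
  have h2 := (EuclideanSpace.proj k : E3 →L[ℝ] ℝ).hasFDerivAt.comp x h1
  have h3 : HasFDerivAt (fun y => (fderiv ℝ w y (a k)).re)
      (Complex.reCLM.comp ((ContinuousLinearMap.apply ℝ ℂ (a k)).comp (fderiv ℝ (fderiv ℝ w) x))) x := by
    have h : DifferentiableAt ℝ (fderiv ℝ w) x :=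
      (((w.smooth ⊤).fderiv_right (m := 1) (by rw [one_add_one_eq_two]; exact two_le_smooth)).differentiable one_ne_zero).differentiableAt
    exact Complex.reCLM.hasFDerivAt.comp x
      ((ContinuousLinearMap.apply ℝ ℂ (a k)).hasFDerivAt.comp x h.hasFDerivAt)
  have e : (EuclideanSpace.proj k : E3 →L[ℝ] ℝ) ∘ (fun y => realPart (gradField a w y))
      = fun y => (fderiv ℝ w y (a k)).re := by
    ext1 y
    simp [realPart, gradField_apply]
  rw [e] at h2
  exact DFunLike.congr_fun (h2.unique h3) v

/-- The rotation of `w` in the plane of the coordinates `i` and `j`. -/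
def rotDir (i j : Fin 3) : Fin 3 → E3 :=
  Pi.single i (EuclideanSpace.single j 1) - Pi.single j (EuclideanSpace.single i 1)

lemma sum_rotDir {M : Type*} [AddCommGroup M] (i j : Fin 3) (L : Fin 3 → E3 →+ M) :
    ∑ k, L k (rotDir i j k)
      = L i (EuclideanSpace.single j 1) - L j (EuclideanSpace.single i 1) := by
  simp only [rotDir, Pi.sub_apply, map_sub, Finset.sum_sub_distrib]
  congr 1 <;>
  · rw [Finset.sum_eq_single_of_mem _ (Finset.mem_univ _), Pi.single_eq_same]
    intro b _ hb
    rw [Pi.single_eq_of_ne hb, map_zero]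

/-- The divergence is `∂_i ∂_j w − ∂_j ∂_i w`. These planar rotations are the only test fields on
which the weak form is used. -/
lemma div_gradField_rotDir (i j : Fin 3) (w : 𝓢(E3, ℂ)) (x : E3) :
    ∑ k : Fin 3, (fderiv ℝ (fun y => realPart (gradField (rotDir i j) w y)) x
      (EuclideanSpace.single k 1)) k = 0 := by
  simp only [fderiv_realPart_gradField_apply]
  have h := sum_rotDir i j fun k : Fin 3 =>
    (Complex.reCLM.comp (fderiv ℝ (fderiv ℝ w) x (EuclideanSpace.single k 1))).toLinearMap.toAddMonoidHom
  refine h.trans ?_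
  have hs : IsSymmSndFDerivAt ℝ w x :=
    (w.smooth ⊤).contDiffAt.isSymmSndFDerivAt (by simpa only [minSmoothness_of_isRCLikeNormedField] using two_le_smooth)
  have e := hs.eq (EuclideanSpace.single i 1) (EuclideanSpace.single j 1)
  change (fderiv ℝ (fderiv ℝ w) x (EuclideanSpace.single i 1) (EuclideanSpace.single j 1)).re
    - (fderiv ℝ (fderiv ℝ w) x (EuclideanSpace.single j 1) (EuclideanSpace.single i 1)).re = 0
  rw [e, sub_self]

/-! ### Gradient and solenoidal fields in frequency space -/

/-- Frequency fields parallel to the frequency. -/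
def gradSpace : Submodule ℝ LC where
  carrier := {Θ | ∀ i j, ∀ᵐ ξ, (ξ j : ℝ) • Θ ξ i = (ξ i : ℝ) • Θ ξ j}
  zero_mem' := fun i j => by
    filter_upwards [Lp.coeFn_zero C3 2 (volume : Measure E3)] with ξ h
    rw [h]
    simp
  add_mem' := fun {a b} ha hb i j => by
    filter_upwards [Lp.coeFn_add a b, ha i j, hb i j] with ξ h h1 h2
    simp only [h, Pi.add_apply, PiLp.add_apply, smul_add, h1, h2]
  smul_mem' := fun c {a} ha i j => by
    filter_upwards [Lp.coeFn_smul c a, ha i j] with ξ h h1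
    simp only [h, Pi.smul_apply, PiLp.smul_apply]
    rw [smul_comm, h1, smul_comm]

/-- The orthogonal complement of the gradient fields. -/
def solSpace : Submodule ℝ LC := gradSpaceᗮ

instance : CompleteSpace solSpace := inferInstanceAs (CompleteSpace gradSpaceᗮ)

/-- Pointwise, pick `ξ_i ≠ 0`. Since `ξ_i Θ_k = ξ_k Θ_i`, multiplying `⟨Θ, E⟩` by `ξ_i` turns it
into `⟨Θ_i, Σ ξ_k E_k⟩ = 0`. -/
lemma mem_solSpace {E : LC} (h : ∀ᵐ ξ, ∑ k, (ξ k : ℝ) • E ξ k = 0) : E ∈ solSpace := by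
  refine (Submodule.mem_orthogonal _ _).2 fun Θ hΘ => ?_
  rw [L2.inner_def]
  refine integral_eq_zero_of_ae ?_
  have hpar : ∀ᵐ ξ, ∀ i j, (ξ j : ℝ) • Θ ξ i = (ξ i : ℝ) • Θ ξ j :=
    ae_all_iff.2 fun i => ae_all_iff.2 fun j => hΘ i j
  have h0 : ∀ᵐ ξ : E3, ξ ≠ 0 := by simp [ae_iff]
  filter_upwards [h, hpar, h0] with ξ h1 h2 h3
  obtain ⟨i, hi⟩ : ∃ i, ξ i ≠ 0 := by
    by_contra! hne
    exact h3 (by ext i; exact hne i)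
  have hz : (ξ i : ℝ) * (inner ℝ (Θ ξ) (E ξ) : ℝ) = 0 := by
    have hk : ∀ k, (ξ i : ℝ) * (inner ℝ (Θ ξ k) (E ξ k) : ℝ)
        = inner ℝ (Θ ξ i) ((ξ k : ℝ) • E ξ k) := fun k => by
      rw [← real_inner_smul_left, ← h2 i k, real_inner_smul_left, real_inner_smul_right]
    rw [PiLp.inner_apply, Finset.mul_sum, Finset.sum_congr rfl fun k _ => hk k, ← inner_sum, h1,
      inner_zero_right]
  exact (mul_eq_zero.1 hz).resolve_left hi

/-- De Rham's theorem in frequency space: what annihilates all rotations is a gradient. It replaces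
the construction of the pressure. -/
lemma mem_gradSpace {α : ℝ} {Θ : LC} (h : ∀ i j, ∀ w : 𝓢(E3, ℂ), HasCompactSupport w →
    inner ℝ Θ (embed α (gradField (rotDir i j) w)) = 0) : Θ ∈ gradSpace := by
  intro i j
  filter_upwards [sum_inner_smul_eq_zero (h i j)] with ξ hξ
  have e := sum_rotDir i j fun k : Fin 3 =>
    ((innerSL ℝ ξ).smulRight (Θ ξ k)).toLinearMap.toAddMonoidHom
  have e' := e.symm.trans hξ
  change (inner ℝ ξ (EuclideanSpace.single j (1 : ℝ)) : ℝ) • Θ ξ i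
    - (inner ℝ ξ (EuclideanSpace.single i (1 : ℝ)) : ℝ) • Θ ξ j = 0 at e'
  simpa [EuclideanSpace.inner_single_right, sub_eq_zero] using e'

/-- The Fourier transform of a divergence free field is orthogonal to the frequency. -/
theorem sum_fourierL2_eq_zero {w : L2} (hw : IsDivFree w) :
    ∀ᵐ ξ, ∑ k, (ξ k : ℝ) • fourierL2 w ξ k = 0 := by
  have h : ∀ᵐ ξ, ∑ k, (inner ℝ ξ (EuclideanSpace.single k (1 : ℝ)) : ℝ)
      • wtOp 0 le_rfl (fourierL2 w) ξ k = 0 := by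
    -- With the coordinate directions, `gradField` is the gradient of `φ`, and the pairing is the
    -- distributional divergence of `w`. Any weight serves, hence the exponent 0.
    refine sum_inner_smul_eq_zero (α := 0) fun φ hφ => ?_
    rw [inner_wtOp, synth_wtDensity_embed]
    have hre : ContDiff ℝ ∞ fun x => (φ x).re := Complex.reCLM.contDiff.comp (φ.smooth ⊤)
    rw [← hw (fun x => (φ x).re) hre (hφ.comp_left (g := Complex.re) rfl)]
    refine integral_congr_ae (ae_of_all _ fun x => ?_)
    have hd : fderiv ℝ (fun x => (φ x).re) x = Complex.reCLM.comp (fderiv ℝ φ x) :=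
      (Complex.reCLM.hasFDerivAt.comp x (φ.hasFDerivAt x)).fderiv
    simp only [hd, PiLp.inner_apply, realPart, gradField_apply]
    have hx : w x = ∑ k, (w x k) • EuclideanSpace.single k (1 : ℝ) := by
      ext i; simp [Pi.single_apply]
    conv_rhs => rw [hx]
    simp only [map_sum, map_smul, ContinuousLinearMap.comp_apply, Complex.reCLM_apply, smul_eq_mul]
    refine Finset.sum_congr rfl fun k _ => ?_
    simp [mul_comm]
  filter_upwards [h, coeFn_wtOp 0 le_rfl (fourierL2 w)] with ξ h1 h2
  rw [h2] at h1
  simp only [wtDensity, PiLp.smul_apply, EuclideanSpace.inner_single_right] at h1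
  have h3 : wt 0 ξ • ∑ k, (ξ k : ℝ) • fourierL2 w ξ k = 0 := by
    rw [Finset.smul_sum, ← h1]
    refine Finset.sum_congr rfl fun k _ => ?_
    rw [smul_comm]
    simp
  exact (smul_eq_zero.1 h3).resolve_left (wt_pos 0 ξ).ne'

lemma mulOp_mem_solSpace {E : LC} (h : ∀ᵐ ξ, ∑ k, (ξ k : ℝ) • E ξ k = 0) (m : E3 → ℝ)
    (hm : Measurable m) (C : ℝ) (hC : ∀ ξ, |m ξ| ≤ C) : mulOp m hm C hC E ∈ solSpace := by
  refine mem_solSpace ?_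
  filter_upwards [h, coeFn_mulOp m hm C hC E] with ξ h1 h2
  simp only [h2, PiLp.smul_apply]
  simp_rw [smul_comm _ (m ξ)]
  rw [← Finset.smul_sum, h1, smul_zero]

/-! ### The evolution equation in frequency space -/

/-- The projected flux, cut off outside the time interval. -/
def solFlux (α : ℝ) (hα : 0 ≤ α) (T : ℝ≥0∞) (u : ℝ → L2) : ℝ → LC :=
  (timeInterval T).indicator fun t => solSpace.starProjection (fluxVec α hα (u t))

lemma aestronglyMeasurable_solFlux {α : ℝ} (hα : 0 ≤ α) {T : ℝ≥0∞} {u : ℝ → L2}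
    (hu : AEStronglyMeasurable u (volume.restrict (timeInterval T))) :
    AEStronglyMeasurable (solFlux α hα T u) volume := by
  refine (aestronglyMeasurable_indicator_iff (isOpen_timeInterval T).measurableSet).2 ?_
  exact (solSpace.starProjection.continuous.comp (continuous_fluxVec α hα)).comp_aestronglyMeasurable hu

lemma exists_norm_fluxVec_le {α : ℝ} (hα : 0 ≤ α) {T : ℝ≥0∞} {u : ℝ → L2}
    (hu : MemLp u ⊤ (volume.restrict (timeInterval T))) :
    ∃ C, 0 ≤ C ∧ ∀ᵐ t ∂volume.restrict (timeInterval T), ‖u t‖ ≤ C ∧ ‖fluxVec α hα (u t)‖ ≤ C := by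
  set B := (eLpNorm u ⊤ (volume.restrict (timeInterval T))).toReal with hB
  have hb : ∀ᵐ t ∂volume.restrict (timeInterval T), ‖u t‖ ≤ B := by
    rw [hB, eLpNorm_exponent_top]
    have hfin : eLpNormEssSup u (volume.restrict (timeInterval T)) ≠ ⊤ := by
      rw [← eLpNorm_exponent_top]; exact hu.2.ne
    filter_upwards [ae_le_eLpNormEssSup (f := u) (μ := volume.restrict (timeInterval T))] with t ht
    rw [← toReal_enorm]
    exact ENNReal.toReal_mono hfin ht
  have hB0 : 0 ≤ B := ENNReal.toReal_nonneg
  have hg0 : 0 ≤ gradConst α := by unfold gradConst; positivity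
  refine ⟨B + (gradConst α * B * B + ‖dissOp α hα‖ * B), by positivity, ?_⟩
  filter_upwards [hb] with t ht
  refine ⟨ht.trans (le_add_of_nonneg_right (by positivity)), ?_⟩
  refine (norm_fluxVec_le α hα (u t)).trans ((?_ : _ ≤ _).trans (le_add_of_nonneg_left hB0))
  gcongr

lemma exists_bound_solFlux {α : ℝ} (hα : 0 ≤ α) {T : ℝ≥0∞} {u : ℝ → L2}
    (hu : MemLp u ⊤ (volume.restrict (timeInterval T))) :
    ∃ C, ∀ᵐ t, ‖solFlux α hα T u t‖ ≤ C := by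
  obtain ⟨C, hC0, hC⟩ := exists_norm_fluxVec_le hα hu
  refine ⟨C, ?_⟩
  filter_upwards [(ae_restrict_iff' (isOpen_timeInterval T).measurableSet).1 hC] with t ht
  by_cases htU : t ∈ timeInterval T
  · rw [solFlux, Set.indicator_of_mem htU]
    exact (solSpace.norm_starProjection_apply_le _).trans (ht htU).2
  · rw [solFlux, Set.indicator_of_notMem htU, norm_zero]
    exact hC0

/-- `ae_eq_primitive` wants arbitrary test vectors `E`, while the weak form admits only solenoidal
ones. Replacing `E` by its projection costs nothing on the transforms of `u` and `u₀`, which are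
solenoidal, and projects the flux. -/
theorem wtOp_ae_eq_primitive {α : ℝ} (hα : 0 ≤ α) {T : ℝ≥0∞} (hT : 0 < T) {u₀ : L2} {u : ℝ → L2}
    (hu : MemLp u ⊤ (volume.restrict (timeInterval T)))
    (hdiv : ∀ᵐ t ∂volume.restrict (timeInterval T), IsDivFree (u t)) (hdiv₀ : IsDivFree u₀)
    (hsol : IsDistributionalSolution α T u₀ u) :
    (fun t => wtOp α hα (fourierL2 (u t))) =ᵐ[volume.restrict (timeInterval T)]
      primitive (wtOp α hα (fourierL2 u₀)) (solFlux α hα T u) := by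
  have hU := (isOpen_timeInterval T).measurableSet
  obtain ⟨C, hC0, hC⟩ := exists_norm_fluxVec_le hα hu
  obtain ⟨B, hgC⟩ := exists_bound_solFlux hα hu
  have hvcont : Continuous fun w : L2 => wtOp α hα (fourierL2 w) :=
    (wtOp α hα).continuous.comp fourierL2CLM.continuous
  have hvC : ∀ᵐ t ∂volume.restrict (timeInterval T), ‖wtOp α hα (fourierL2 (u t))‖ ≤ ‖wtOp α hα‖ * C := by
    filter_upwards [hC] with t ht
    refine (ContinuousLinearMap.le_opNorm _ _).trans ?_
    rw [norm_fourierL2]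
    gcongr
    exact ht.1
  have hvm : AEStronglyMeasurable (fun t => wtOp α hα (fourierL2 (u t)))
      (volume.restrict (timeInterval T)) := hvcont.comp_aestronglyMeasurable hu.1
  have hfm : AEStronglyMeasurable (fun t => fluxVec α hα (u t))
      (volume.restrict (timeInterval T)) := (continuous_fluxVec α hα).comp_aestronglyMeasurable hu.1
  refine ae_eq_primitive hT (aestronglyMeasurable_solFlux hα hu.1) hgC
    (memLp_top_of_bound hvm _ hvC) _ fun η hη hηc hηT E => ?_
  have hi : ∀ {ζ : ℝ → ℝ} (_ : Continuous ζ) (_ : HasCompactSupport ζ) {w : ℝ → LC} {B : ℝ}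
      (_ : AEStronglyMeasurable w (volume.restrict (timeInterval T)))
      (_ : ∀ᵐ t ∂volume.restrict (timeInterval T), ‖w t‖ ≤ B),
      IntegrableOn (fun t => ζ t • w t) (timeInterval T) := fun {ζ} hζ hζc {w B} hw hB =>
    ((hζ.integrable_of_hasCompactSupport hζc).integrableOn.smul_of_top_left
      (memLp_top_of_bound hw _ hB))
  have hη' : Continuous (deriv η) := hη.continuous_deriv (by simp)
  have i1 := hi hη' hηc.deriv hvm hvC
  have i2 := hi hη.continuous hηc hfm (hC.mono fun t ht => ht.2)
  -- The defect of the unprojected equation against `η`, as a vector of `LC`. It annihilates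
  -- rotations, so it is a gradient and is orthogonal to the projection of `E`.
  set Θ : LC := (∫ τ in timeInterval T,
      (deriv η τ • wtOp α hα (fourierL2 (u τ)) + η τ • fluxVec α hα (u τ)))
    + η 0 • wtOp α hα (fourierL2 u₀) with hΘ
  have hΘE : ∀ G : LC, inner ℝ Θ G = (∫ τ in timeInterval T,
      (deriv η τ * inner ℝ (wtOp α hα (fourierL2 (u τ))) G
        + η τ * inner ℝ (fluxVec α hα (u τ)) G))
      + η 0 * inner ℝ (wtOp α hα (fourierL2 u₀)) G := fun G => by
    rw [hΘ, inner_add_left, real_inner_smul_left, real_inner_comm, 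
      ← integral_inner (f := fun τ => deriv η τ • wtOp α hα (fourierL2 (u τ))
        + η τ • fluxVec α hα (u τ)) (i1.add i2)]
    congr 2
    ext τ
    rw [inner_add_right, real_inner_smul_right, real_inner_smul_right, real_inner_comm G,
      real_inner_comm G]
  have hΘN : Θ ∈ gradSpace := by
    refine mem_gradSpace (α := α) fun i j w hw => ?_
    rw [hΘE, weak_embed hα hsol _ (hasCompactSupport_gradField _ hw) (div_gradField_rotDir i j w)
      hη hηc hηT, neg_add_cancel]
  have h0 : inner ℝ Θ (solSpace.starProjection E) = 0 :=
    (Submodule.mem_orthogonal _ _).1 (solSpace.starProjection_apply_mem E) Θ hΘN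
  rw [hΘE] at h0
  have hproj : ∀ w : L2, IsDivFree w → inner ℝ (wtOp α hα (fourierL2 w)) (solSpace.starProjection E)
      = inner ℝ (wtOp α hα (fourierL2 w)) E := fun w hw => by
    have hmem : wtOp α hα (fourierL2 w) ∈ solSpace :=
      mulOp_mem_solSpace (sum_fourierL2_eq_zero hw) _ _ _ _
    rw [← Submodule.inner_starProjection_left_eq_right, Submodule.starProjection_eq_self_iff.2 hmem]
  rw [hproj u₀ hdiv₀] at h0
  rw [← eq_neg_of_add_eq_zero_left h0]
  refine integral_congr_ae ?_
  filter_upwards [hdiv, ae_restrict_mem hU] with t ht htU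
  rw [hproj _ ht, solFlux, Set.indicator_of_mem htU, Submodule.inner_starProjection_left_eq_right]

/-! ### Cutoffs and Sobolev inequalities -/

lemma exists_cutoff : ∃ ζ : ℕ → E3 → ℝ, (∀ k, ContDiff ℝ ((⊤ : ℕ∞) : WithTop ℕ∞) (ζ k)) ∧
    (∀ k, HasCompactSupport (ζ k)) ∧ (∀ k x, |ζ k x| ≤ 1) ∧
    (∀ x, Tendsto (fun k => ζ k x) atTop (𝓝 1)) ∧
    ∃ C : ℝ, 0 ≤ C ∧ ∀ k x, ‖fderiv ℝ (ζ k) x‖ ≤ C * ((k : ℝ) + 1)⁻¹ := by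
  let χ : ContDiffBump (0 : E3) := ⟨1, 2, by norm_num, by norm_num⟩
  set r : ℕ → ℝ := fun k => ((k : ℝ) + 1)⁻¹ with hr
  have hr0 : ∀ k, 0 < r k := fun k => by simp only [hr]; positivity
  have hrt : Tendsto r atTop (𝓝 0) := by
    simpa [hr, one_div] using tendsto_one_div_add_atTop_nhds_zero_nat (𝕜 := ℝ)
  have hχ1 : ContDiff ℝ 1 χ := χ.contDiff
  obtain ⟨C, hC⟩ := (χ.hasCompactSupport.fderiv (𝕜 := ℝ)).exists_bound_of_continuous
    (hχ1.continuous_fderiv one_ne_zero)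
  have hC0 : 0 ≤ C := (norm_nonneg _).trans (hC 0)
  refine ⟨fun k x => χ (r k • x), fun k => χ.contDiff.comp (contDiff_const_smul _),
    fun k => χ.hasCompactSupport.comp_smul (hr0 k).ne', fun k x => ?_, fun x => ?_, C, hC0,
    fun k x => ?_⟩
  · rw [abs_of_nonneg χ.nonneg]
    exact χ.le_one
  · have h1 : χ 0 = 1 := χ.one_of_mem_closedBall (by simp [χ])
    have h2 : Tendsto (fun k => r k • x) atTop (𝓝 0) := by
      simpa using hrt.smul_const x
    have h3 := (χ.continuous.tendsto 0).comp h2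
    rwa [h1] at h3
  · have h1 : HasFDerivAt (fun x : E3 => χ (r k • x))
        ((fderiv ℝ χ (r k • x)).comp (r k • ContinuousLinearMap.id ℝ E3)) x :=
      HasFDerivAt.comp (g := χ) (f := fun x : E3 => r k • x) x ((hχ1.differentiable one_ne_zero).differentiableAt.hasFDerivAt)
        ((hasFDerivAt_id x).const_smul (r k))
    rw [h1.fderiv, ContinuousLinearMap.comp_smul, ContinuousLinearMap.comp_id, norm_smul,
      Real.norm_of_nonneg (hr0 k).le, mul_comm]
    gcongr
    exact hC _

lemma eLpNorm_le_add_const_mul {X U V W : Type*} [MeasurableSpace X] {μ : Measure X}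
    [NormedAddCommGroup U] [NormedAddCommGroup V] [NormedAddCommGroup W] {f : X → U} {g : X → V}
    {h : X → W} (hf : AEStronglyMeasurable f μ) (hg : AEStronglyMeasurable g μ) {c : ℝ} (hc : 0 ≤ c)
    {p : ℝ≥0∞} (hp : 1 ≤ p) (hle : ∀ x, ‖h x‖ ≤ ‖f x‖ + c * ‖g x‖) :
    eLpNorm h p μ ≤ eLpNorm f p μ + ENNReal.ofReal c * eLpNorm g p μ := by
  refine (eLpNorm_mono_real hle).trans ((eLpNorm_add_le hf.norm (hg.norm.const_mul c) hp).trans ?_)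
  rw [eLpNorm_norm]
  refine add_le_add le_rfl ?_
  refine (eLpNorm_const_smul c (fun x => ‖g x‖) p μ).trans_le ?_
  rw [eLpNorm_norm, Real.enorm_of_nonneg hc]

/-- The constant of the Sobolev inequality `‖f‖_{L⁶} ≤ C ‖∇f‖_{L²}`. -/
def sobolevConst : ℝ≥0 := SNormLESNormFDerivOfEqConst E3 (volume : Measure E3) 2

/-- Apply the inequality for compactly supported functions to `ζ_k f`. As `f ∈ L²`, the error `f
∇ζ_k` is of order `1/(k+1)` in `L²`, and Fatou's lemma gives the limit. -/
theorem eLpNorm_six_le {f : E3 → E3} (hf : ContDiff ℝ 1 f) (h2 : MemLp f 2 volume) :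
    eLpNorm f 6 volume ≤ sobolevConst * eLpNorm (fderiv ℝ f) 2 volume := by
  obtain ⟨ζ, hζs, hζc, hζ1, hζt, C, hC0, hC⟩ := exists_cutoff
  have hg : ∀ k, ContDiff ℝ 1 fun x => ζ k x • f x := fun k =>
    ((hζs k).of_le (by exact_mod_cast le_top)).smul hf
  have hd : ∀ k x, fderiv ℝ (fun x => ζ k x • f x) x
      = ζ k x • fderiv ℝ f x + (fderiv ℝ (ζ k) x).smulRight (f x) := fun k x =>
    ((((hζs k).differentiable (by simp)).differentiableAt.hasFDerivAt).smul
      ((hf.differentiable one_ne_zero).differentiableAt.hasFDerivAt)).fderiv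
  have hfd : AEStronglyMeasurable (fderiv ℝ f) (volume : Measure E3) :=
    (hf.continuous_fderiv one_ne_zero).aestronglyMeasurable
  have hbound : ∀ k, eLpNorm (fun x => ζ k x • f x) 6 volume
      ≤ sobolevConst * (eLpNorm (fderiv ℝ f) 2 volume
        + ENNReal.ofReal (C * ((k : ℝ) + 1)⁻¹) * eLpNorm f 2 volume) := fun k => by
    have h6 := eLpNorm_le_eLpNorm_fderiv_of_eq (μ := (volume : Measure E3)) (p := 2) (p' := 6)
      (hg k) ((hζc k).smul_right) (by norm_num) (by simp) (by simp; norm_num)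
    simp only [ENNReal.coe_ofNat, NNReal.coe_ofNat] at h6
    refine h6.trans ?_
    change (sobolevConst : ℝ≥0∞) * _ ≤ _
    refine mul_le_mul' le_rfl ?_
    refine eLpNorm_le_add_const_mul hfd h2.1 (by positivity) one_le_two fun x => ?_
    rw [hd]
    refine (norm_add_le _ _).trans (add_le_add ?_ ?_)
    · rw [norm_smul]
      exact mul_le_of_le_one_left (norm_nonneg _) (hζ1 k x)
    · rw [ContinuousLinearMap.norm_smulRight_apply]
      gcongr
      exact hC k x
  have hlim : Tendsto (fun k : ℕ => (sobolevConst : ℝ≥0∞) * (eLpNorm (fderiv ℝ f) 2 volume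
        + ENNReal.ofReal (C * ((k : ℝ) + 1)⁻¹) * eLpNorm f 2 volume)) atTop
      (𝓝 (sobolevConst * eLpNorm (fderiv ℝ f) 2 volume)) := by
    have hr : Tendsto (fun k : ℕ => C * ((k : ℝ) + 1)⁻¹) atTop (𝓝 0) := by
      simpa [one_div] using (tendsto_one_div_add_atTop_nhds_zero_nat (𝕜 := ℝ)).const_mul C
    have h1 := ENNReal.Tendsto.mul_const (ENNReal.tendsto_ofReal hr) (Or.inr h2.2.ne)
    have h3 := ENNReal.Tendsto.const_mul (h1.const_add (eLpNorm (fderiv ℝ f) 2 volume))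
      (Or.inr (ENNReal.coe_ne_top (r := sobolevConst)))
    simpa using h3
  refine (Lp.eLpNorm_lim_le_liminf_eLpNorm (f := fun k x => ζ k x • f x)
    (fun k => (hg k).continuous.aestronglyMeasurable) f
    (ae_of_all _ fun x => by simpa using (hζt x).smul_const (f x))).trans ?_
  rw [← hlim.liminf_eq]
  exact liminf_le_liminf (Eventually.of_forall hbound)

/-! ### Hölder estimates and skew-symmetry of the trilinear form -/

lemma eLpNorm_natCast_pow {X V : Type*} [MeasurableSpace X] {μ : Measure X} [NormedAddCommGroup V]
    (f : X → V) (n : ℕ) (hn : n ≠ 0) : eLpNorm f n μ ^ n = ∫⁻ x, ‖f x‖ₑ ^ n ∂μ := by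
  have h := eLpNorm_nnreal_pow_eq_lintegral (f := f) (μ := μ) (p := (n : ℝ≥0))
    (Nat.cast_ne_zero.2 hn)
  simpa [ENNReal.rpow_natCast] using h

lemma lintegral_mul_sq_le {X : Type*} [MeasurableSpace X] {μ : Measure X} {f g : X → ℝ≥0∞}
    (hf : AEMeasurable f μ) (hg : AEMeasurable g μ) :
    (∫⁻ x, f x * g x ∂μ) ^ 2 ≤ (∫⁻ x, f x ^ 2 ∂μ) * ∫⁻ x, g x ^ 2 ∂μ := by
  have h := ENNReal.lintegral_mul_le_Lp_mul_Lq μ Real.HolderConjugate.two_two hf hg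
  simp only [Pi.mul_apply, ENNReal.rpow_two] at h
  refine (pow_le_pow_left' h 2).trans_eq ?_
  rw [mul_pow]
  congr 1 <;>
  · rw [← ENNReal.rpow_two, ← ENNReal.rpow_mul]
    norm_num

/-- Cauchy–Schwarz applied to `|f|⁴ = |f| · |f|³`. -/
lemma eLpNorm_four_le {X V : Type*} [MeasurableSpace X] {μ : Measure X} [NormedAddCommGroup V]
    {f : X → V} (hf : AEStronglyMeasurable f μ) :
    eLpNorm f 4 μ ^ 4 ≤ eLpNorm f 2 μ * eLpNorm f 6 μ ^ 3 := by
  rw [← ENNReal.pow_le_pow_left_iff two_ne_zero, mul_pow, ← pow_mul (eLpNorm f 6 μ)]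
  have h4 := eLpNorm_natCast_pow (μ := μ) f 4 (by norm_num)
  have h2 := eLpNorm_natCast_pow (μ := μ) f 2 (by norm_num)
  have h6 := eLpNorm_natCast_pow (μ := μ) f 6 (by norm_num)
  push_cast at h4 h2 h6
  norm_num
  rw [h4, h2, h6]
  have h := lintegral_mul_sq_le hf.enorm (hf.enorm.pow_const 3)
  simp_rw [← pow_mul, ← pow_succ'] at h
  exact h

/-- Hölder's inequality for the trilinear form. -/
theorem enorm_trilin_le {φ u v : E3 → E3} (hφ : AEStronglyMeasurable (fderiv ℝ φ) volume)
    (hu : AEStronglyMeasurable u volume) (hv : AEStronglyMeasurable v volume) :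
    ‖trilin φ u v‖ₑ ≤ eLpNorm (fderiv ℝ φ) 2 volume * (eLpNorm u 4 volume * eLpNorm v 4 volume) := by
  have h1 : ‖trilin φ u v‖ₑ ≤ ∫⁻ x, ‖fderiv ℝ φ x‖ₑ * (‖u x‖ₑ * ‖v x‖ₑ) := by
    refine (enorm_integral_le_lintegral_enorm _).trans (lintegral_mono fun x => ?_)
    rw [← ofReal_norm, ← ofReal_norm, ← ofReal_norm, ← ofReal_norm, ← ENNReal.ofReal_mul (by positivity),
      ← ENNReal.ofReal_mul (by positivity), ← mul_assoc]
    refine ENNReal.ofReal_le_ofReal ((norm_inner_le_norm (𝕜 := ℝ) _ _).trans ?_)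
    gcongr
    exact ContinuousLinearMap.le_opNorm _ _
  have h4 := fun f : E3 → E3 => eLpNorm_natCast_pow (μ := volume) f 4 (by norm_num)
  have h2 := eLpNorm_natCast_pow (μ := volume) (fderiv ℝ φ) 2 (by norm_num)
  push_cast at h4 h2
  have h3 : ∫⁻ x, (‖u x‖ₑ * ‖v x‖ₑ) ^ 2 ≤ (eLpNorm u 4 volume * eLpNorm v 4 volume) ^ 2 := by
    rw [← ENNReal.pow_le_pow_left_iff two_ne_zero, ← pow_mul, mul_pow]
    norm_num
    rw [h4, h4]
    have h := lintegral_mul_sq_le (hu.enorm.pow_const 2) (hv.enorm.pow_const 2)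
    simp_rw [← pow_mul] at h
    simpa only [mul_pow] using h
  rw [← ENNReal.pow_le_pow_left_iff two_ne_zero, mul_pow, h2]
  refine (pow_le_pow_left' h1 2).trans ((lintegral_mul_sq_le hφ.enorm (hu.enorm.mul hv.enorm)).trans ?_)
  gcongr
  exact h3

/-- The trilinear form is skew-symmetric for divergence free advecting fields. -/
theorem trilin_self_eq_zero {φ : E3 → E3} (hφ : ContDiff ℝ ((⊤ : ℕ∞) : WithTop ℕ∞) φ) {B C : ℝ}
    (hB : ∀ x, ‖φ x‖ ≤ B) (h2 : MemLp φ 2 volume) (hC : ∀ x, ‖fderiv ℝ φ x‖ ≤ C) {w : L2}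
    (hw : IsDivFree w) : trilin φ w φ = 0 := by
  obtain ⟨ζ, hζs, hζc, hζ1, hζt, A, hA0, hA⟩ := exists_cutoff
  have hC0 : 0 ≤ C := (norm_nonneg _).trans (hC 0)
  have hB0 : 0 ≤ B := (norm_nonneg _).trans (hB 0)
  have hd : ∀ k x v, fderiv ℝ (fun y => ζ k y * (2⁻¹ * ‖φ y‖ ^ 2)) x v
      = ζ k x * inner ℝ (fderiv ℝ φ x v) (φ x) + 2⁻¹ * ‖φ x‖ ^ 2 * fderiv ℝ (ζ k) x v := fun k x v => by
    have h := ((((hζs k).differentiable (by simp)).differentiableAt (x := x)).hasFDerivAt).mul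
      ((((hφ.differentiable (by simp)).differentiableAt (x := x)).hasFDerivAt).norm_sq.const_mul
        (2⁻¹ : ℝ))
    have h' := congrArg (fun L : E3 →L[ℝ] ℝ => L v) h.fderiv
    refine (show _ = _ from h').trans ?_
    simp [real_inner_comm]
  -- Since `(w·∇)φ · φ = w · ∇(|φ|²/2)`, this is the condition `div w = 0` tested with `ζ_k |φ|²/2`;
  -- the cutoff supplies compact support.
  have hz : ∀ k, ∫ x, (ζ k x * inner ℝ (fderiv ℝ φ x (w x)) (φ x)
      + 2⁻¹ * ‖φ x‖ ^ 2 * fderiv ℝ (ζ k) x (w x)) = 0 := fun k => by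
    rw [← hw (fun y => ζ k y * (2⁻¹ * ‖φ y‖ ^ 2))
      ((hζs k).mul (contDiff_const.mul (hφ.norm_sq ℝ))) (hζc k).mul_right]
    simp_rw [hd]
  have hm1 : AEStronglyMeasurable (fun x => (inner ℝ (fderiv ℝ φ x (w x)) (φ x) : ℝ)) volume :=
    (integrable_trilin (hφ.continuous_fderiv (by simp)).aestronglyMeasurable hC (memLp_coe w) h2).1
  have hm2 : ∀ k, AEStronglyMeasurable (fun x => fderiv ℝ (ζ k) x (w x)) volume := fun k =>
    Continuous.comp_aestronglyMeasurable
      (g := fun p : (E3 →L[ℝ] ℝ) × E3 => p.1 p.2) (by fun_prop)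
      (((hζs k).continuous_fderiv (by simp)).aestronglyMeasurable.prodMk (memLp_coe w).1)
  have hdom : Integrable fun x => (C + 2⁻¹ * B * A) * (‖w x‖ * ‖φ x‖) :=
    (integral_norm_mul_norm_le (memLp_coe w) h2).1.const_mul _
  have hlim : Tendsto (fun k => ∫ x, (ζ k x * inner ℝ (fderiv ℝ φ x (w x)) (φ x)
      + 2⁻¹ * ‖φ x‖ ^ 2 * fderiv ℝ (ζ k) x (w x))) atTop (𝓝 (trilin φ w φ)) := by
    refine tendsto_integral_of_dominated_convergence _ (fun k => ?_) hdom (fun k => ?_) ?_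
    · exact ((hζs k).continuous.aestronglyMeasurable.mul hm1).add
        ((((h2.1.norm.pow 2).const_mul _)).mul (hm2 k))
    · refine ae_of_all _ fun x => ?_
      have e1 : ‖ζ k x * inner ℝ (fderiv ℝ φ x (w x)) (φ x)‖ ≤ C * (‖w x‖ * ‖φ x‖) := by
        rw [norm_mul]
        refine (mul_le_of_le_one_left (norm_nonneg _) (hζ1 k x)).trans
          ((norm_inner_le_norm (𝕜 := ℝ) _ _).trans ?_)
        rw [← mul_assoc]
        gcongr
        exact (ContinuousLinearMap.le_opNorm _ _).trans (by gcongr; exact hC x)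
      have e2 : ‖2⁻¹ * ‖φ x‖ ^ 2 * fderiv ℝ (ζ k) x (w x)‖ ≤ 2⁻¹ * B * A * (‖w x‖ * ‖φ x‖) := by
        have e3 : ‖fderiv ℝ (ζ k) x (w x)‖ ≤ A * ‖w x‖ := by
          refine (ContinuousLinearMap.le_opNorm _ _).trans ?_
          gcongr
          refine (hA k x).trans (mul_le_of_le_one_right hA0 (inv_le_one_of_one_le₀ ?_))
          linarith [(k.cast_nonneg : (0 : ℝ) ≤ k)]
        rw [norm_mul, Real.norm_of_nonneg (by positivity)]
        calc 2⁻¹ * ‖φ x‖ ^ 2 * ‖fderiv ℝ (ζ k) x (w x)‖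
            ≤ 2⁻¹ * (B * ‖φ x‖) * (A * ‖w x‖) := by
              rw [pow_two]
              gcongr
              exact hB x
          _ = _ := by ring
      refine (norm_add_le _ _).trans ((add_le_add e1 e2).trans_eq ?_)
      ring
    · refine ae_of_all _ fun x => ?_
      have t1 : Tendsto (fun k => ζ k x * (inner ℝ (fderiv ℝ φ x (w x)) (φ x) : ℝ)) atTop
          (𝓝 (inner ℝ (fderiv ℝ φ x (w x)) (φ x))) := by
        simpa using (hζt x).mul_const (inner ℝ (fderiv ℝ φ x (w x)) (φ x) : ℝ)
      have t2 : Tendsto (fun k => fderiv ℝ (ζ k) x (w x)) atTop (𝓝 0) := by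
        refine squeeze_zero_norm (a := fun k : ℕ => A * ((k : ℝ) + 1)⁻¹ * ‖w x‖) (fun k => ?_) ?_
        · exact (ContinuousLinearMap.le_opNorm _ _).trans (by gcongr; exact hA k x)
        · simpa [one_div] using
            ((tendsto_one_div_add_atTop_nhds_zero_nat (𝕜 := ℝ)).const_mul A).mul_const ‖w x‖
      simpa using t1.add (t2.const_mul (2⁻¹ * ‖φ x‖ ^ 2))
  refine tendsto_nhds_unique hlim ?_
  simp_rw [hz]
  exact tendsto_const_nhds

/-! ### Frequency truncation -/

/-- The indicator function of the ball of radius `n`. -/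
def cut (n : ℕ) : E3 → ℝ := (Metric.closedBall (0 : E3) n).indicator 1

lemma measurable_cut (n : ℕ) : Measurable (cut n) :=
  measurable_one.indicator Metric.isClosed_closedBall.measurableSet

lemma cut_of_le {n : ℕ} {ξ : E3} (h : ‖ξ‖ ≤ n) : cut n ξ = 1 :=
  Set.indicator_of_mem (by simpa using h) _

lemma cut_of_lt {n : ℕ} {ξ : E3} (h : n < ‖ξ‖) : cut n ξ = 0 :=
  Set.indicator_of_notMem (by simpa using h) _

lemma cut_nonneg (n : ℕ) (ξ : E3) : 0 ≤ cut n ξ := Set.indicator_nonneg (fun _ _ => zero_le_one) ξ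

lemma cut_le_one (n : ℕ) (ξ : E3) : cut n ξ ≤ 1 :=
  Set.indicator_le_self' (fun _ _ => zero_le_one) ξ

lemma abs_cut_le (n : ℕ) (ξ : E3) : |cut n ξ| ≤ 1 := by
  rw [abs_of_nonneg (cut_nonneg n ξ)]
  exact cut_le_one n ξ

lemma cut_mul_cut {m n : ℕ} (h : m ≤ n) (ξ : E3) : cut m ξ * cut n ξ = cut m ξ := by
  rcases le_or_gt ‖ξ‖ m with h1 | h1
  · rw [cut_of_le h1, cut_of_le (h1.trans (Nat.cast_le.2 h)), mul_one]
  · rw [cut_of_lt h1, zero_mul]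

lemma tendsto_cut (ξ : E3) : ∀ᶠ n in atTop, cut n ξ = 1 := by
  filter_upwards [eventually_ge_atTop ⌈‖ξ‖⌉₊] with n hn
  exact cut_of_le ((Nat.le_ceil _).trans (Nat.cast_le.2 hn))

lemma norm_pow_mul_cut_le (n k : ℕ) (ξ : E3) : ‖ξ‖ ^ k * cut n ξ ≤ (n : ℝ) ^ k := by
  rcases le_or_gt ‖ξ‖ n with h | h
  · rw [cut_of_le h, mul_one]
    gcongr
  · rw [cut_of_lt h, mul_zero]
    positivity

/-- Truncation to frequencies of size at most `n`. -/
def lowPass (n : ℕ) : LC →L[ℝ] LC := mulOp (cut n) (measurable_cut n) 1 (abs_cut_le n)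

/-- The function `1_{|ξ| ≤ n} E(ξ)`. -/
def lowDensity (n : ℕ) (E : LC) (ξ : E3) : C3 := cut n ξ • E ξ

lemma coeFn_lowPass (n : ℕ) (E : LC) : lowPass n E =ᵐ[volume] lowDensity n E := coeFn_mulOp _ _ _ _ E

lemma norm_lowDensity (n : ℕ) (E : LC) (ξ : E3) : ‖lowDensity n E ξ‖ = cut n ξ * ‖E ξ‖ := by
  rw [lowDensity, norm_smul, Real.norm_of_nonneg (cut_nonneg n ξ)]

lemma memLp_lowDensity (n : ℕ) (E : LC) : MemLp (lowDensity n E) 2 volume :=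
  memLp_smul_of_bdd (measurable_cut n) (abs_cut_le n) E

lemma integrable_lowDensity (n : ℕ) (E : LC) : Integrable (lowDensity n E) := by
  have h : MemLp (cut n) 2 volume :=
    memLp_indicator_const 2 Metric.isClosed_closedBall.measurableSet 1
      (Or.inr (measure_closedBall_lt_top).ne)
  refine (integral_norm_mul_norm_le h (Lp.memLp E)).1.mono' (memLp_lowDensity n E).1
    (ae_of_all _ fun ξ => ?_)
  rw [norm_lowDensity, Real.norm_of_nonneg (cut_nonneg n ξ)]

lemma integrable_pow_mul_lowDensity (n k : ℕ) (E : LC) :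
    Integrable fun ξ => ‖ξ‖ ^ k * ‖lowDensity n E ξ‖ := by
  refine ((integrable_lowDensity n E).norm.const_mul ((n : ℝ) ^ k)).mono'
    ((by fun_prop : Continuous fun ξ : E3 => ‖ξ‖ ^ k).aestronglyMeasurable.mul
      (integrable_lowDensity n E).1.norm) (ae_of_all _ fun ξ => ?_)
  rw [Real.norm_of_nonneg (by positivity), norm_lowDensity, ← cut_mul_cut le_rfl ξ]
  have h := norm_pow_mul_cut_le n k ξ
  have h0 := cut_nonneg n ξ
  calc ‖ξ‖ ^ k * (cut n ξ * cut n ξ * ‖E ξ‖) = (‖ξ‖ ^ k * cut n ξ) * (cut n ξ * ‖E ξ‖) := by ring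
    _ ≤ (n : ℝ) ^ k * (cut n ξ * ‖E ξ‖) := by gcongr
    _ = (n : ℝ) ^ k * (cut n ξ * cut n ξ * ‖E ξ‖) := by rw [cut_mul_cut le_rfl ξ]

lemma integrable_norm_mul_lowDensity (n : ℕ) (E : LC) :
    Integrable fun ξ => ‖ξ‖ * ‖lowDensity n E ξ‖ := by
  simpa using integrable_pow_mul_lowDensity n 1 E

lemma contDiff_synth_lowDensity (n : ℕ) (E : LC) :
    ContDiff ℝ ((⊤ : ℕ∞) : WithTop ℕ∞) (synth (lowDensity n E)) :=
  contDiff_synth fun k _ => integrable_pow_mul_lowDensity n k E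

lemma memLp_synth_lowDensity (n : ℕ) (E : LC) : MemLp (synth (lowDensity n E)) 2 volume :=
  memLp_synth (integrable_lowDensity n E) (memLp_lowDensity n E)

lemma synth_lowDensity_ae_eq (n : ℕ) (E : LC) :
    synth (lowDensity n E) =ᵐ[volume] realLp (lowPass n E) := by
  refine (synth_ae_eq (integrable_lowDensity n E) (memLp_lowDensity n E)).trans ?_
  have h : (memLp_lowDensity n E).toLp = lowPass n E := rfl
  rw [h]

/-- The `L²` norm of the gradient, in frequency space. -/
def gradNorm (E : LC) : ℝ≥0∞ := eLpNorm (fun ξ => (2 * Real.pi * ‖ξ‖) • E ξ) 2 volume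

lemma eLpNorm_fderiv_synth_lowDensity_le (n : ℕ) (E : LC) :
    eLpNorm (fderiv ℝ (synth (lowDensity n E))) 2 volume ≤ 3 * gradNorm E := by
  have hm : MemLp (fun ξ => (2 * Real.pi * ‖ξ‖) • lowDensity n E ξ) 2 volume := by
    refine (Lp.memLp E).of_le_mul (c := 2 * Real.pi * n)
      ((by fun_prop : Continuous fun ξ : E3 => 2 * Real.pi * ‖ξ‖).aestronglyMeasurable.smul
        (memLp_lowDensity n E).1) (ae_of_all _ fun ξ => ?_)
    rw [norm_smul, norm_lowDensity, Real.norm_of_nonneg (by positivity)]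
    have h := norm_pow_mul_cut_le n 1 ξ
    simp only [pow_one] at h
    calc 2 * Real.pi * ‖ξ‖ * (cut n ξ * ‖E ξ‖) = 2 * Real.pi * (‖ξ‖ * cut n ξ) * ‖E ξ‖ := by ring
      _ ≤ _ := by gcongr
  refine (eLpNorm_fderiv_synth_le (integrable_lowDensity n E) (integrable_norm_mul_lowDensity n E)
    hm).trans ?_
  refine mul_le_mul' le_rfl (eLpNorm_mono fun ξ => ?_)
  rw [norm_smul, norm_smul, norm_lowDensity]
  gcongr
  exact mul_le_of_le_one_left (norm_nonneg _) (cut_le_one n ξ)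

lemma norm_sub_lowPass_le (n : ℕ) (E : LC) :
    ∀ᵐ ξ, ‖(E - lowPass n E : LC) ξ‖ ≤ ‖E ξ‖ := by
  filter_upwards [Lp.coeFn_sub E (lowPass n E), coeFn_lowPass n E] with ξ h1 h2
  have e : E ξ - lowDensity n E ξ = (1 - cut n ξ) • E ξ := by rw [lowDensity, sub_smul, one_smul]
  rw [h1, Pi.sub_apply, h2, e, norm_smul, Real.norm_of_nonneg (by linarith [cut_le_one n ξ])]
  exact mul_le_of_le_one_left (norm_nonneg _) (by linarith [cut_nonneg n ξ])

lemma gradNorm_sub_lowPass_le (n : ℕ) (E : LC) : gradNorm (E - lowPass n E) ≤ gradNorm E := by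
  refine eLpNorm_mono_ae ?_
  filter_upwards [norm_sub_lowPass_le n E] with ξ h
  rw [norm_smul, norm_smul]
  gcongr

lemma tendsto_zero_of_pow {f : ℕ → ℝ≥0∞} {k : ℕ} (hk : k ≠ 0)
    (h : Tendsto (fun n => f n ^ k) atTop (𝓝 0)) : Tendsto f atTop (𝓝 0) := by
  have h2 := ((ENNReal.continuous_rpow_const (y := (k : ℝ)⁻¹)).tendsto 0).comp h
  rw [ENNReal.zero_rpow_of_pos (by positivity)] at h2
  exact h2.congr fun n => ENNReal.pow_rpow_inv_natCast hk (f n)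

lemma tendsto_sub_lowPass (E : LC) : Tendsto (fun n => ‖E - lowPass n E‖ₑ) atTop (𝓝 0) := by
  have h0 : ∀ F : LC, ‖F‖ₑ ^ 2 = ∫⁻ ξ, ‖F ξ‖ₑ ^ 2 := fun F => by
    have h := eLpNorm_natCast_pow (μ := (volume : Measure E3)) F 2 two_ne_zero
    push_cast at h
    rw [Lp.enorm_def, h]
  have h1 : Tendsto (fun n => ‖E - lowPass n E‖ₑ ^ 2) atTop (𝓝 0) := by
    simp_rw [h0]
    rw [← lintegral_zero (μ := (volume : Measure E3))]
    refine tendsto_lintegral_of_dominated_convergence' (fun ξ => ‖E ξ‖ₑ ^ 2)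
      (fun n => (Lp.aestronglyMeasurable _).enorm.pow_const 2) (fun n => ?_) ?_ ?_
    · filter_upwards [norm_sub_lowPass_le n E] with ξ h
      exact pow_le_pow_left' (enorm_le_iff_norm_le.2 h) 2
    · rw [← h0]
      exact ENNReal.pow_ne_top enorm_ne_top
    · have hall : ∀ᵐ ξ, ∀ n, (E - lowPass n E : LC) ξ = E ξ - cut n ξ • E ξ := by
        refine ae_all_iff.2 fun n => ?_
        filter_upwards [Lp.coeFn_sub E (lowPass n E), coeFn_lowPass n E] with ξ h1 h2
        rw [h1, Pi.sub_apply, h2, lowDensity]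
      filter_upwards [hall] with ξ h
      refine tendsto_const_nhds.congr' ?_
      filter_upwards [tendsto_cut ξ] with n hn
      rw [h, hn, one_smul, sub_self]
      simp
  exact tendsto_zero_of_pow two_ne_zero h1

lemma tendsto_lowPass (E : LC) : Tendsto (fun n => lowPass n E) atTop (𝓝 E) := by
  rw [tendsto_iff_edist_tendsto_0]
  simpa [edist_comm _ E, edist_eq_enorm_sub] using tendsto_sub_lowPass E

/-- The Sobolev embedding into `L⁴`, interpolated. -/
theorem eLpNorm_realLp_four_le (E : LC) :
    eLpNorm (realLp E) 4 volume ^ 4 ≤ ‖E‖ₑ * (sobolevConst * (3 * gradNorm E)) ^ 3 := by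
  -- The truncated fields are smooth, so the Sobolev inequality applies to them, with a bound
  -- independent of `n` that survives the limit.
  have hb : ∀ n, eLpNorm (realLp (lowPass n E)) 4 volume
      ≤ (‖E‖ₑ * (sobolevConst * (3 * gradNorm E)) ^ 3) ^ (4⁻¹ : ℝ) := fun n => by
    rw [ENNReal.le_rpow_inv_iff (by norm_num)]
    rw [show (4 : ℝ) = ((4 : ℕ) : ℝ) by norm_num, ENNReal.rpow_natCast,
      ← eLpNorm_congr_ae (synth_lowDensity_ae_eq n E)]
    refine (eLpNorm_four_le (memLp_synth_lowDensity n E).1).trans ?_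
    refine mul_le_mul' ?_ (pow_le_pow_left' ?_ 3)
    · refine (eLpNorm_synth_le (integrable_lowDensity n E) (memLp_lowDensity n E)).trans ?_
      rw [Lp.enorm_def]
      refine eLpNorm_mono fun ξ => ?_
      rw [norm_lowDensity]
      exact mul_le_of_le_one_left (norm_nonneg _) (cut_le_one n ξ)
    · refine (eLpNorm_six_le ((contDiff_synth_lowDensity n E).of_le (by exact_mod_cast le_top))
        (memLp_synth_lowDensity n E)).trans ?_
      exact mul_le_mul' le_rfl (eLpNorm_fderiv_synth_lowDensity_le n E)
  have ht : Tendsto (fun n => realLp (lowPass n E)) atTop (𝓝 (realLp E)) :=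
    (realLp.continuous.tendsto E).comp (tendsto_lowPass E)
  obtain ⟨ns, -, hns⟩ := (tendstoInMeasure_of_tendsto_Lp ht).exists_seq_tendsto_ae
  have h := Lp.eLpNorm_le_of_ae_tendsto (u := atTop) (Eventually.of_forall fun i => hb (ns i))
    (fun i => Lp.aestronglyMeasurable _) hns
  rw [ENNReal.le_rpow_inv_iff (by norm_num)] at h
  rwa [show (4 : ℝ) = ((4 : ℕ) : ℝ) by norm_num, ENNReal.rpow_natCast] at h

/-! ### The nonlinear term in the limit of no truncation -/

/-- The truncated velocity. -/
def lowField (n : ℕ) (u : L2) : E3 → E3 := synth (lowDensity n (fourierL2 u))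

lemma eLpNorm_fderiv_lowField_le (n : ℕ) (u : L2) :
    eLpNorm (fderiv ℝ (lowField n u)) 2 volume ≤ 3 * gradNorm (fourierL2 u) :=
  eLpNorm_fderiv_synth_lowDensity_le n _

lemma memLp_lowField (n : ℕ) (u : L2) : MemLp (lowField n u) 2 volume := memLp_synth_lowDensity n _

/-- Only the `L²` factor of the interpolation tends to zero; for the gradient factor a bound
independent of `n` suffices. -/
lemma eLpNorm_sub_lowField_le (n : ℕ) (u : L2) :
    eLpNorm (fun x => u x - lowField n u x) 4 volume ^ 4
      ≤ ‖fourierL2 u - lowPass n (fourierL2 u)‖ₑ * (sobolevConst * (3 * gradNorm (fourierL2 u))) ^ 3 := by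
  have e : (fun x => u x - lowField n u x) =ᵐ[volume]
      realLp (fourierL2 u - lowPass n (fourierL2 u)) := by
    rw [map_sub, realLp_fourierL2]
    filter_upwards [Lp.coeFn_sub u (realLp (lowPass n (fourierL2 u))),
      synth_lowDensity_ae_eq n (fourierL2 u)] with x h1 h2
    rw [h1, Pi.sub_apply, ← h2, lowField]
  rw [eLpNorm_congr_ae e]
  refine (eLpNorm_realLp_four_le _).trans ?_
  gcongr
  exact gradNorm_sub_lowPass_le n _

lemma enorm_trilin_lowField_le (n : ℕ) (u : L2) :
    ‖trilin (lowField n u) u u‖ₑ ≤ 3 * gradNorm (fourierL2 u) * eLpNorm u 4 volume ^ 2 := by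
  refine (enorm_trilin_le (measurable_fderiv_synth _) (memLp_coe u).1 (memLp_coe u).1).trans ?_
  rw [← pow_two]
  gcongr
  exact eLpNorm_fderiv_lowField_le n u

/-- The trilinear term vanishes in the limit of no truncation. -/
theorem tendsto_trilin_lowField {u : L2} (hu : IsDivFree u) (hD : gradNorm (fourierL2 u) ≠ ⊤)
    (h4 : eLpNorm u 4 volume ≠ ⊤) :
    Tendsto (fun n => trilin (lowField n u) u u) atTop (𝓝 0) := by
  have hgrad : ∀ n x, ‖fderiv ℝ (lowField n u) x‖
      ≤ 2 * Real.pi * ∫ ξ, ‖ξ‖ * ‖lowDensity n (fourierL2 u) ξ‖ := fun n x =>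
    norm_fderiv_synth_le (integrable_lowDensity n _) (integrable_norm_mul_lowDensity n _) x
  -- Skew-symmetry allows `u_n` to be subtracted in the last argument, and this difference is the
  -- small factor.
  have hsub : ∀ n, trilin (lowField n u) u u
      = trilin (lowField n u) u (fun x => u x - lowField n u x) := fun n => by
    have h0 : trilin (lowField n u) u (lowField n u) = 0 :=
      trilin_self_eq_zero (contDiff_synth_lowDensity n _) (norm_synth_le _)
        (memLp_lowField n u) (hgrad n) hu
    have i1 := integrable_trilin (φ := lowField n u) (measurable_fderiv_synth _) (hgrad n)
      (memLp_coe u) (memLp_coe u)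
    have i2 := integrable_trilin (φ := lowField n u) (measurable_fderiv_synth _) (hgrad n)
      (memLp_coe u) (memLp_lowField n u)
    rw [← sub_zero (trilin (lowField n u) u u), ← h0, trilin, trilin, trilin, ← integral_sub i1 i2]
    simp_rw [inner_sub_right]
  rw [tendsto_zero_iff_norm_tendsto_zero]
  have hE : Tendsto (fun n => ‖trilin (lowField n u) u u‖ₑ) atTop (𝓝 0) := by
    have hd4 : Tendsto (fun n => eLpNorm (fun x => u x - lowField n u x) 4 volume) atTop (𝓝 0) := by
      have h1 : Tendsto (fun n => ‖fourierL2 u - lowPass n (fourierL2 u)‖ₑ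
          * (sobolevConst * (3 * gradNorm (fourierL2 u))) ^ 3) atTop (𝓝 0) := by
        have h := ENNReal.Tendsto.mul_const (tendsto_sub_lowPass (fourierL2 u))
          (b := (sobolevConst * (3 * gradNorm (fourierL2 u))) ^ 3)
          (Or.inr (ENNReal.pow_ne_top (ENNReal.mul_ne_top ENNReal.coe_ne_top
            (ENNReal.mul_ne_top (by norm_num) hD))))
        rwa [zero_mul] at h
      have h2 := tendsto_of_tendsto_of_tendsto_of_le_of_le tendsto_const_nhds h1
        (fun _ => zero_le) (fun n => eLpNorm_sub_lowField_le n u)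
      exact tendsto_zero_of_pow four_ne_zero h2
    have h5 : Tendsto (fun n => 3 * gradNorm (fourierL2 u) * (eLpNorm u 4 volume
        * eLpNorm (fun x => u x - lowField n u x) 4 volume)) atTop (𝓝 0) := by
      have := ENNReal.Tendsto.const_mul (ENNReal.Tendsto.const_mul hd4 (Or.inr h4))
        (a := 3 * gradNorm (fourierL2 u)) (Or.inr (ENNReal.mul_ne_top (by norm_num) hD))
      simpa using this
    refine tendsto_of_tendsto_of_tendsto_of_le_of_le tendsto_const_nhds h5 (fun _ => zero_le)
      fun n => ?_
    simp only
    rw [hsub]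
    refine (enorm_trilin_le (measurable_fderiv_synth _) (memLp_coe u).1
      ((memLp_coe u).1.sub (memLp_lowField n u).1)).trans ?_
    gcongr
    · exact eLpNorm_fderiv_lowField_le n u
    · exact le_rfl
  have := (ENNReal.tendsto_toReal ENNReal.zero_ne_top).comp hE
  simpa [Function.comp_def] using this

/-! ### Multipliers and the `L⁴` norm -/

/-- The projection to a coordinate. -/
def coordC (j : Fin 3) : C3 →L[ℂ] ℂ := EuclideanSpace.proj j

/-- The `L²` Fourier transform acts on components. -/
lemma fourier_coordC (j : Fin 3) (F : LC) :
    (𝓕 ((coordC j).compLp F) : Lp ℂ 2 (volume : Measure E3)) = (coordC j).compLp (𝓕 F : LC) := by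
  have hc : ∀ G : LC, (coordC j).compLp G = (coordC j).compLpL 2 volume G := fun G => rfl
  refine DenseRange.induction_on (p := fun F : LC =>
      (𝓕 ((coordC j).compLp F) : Lp ℂ 2 (volume : Measure E3)) = (coordC j).compLp (𝓕 F : LC))
    (SchwartzMap.denseRange_toLpCLM (F := C3) (μ := (volume : Measure E3)) (p := 2) (by norm_num)) F ?_ ?_
  · simp only [hc]
    refine isClosed_eq ?_ ?_
    · exact (Lp.fourierTransformₗᵢ E3 ℂ).continuous.comp ((coordC j).compLpL 2 volume).continuous
    · exact ((coordC j).compLpL 2 volume).continuous.comp (Lp.fourierTransformₗᵢ E3 C3).continuous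
  · intro G
    have h1 : (coordC j).compLp (G.toLp 2 volume) = (SchwartzMap.postcompCLM (coordC j) G).toLp 2 volume := by
      refine Lp.ext ?_
      filter_upwards [(coordC j).coeFn_compLp (G.toLp 2 volume), G.coeFn_toLp 2 volume,
        (SchwartzMap.postcompCLM (coordC j) G).coeFn_toLp 2 volume] with x h1 h2 h3
      rw [h1, h2, h3, SchwartzMap.postcompCLM_apply]
    rw [SchwartzMap.toLpCLM_apply, h1, SchwartzMap.toLp_fourier_eq, SchwartzMap.toLp_fourier_eq]
    refine Lp.ext ?_
    filter_upwards [(coordC j).coeFn_compLp ((𝓕 G).toLp 2 volume), (𝓕 G).coeFn_toLp 2 volume,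
      (𝓕 (SchwartzMap.postcompCLM (coordC j) G)).coeFn_toLp 2 volume] with ξ h1 h2 h3
    rw [h1, h2, h3, SchwartzMap.fourier_coe]
    exact (fourier_coord G ξ j).symm

lemma represents_toTemperedDistribution (f : Lp ℂ 2 (volume : Measure E3)) :
    Represents f (Lp.toTemperedDistribution f) := by
  refine ⟨(Lp.memLp f).locallyIntegrable (by norm_num), fun ψ => ⟨?_, ?_⟩⟩
  · exact (ψ.memLp 2 volume).integrable_mul (Lp.memLp f)
  · rw [Lp.toTemperedDistribution_apply]
    rfl

lemma Represents.congr {f g : E3 → ℂ} {F : 𝓢'(E3, ℂ)} (h : Represents f F) (e : f =ᵐ[volume] g) :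
    Represents g F := by
  have e' : ∀ ψ : 𝓢(E3, ℂ), (fun x => ψ x * f x) =ᵐ[volume] fun x => ψ x * g x := fun ψ =>
    e.mono fun x hx => by simp only [hx]
  refine ⟨h.1.congr e, fun ψ => ⟨(h.2 ψ).1.congr (e' ψ), ?_⟩⟩
  rw [(h.2 ψ).2, integral_congr_ae (e' ψ)]

/-- Reconciles the Plancherel transform of a field with the distributional one behind
`homSobolevNorm`, so that components of `w` can compete in the supremum defining the multiplier
norm. -/
lemma isFourierPair_component (w : L2) (j : Fin 3) :
    IsFourierPair (fun x => w x j) (fun ξ => fourierL2 w ξ j) := by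
  refine ⟨Lp.toTemperedDistribution ((coordC j).compLp (complexify.compLp w)), ?_, ?_⟩
  · refine (represents_toTemperedDistribution _).congr ?_
    filter_upwards [(coordC j).coeFn_compLp (complexify.compLp w), complexify.coeFn_compLp w]
      with x h1 h2
    rw [h1, h2]
    rfl
  · rw [Lp.fourier_toTemperedDistribution_eq, fourier_coordC]
    refine (represents_toTemperedDistribution _).congr ?_
    filter_upwards [(coordC j).coeFn_compLp (𝓕 (complexify.compLp w) : LC)] with x h1
    rw [h1]
    rfl

lemma homSobolevNorm_component_le (s : ℝ) (w : L2) (j : Fin 3) :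
    homSobolevNorm s (fun x => w x j) ≤ lambdaNorm s w := by
  refine (iInf₂_le _ (isFourierPair_component w j)).trans (eLpNorm_mono fun ξ => ?_)
  rw [norm_smul, norm_smul]
  gcongr
  exact PiLp.norm_apply_le _ j

lemma eLpNorm_mul_component_le {s : ℝ} {p : ℝ≥0∞} {φ : E3 → ℝ} {w : L2} (j : Fin 3)
    (hM : multiplierNorm s p φ ≠ ⊤) (hS : lambdaNorm s w ≠ ⊤) :
    eLpNorm (fun x => φ x * w x j) p volume ≤ multiplierNorm s p φ * lambdaNorm s w := by
  by_cases h0 : (fun x => w x j) =ᵐ[volume] 0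
  · have h : (fun x => φ x * w x j) =ᵐ[volume] 0 := h0.mono fun x hx => by
      simp only [Pi.zero_apply] at hx ⊢
      rw [hx, mul_zero]
    rw [eLpNorm_congr_ae h, eLpNorm_zero]
    exact zero_le
  have hN := homSobolevNorm_component_le s w j
  have hNt : homSobolevNorm s (fun x => w x j) ≠ ⊤ := ne_top_of_le_ne_top hS hN
  have h : eLpNorm (fun x => φ x * w x j) p volume / homSobolevNorm s (fun x => w x j)
      ≤ multiplierNorm s p φ :=
    le_iSup₂ (f := fun (f : E3 → ℝ) (_ : f ∈ homSobolev s ∧ ¬ f =ᵐ[volume] 0) =>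
      eLpNorm (fun x => φ x * f x) p volume / homSobolevNorm s f) (fun x => w x j)
      ⟨lt_top_iff_ne_top.2 hNt, h0⟩
  rw [ENNReal.div_le_iff_le_mul (Or.inr hM) (Or.inl hNt)] at h
  exact h.trans (mul_le_mul' le_rfl hN)

lemma multiplierNorm_le_multiplierNorm3 (s : ℝ) (p : ℝ≥0∞) (φ : E3 → E3) (i : Fin 3) :
    multiplierNorm s p (fun x => φ x i) ≤ multiplierNorm3 s p φ := by
  rw [multiplierNorm3, one_div, ENNReal.le_rpow_inv_iff (by norm_num), ENNReal.rpow_two]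
  exact Finset.single_le_sum (f := fun i => multiplierNorm s p (fun x => φ x i) ^ 2)
    (fun _ _ => zero_le) (Finset.mem_univ i)

lemma norm_le_sum_component (v : E3) : ‖v‖ ≤ ∑ i, |v i| := by
  have hv : v = ∑ j : Fin 3, v j • (EuclideanSpace.single j (1 : ℝ) : E3) := by
    ext i
    fin_cases i <;> simp [Fin.sum_univ_three]
  conv_lhs => rw [hv]
  refine (norm_sum_le _ _).trans_eq (Finset.sum_congr rfl fun i _ => ?_)
  simp [norm_smul]

/-- The multiplier estimate applied to the components of `w`. -/
lemma eLpNorm_norm_mul_norm_le {s : ℝ} {p : ℝ≥0∞} (hp : 1 ≤ p) {φ : E3 → E3}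
    (hφ : AEStronglyMeasurable φ volume) {w : L2} (hM : multiplierNorm3 s p φ ≠ ⊤)
    (hS : lambdaNorm s w ≠ ⊤) :
    eLpNorm (fun x => ‖φ x‖ * ‖w x‖) p volume ≤ 9 * (multiplierNorm3 s p φ * lambdaNorm s w) := by
  have hc : ∀ (v : E3 → E3) (i : Fin 3), AEStronglyMeasurable v volume →
      AEStronglyMeasurable (fun x => v x i) volume := fun v i hv =>
    (EuclideanSpace.proj i : E3 →L[ℝ] ℝ).continuous.comp_aestronglyMeasurable hv
  -- The constant 9 counts the products `φ_i w_j`. Minkowski's inequality for their sum requires `1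
  -- ≤ p`; for `p = 2γ` this is the condition `γ ≥ 1/2`.
  calc eLpNorm (fun x => ‖φ x‖ * ‖w x‖) p volume
      ≤ eLpNorm (∑ z : Fin 3 × Fin 3, fun x => |φ x z.1 * w x z.2|) p volume := by
        refine eLpNorm_mono_real fun x => ?_
        rw [Real.norm_of_nonneg (by positivity), Finset.sum_apply, Fintype.sum_prod_type]
        refine (mul_le_mul (norm_le_sum_component _) (norm_le_sum_component _) (norm_nonneg _)
          (by positivity)).trans_eq ?_
        rw [Finset.sum_mul_sum]
        simp_rw [abs_mul]
    _ ≤ ∑ z : Fin 3 × Fin 3, eLpNorm (fun x => |φ x z.1 * w x z.2|) p volume :=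
        eLpNorm_sum_le (fun z _ => ((hc φ z.1 hφ).mul (hc w z.2 (memLp_coe w).1)).norm) hp
    _ ≤ ∑ _z : Fin 3 × Fin 3, multiplierNorm3 s p φ * lambdaNorm s w := by
        refine Finset.sum_le_sum fun z _ => ?_
        have h := multiplierNorm_le_multiplierNorm3 s p φ z.1
        refine (eLpNorm_norm (f := fun x => φ x z.1 * w x z.2)).trans_le ?_
        exact (eLpNorm_mul_component_le z.2 (ne_top_of_le_ne_top hM h) hS).trans
          (mul_le_mul' h le_rfl)
    _ = _ := by
        rw [Finset.sum_const, nsmul_eq_mul]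
        norm_num

/-- The multiplier estimate in the form of an `L⁴` bound. -/
lemma eLpNorm_four_le_multiplier {γ s : ℝ} (hγ : 1 / 2 ≤ γ) {w : L2}
    (hM : multiplierNorm3 s (ENNReal.ofReal (2 * γ)) (fun x => ‖w x‖ ^ (2 / γ - 2) • w x) ≠ ⊤)
    (hS : lambdaNorm s w ≠ ⊤) :
    eLpNorm w 4 volume ^ 4 ≤ (9 * (multiplierNorm3 s (ENNReal.ofReal (2 * γ))
      (fun x => ‖w x‖ ^ (2 / γ - 2) • w x) * lambdaNorm s w)) ^ (2 * γ) := by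
  have hγ0 : 0 < γ := by linarith
  have hφ : AEStronglyMeasurable (fun x => ‖w x‖ ^ (2 / γ - 2) • w x) volume :=
    ((memLp_coe w).1.norm.aemeasurable.pow_const _).aestronglyMeasurable.smul (memLp_coe w).1
  have h := eLpNorm_norm_mul_norm_le (p := ENNReal.ofReal (2 * γ))
    (ENNReal.one_le_ofReal.2 (by linarith)) hφ hM hS
  -- The exponent `2/γ − 2` is made for this: the product is `|w|^{2/γ}`, whose power `2γ` is
  -- `|w|⁴`.
  have e : (fun x => ‖‖w x‖ ^ (2 / γ - 2) • w x‖ * ‖w x‖) = fun x => ‖w x‖ ^ (2 / γ) := by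
    ext1 x
    rcases eq_or_ne (w x) 0 with h0 | h0
    · rw [h0, norm_zero, mul_zero, Real.zero_rpow (by positivity)]
    · have hn : 0 < ‖w x‖ := norm_pos_iff.2 h0
      rw [norm_smul, Real.norm_of_nonneg (by positivity), mul_assoc, ← pow_two, ← Real.rpow_two,
        ← Real.rpow_add hn, sub_add_cancel]
  rw [e] at h
  refine le_trans (le_of_eq ?_) (ENNReal.rpow_le_rpow h (by positivity : 0 ≤ 2 * γ))
  have h4 := eLpNorm_natCast_pow (μ := volume) w 4 (by norm_num)
  push_cast at h4
  rw [h4]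
  have hp0 : ENNReal.ofReal (2 * γ) ≠ 0 := by simpa using hγ0
  rw [eLpNorm_eq_lintegral_rpow_enorm_toReal hp0 ENNReal.ofReal_ne_top,
    ENNReal.toReal_ofReal (by positivity), ← ENNReal.rpow_mul, one_div,
    inv_mul_cancel₀ (by positivity), ENNReal.rpow_one]
  refine lintegral_congr fun x => ?_
  rw [Real.enorm_rpow_of_nonneg (norm_nonneg _) (by positivity), enorm_norm, ← ENNReal.rpow_mul,
    ← ENNReal.rpow_natCast]
  congr 1
  field_simp
  norm_num

/-! ### Interpolation and integrability in time -/

/-- Interpolation of homogeneous Sobolev norms. -/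
lemma lambdaNorm_sq_le {α s : ℝ} (hα : 0 < α) (hs : 0 ≤ s) (hsα : s ≤ α) (w : L2) :
    lambdaNorm s w ^ 2 ≤ (‖w‖ₑ ^ 2) ^ (1 - s / α) * (sobolevNorm α w ^ 2) ^ (s / α) := by
  have hr0 : 0 ≤ s / α := by positivity
  have hr1 : s / α ≤ 1 := (div_le_one hα).2 hsα
  have hsq : ∀ f : E3 → C3, eLpNorm f 2 volume ^ 2 = ∫⁻ ξ, ‖f ξ‖ₑ ^ 2 := fun f => by
    have h := eLpNorm_natCast_pow (μ := (volume : Measure E3)) f 2 two_ne_zero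
    push_cast at h
    exact h
  have hw : ‖w‖ₑ = eLpNorm (fourierL2 w) 2 volume := by
    rw [← Lp.enorm_def, ← ofReal_norm, ← ofReal_norm, norm_fourierL2]
  rw [lambdaNorm, rieszNorm, sobolevNorm, hw, hsq, hsq, hsq]
  have hF := Lp.aestronglyMeasurable (fourierL2 w)
  -- Hölder with the weights `1 − s/α` and `s/α`, after the symbol of order `2s` has been bounded by
  -- the power `s/α` of the one of order `2α`.
  refine le_trans (lintegral_mono fun ξ => ?_) (ENNReal.lintegral_mul_norm_pow_le
    (hF.enorm.pow_const 2) (((by fun_prop (disch := intro x; positivity) :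
      Measurable fun ξ : E3 => (1 + (2 * Real.pi * ‖ξ‖) ^ 2) ^ (α / 2)).aestronglyMeasurable.smul
        hF).enorm.pow_const 2) (by linarith : 0 ≤ 1 - s / α) hr0 (by ring))
  simp only
  have hb : (2 * Real.pi * ‖ξ‖) ^ s ≤ ((1 + (2 * Real.pi * ‖ξ‖) ^ 2) ^ (α / 2)) ^ (s / α) := by
    rw [← Real.rpow_mul (by positivity), show α / 2 * (s / α) = 2⁻¹ * s by field_simp,
      Real.rpow_mul (by positivity)]
    refine Real.rpow_le_rpow (by positivity) ?_ hs
    rw [← one_div, ← Real.sqrt_eq_rpow]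
    exact Real.le_sqrt_of_sq_le (by linarith)
  rw [Pi.smul_apply', enorm_smul, enorm_smul, mul_pow, mul_pow]
  calc ‖(2 * Real.pi * ‖ξ‖) ^ s‖ₑ ^ 2 * ‖fourierL2 w ξ‖ₑ ^ 2
      ≤ (‖(1 + (2 * Real.pi * ‖ξ‖) ^ 2) ^ (α / 2)‖ₑ ^ 2) ^ (s / α) * ‖fourierL2 w ξ‖ₑ ^ 2 := by
        gcongr
        rw [← ENNReal.rpow_natCast, ← ENNReal.rpow_natCast, ← ENNReal.rpow_mul,
          mul_comm _ (s / α), ENNReal.rpow_mul, Real.enorm_of_nonneg (by positivity),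
          Real.enorm_of_nonneg (by positivity), ENNReal.ofReal_rpow_of_nonneg (by positivity) hr0]
        gcongr
    _ = (‖fourierL2 w ξ‖ₑ ^ 2) ^ (1 - s / α)
        * ((‖(1 + (2 * Real.pi * ‖ξ‖) ^ 2) ^ (α / 2)‖ₑ ^ 2) ^ (s / α) * (‖fourierL2 w ξ‖ₑ ^ 2) ^ (s / α)) := by
        have e : ‖fourierL2 w ξ‖ₑ ^ 2
            = (‖fourierL2 w ξ‖ₑ ^ 2) ^ (1 - s / α) * (‖fourierL2 w ξ‖ₑ ^ 2) ^ (s / α) := by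
          rw [← ENNReal.rpow_add_of_nonneg _ _ (by linarith) hr0, sub_add_cancel, ENNReal.rpow_one]
        conv_lhs => rw [e]
        ring
    _ = _ := by rw [← ENNReal.mul_rpow_of_nonneg _ _ hr0]

/-- A form of Young's inequality: each factor is at most the same power of `x + y`. -/
lemma rpow_mul_rpow_le_add (x y : ℝ≥0∞) {r : ℝ} (h0 : 0 ≤ r) (h1 : r ≤ 1) :
    x ^ (1 - r) * y ^ r ≤ x + y := by
  calc x ^ (1 - r) * y ^ r ≤ (x + y) ^ (1 - r) * (x + y) ^ r := by
        refine mul_le_mul' (ENNReal.rpow_le_rpow le_self_add (by linarith))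
          (ENNReal.rpow_le_rpow le_add_self h0)
    _ = x + y := by
        rw [← ENNReal.rpow_add_of_nonneg _ _ (by linarith) h0, sub_add_cancel, ENNReal.rpow_one]

/-- The multiplier estimate combined with interpolation. -/
lemma eLpNorm_four_le_interpolated {α γ θ B : ℝ} (hα : 1 ≤ α) (hγ : 1 / 2 ≤ γ)
    (hθ : 0 ≤ θ) (hθγ : θ ≤ γ) {w : L2} (hB : ‖w‖ ≤ B)
    (hM : multiplierNorm3 (θ / γ) (ENNReal.ofReal (2 * γ)) (fun x => ‖w x‖ ^ (2 / γ - 2) • w x) ≠ ⊤)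
    (hS : sobolevNorm α w ≠ ⊤) :
    eLpNorm w 4 volume ^ 4 ≤ 9 ^ (2 * γ) * (ENNReal.ofReal B ^ 2) ^ ((1 - θ / γ / α) * γ) *
      (multiplierNorm3 (θ / γ) (ENNReal.ofReal (2 * γ)) (fun x => ‖w x‖ ^ (2 / γ - 2) • w x) ^ (2 * γ)
        * (sobolevNorm α w ^ 2) ^ (θ / α)) := by
  have hγ0 : 0 < γ := by linarith
  have hα0 : 0 < α := by linarith
  have hs1 : θ / γ ≤ 1 := (div_le_one hγ0).2 hθγ
  have hr1 : θ / γ / α ≤ 1 := (div_le_one hα0).2 (hs1.trans hα)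
  have hr0 : 0 ≤ θ / γ / α := by positivity
  have hl := lambdaNorm_sq_le hα0 (by positivity) (hs1.trans hα) w
  have hwB : ‖w‖ₑ ≤ ENNReal.ofReal B := by
    rw [← ofReal_norm]
    exact ENNReal.ofReal_le_ofReal hB
  have hl' : lambdaNorm (θ / γ) w ^ 2
      ≤ (ENNReal.ofReal B ^ 2) ^ (1 - θ / γ / α) * (sobolevNorm α w ^ 2) ^ (θ / γ / α) := by
    refine hl.trans (mul_le_mul' (ENNReal.rpow_le_rpow ?_ (by linarith)) le_rfl)
    gcongr
  have hΛ : lambdaNorm (θ / γ) w ≠ ⊤ := by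
    intro h
    rw [h, ENNReal.top_pow two_ne_zero, top_le_iff] at hl'
    exact ENNReal.mul_ne_top (ENNReal.rpow_ne_top_of_nonneg (by linarith)
      (ENNReal.pow_ne_top ENNReal.ofReal_ne_top)) (ENNReal.rpow_ne_top_of_nonneg hr0
      (ENNReal.pow_ne_top hS)) hl'
  refine (eLpNorm_four_le_multiplier hγ hM hΛ).trans ?_
  rw [ENNReal.mul_rpow_of_nonneg _ _ (by positivity), ENNReal.mul_rpow_of_nonneg _ _ (by positivity)]
  have hΛγ : lambdaNorm (θ / γ) w ^ (2 * γ)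
      ≤ (ENNReal.ofReal B ^ 2) ^ ((1 - θ / γ / α) * γ) * (sobolevNorm α w ^ 2) ^ (θ / α) := by
    have h := ENNReal.rpow_le_rpow hl' hγ0.le
    rw [ENNReal.mul_rpow_of_nonneg _ _ hγ0.le, ← ENNReal.rpow_mul, ← ENNReal.rpow_mul,
      show θ / γ / α * γ = θ / α by field_simp] at h
    refine le_trans (le_of_eq ?_) h
    rw [ENNReal.rpow_mul, ENNReal.rpow_two]
  calc _ ≤ (9 : ℝ≥0∞) ^ (2 * γ) * (_ * ((ENNReal.ofReal B ^ 2) ^ ((1 - θ / γ / α) * γ)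
        * (sobolevNorm α w ^ 2) ^ (θ / α))) := by gcongr
    _ = _ := by ring

/-- Integrable majorants from mixed bounds. -/
lemma exists_majorant {α γ θ : ℝ} (hα : 0 < α) (hγ : 0 < γ) (hθ : 0 ≤ θ) (hθα : θ ≤ α)
    {μ : Measure ℝ} {M S F : ℝ → ℝ≥0∞} {A : ℝ≥0∞} (hAt : A ≠ ⊤) (hS : MemLp S 2 μ)
    (hM : MemLp M (ENNReal.ofReal (2 * α * γ) / ENNReal.ofReal (α - θ)) μ)
    (hF : ∀ᵐ t ∂μ, M t ≠ ⊤ → S t ≠ ⊤ → F t ≤ A * (M t ^ (2 * γ) * (S t ^ 2) ^ (θ / α))) :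
    ∃ G : ℝ → ℝ≥0∞, AEMeasurable G μ ∧ ∫⁻ t, G t ∂μ ≠ ⊤ ∧ ∀ᵐ t ∂μ, F t ≤ G t := by
  have hSm : AEMeasurable S μ := hS.1.aemeasurable
  have hMm : AEMeasurable M μ := hM.1.aemeasurable
  have hSi : ∫⁻ t, S t ^ 2 ∂μ ≠ ⊤ := by
    have h := lintegral_rpow_enorm_lt_top_of_eLpNorm_lt_top two_ne_zero (by norm_num) hS.2
    simpa using h.ne
  have hSt : ∀ᵐ t ∂μ, S t ≠ ⊤ := by
    filter_upwards [ae_lt_top' (hSm.pow_const 2) hSi] with t ht h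
    rw [h] at ht
    simp at ht
  have hn0 : ENNReal.ofReal (2 * α * γ) ≠ 0 := by
    rw [Ne, ENNReal.ofReal_eq_zero, not_le]
    positivity
  -- For `θ < α`, Young's inequality with weights `1 − θ/α` and `θ/α` turns `M^{2γ}` into the power
  -- `2αγ/(α−θ)`, the time exponent of the hypothesis. For `θ = α` that exponent is `∞`, `M` is
  -- essentially bounded, and `S²` alone is the majorant up to a constant.
  rcases hθα.lt_or_eq with hlt | heq
  · have hd : 0 < α - θ := by linarith
    have hq : ENNReal.ofReal (2 * α * γ) / ENNReal.ofReal (α - θ)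
        = ENNReal.ofReal (2 * α * γ / (α - θ)) := (ENNReal.ofReal_div_of_pos hd).symm
    have hq0 : 0 < 2 * α * γ / (α - θ) := by positivity
    rw [hq] at hM
    have hMi : ∫⁻ t, M t ^ (2 * α * γ / (α - θ)) ∂μ ≠ ⊤ := by
      have h := lintegral_rpow_enorm_lt_top_of_eLpNorm_lt_top (by simpa using hq0)
        ENNReal.ofReal_ne_top hM.2
      simpa [ENNReal.toReal_ofReal hq0.le] using h.ne
    have hMt : ∀ᵐ t ∂μ, M t ≠ ⊤ := by
      filter_upwards [ae_lt_top' (hMm.pow_const _) hMi] with t ht h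
      rw [h, ENNReal.top_rpow_of_pos hq0] at ht
      exact lt_irrefl _ ht
    have hMS : AEMeasurable (fun t => M t ^ (2 * α * γ / (α - θ)) + S t ^ 2) μ :=
      (hMm.pow_const _).add (hSm.pow_const 2)
    refine ⟨fun t => A * (M t ^ (2 * α * γ / (α - θ)) + S t ^ 2), hMS.const_mul A, ?_, ?_⟩
    · rw [lintegral_const_mul'' _ hMS, lintegral_add_left' (hMm.pow_const _)]
      exact ENNReal.mul_ne_top hAt (ENNReal.add_ne_top.2 ⟨hMi, hSi⟩)
    · filter_upwards [hF, hSt, hMt] with t h1 h2 h3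
      refine (h1 h3 h2).trans ?_
      refine mul_le_mul' le_rfl ?_
      have e : M t ^ (2 * γ) = (M t ^ (2 * α * γ / (α - θ))) ^ (1 - θ / α) := by
        rw [← ENNReal.rpow_mul]
        congr 1
        field_simp
      have h := rpow_mul_rpow_le_add (M t ^ (2 * α * γ / (α - θ))) (S t ^ 2)
        (by positivity : 0 ≤ θ / α) ((div_le_one hα).2 hθα)
      rw [← e] at h
      exact h
  · rw [heq, sub_self, ENNReal.ofReal_zero, ENNReal.div_zero (heq ▸ hn0)] at hM
    set L : ℝ≥0∞ := eLpNorm M ⊤ μ with hL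
    have hLt : L ≠ ⊤ := hM.2.ne
    have hML : ∀ᵐ t ∂μ, M t ≤ L := by
      rw [hL, eLpNorm_exponent_top]
      exact ae_le_eLpNormEssSup (f := M)
    refine ⟨fun t => A * L ^ (2 * γ) * S t ^ 2, (hSm.pow_const 2).const_mul _, ?_, ?_⟩
    · rw [lintegral_const_mul'' _ (hSm.pow_const 2)]
      exact ENNReal.mul_ne_top (ENNReal.mul_ne_top hAt
        (ENNReal.rpow_ne_top_of_nonneg (by positivity) hLt)) hSi
    · filter_upwards [hF, hSt, hML] with t h1 h2 h3
      refine (h1 (ne_top_of_le_ne_top hLt h3) h2).trans ?_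
      rw [mul_assoc A, heq, div_self hα.ne', ENNReal.rpow_one]
      refine mul_le_mul' le_rfl (mul_le_mul' (ENNReal.rpow_le_rpow h3 (by positivity)) le_rfl)

/-- The `L⁴` norm of the solution to the fourth power has an integrable majorant in time. -/
theorem exists_dominating {α γ θ B : ℝ} (hα : 1 ≤ α) (hγ : 1 / 2 ≤ γ) (hγ1 : γ ≤ 1)
    (hθ : 0 ≤ θ) (hθγ : θ ≤ γ) {μ : Measure ℝ} {u : ℝ → L2} (hB : ∀ᵐ t ∂μ, ‖u t‖ ≤ B)
    (hS : MemLp (fun t => sobolevNorm α (u t)) 2 μ)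
    (hM : MemLp (fun t => multiplierNorm3 (θ / γ) (ENNReal.ofReal (2 * γ))
      (fun x => ‖u t x‖ ^ (2 / γ - 2) • u t x))
      (ENNReal.ofReal (2 * α * γ) / ENNReal.ofReal (α - θ)) μ) :
    ∃ G : ℝ → ℝ≥0∞, AEMeasurable G μ ∧ ∫⁻ t, G t ∂μ ≠ ⊤ ∧
      ∀ᵐ t ∂μ, eLpNorm (u t) 4 volume ^ 4 ≤ G t := by
  have hγ0 : 0 < γ := by linarith
  have hα0 : 0 < α := by linarith
  have hr1 : θ / γ / α ≤ 1 := (div_le_one hα0).2 (((div_le_one hγ0).2 hθγ).trans hα)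
  have hAt : (9 : ℝ≥0∞) ^ (2 * γ) * (ENNReal.ofReal B ^ 2) ^ ((1 - θ / γ / α) * γ) ≠ ⊤ :=
    ENNReal.mul_ne_top (ENNReal.rpow_ne_top_of_nonneg (by positivity) (by norm_num))
      (ENNReal.rpow_ne_top_of_nonneg (mul_nonneg (by linarith) hγ0.le)
      (ENNReal.pow_ne_top ENNReal.ofReal_ne_top))
  refine exists_majorant hα0 hγ0 hθ (by linarith) hAt hS hM ?_
  filter_upwards [hB] with t ht h1 h2
  exact eLpNorm_four_le_interpolated hα hγ hθ hθγ ht h1 h2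

/-! ### The truncated energy balance -/

lemma abs_cut_mul_invWt_le {α : ℝ} (hα : 0 ≤ α) (n : ℕ) (ξ : E3) :
    |cut n ξ * invWt α ξ| ≤ (1 + (n : ℝ) ^ 2) ^ (α + 2) := by
  have h0 : 0 ≤ invWt α ξ := by unfold invWt; positivity
  rw [abs_of_nonneg (mul_nonneg (cut_nonneg n ξ) h0)]
  rcases le_or_gt ‖ξ‖ n with h | h
  · rw [cut_of_le h, one_mul, invWt]
    gcongr
  · rw [cut_of_lt h, zero_mul]
    positivity

/-- Truncation combined with removal of the weight. -/
def cutInv (α : ℝ) (hα : 0 ≤ α) (n : ℕ) : LC →L[ℝ] LC :=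
  mulOp (fun ξ => cut n ξ * invWt α ξ)
    ((measurable_cut n).mul (hasTemperateGrowth_invWt α).1.continuous.measurable)
    ((1 + (n : ℝ) ^ 2) ^ (α + 2)) (abs_cut_mul_invWt_le hα n)

lemma coeFn_cutInv {α : ℝ} (hα : 0 ≤ α) (n : ℕ) (E : LC) :
    cutInv α hα n E =ᵐ[volume] fun ξ => (cut n ξ * invWt α ξ) • E ξ := coeFn_mulOp _ _ _ _ E

lemma cutInv_wtOp {α : ℝ} (hα : 0 ≤ α) (n : ℕ) (E : LC) :
    cutInv α hα n (wtOp α hα E) = lowPass n E := by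
  refine Lp.ext ?_
  filter_upwards [coeFn_cutInv hα n (wtOp α hα E), coeFn_wtOp α hα E, coeFn_lowPass n E]
    with ξ h1 h2 h3
  rw [h1, h2, h3, wtDensity, lowDensity, smul_smul, mul_assoc, invWt_mul_wt, mul_one]

lemma lowPass_cutInv {α : ℝ} (hα : 0 ≤ α) {m n : ℕ} (h : m ≤ n) (E : LC) :
    lowPass m (cutInv α hα n E) = cutInv α hα m E := by
  refine Lp.ext ?_
  filter_upwards [coeFn_cutInv hα n E, coeFn_cutInv hα m E, coeFn_lowPass m (cutInv α hα n E)]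
    with ξ h1 h2 h3
  rw [h3, lowDensity, h1, h2, smul_smul, ← mul_assoc, cut_mul_cut h]

/-- The rate of change of half the energy of the truncated velocity. -/
def energyFlux (α : ℝ) (hα : 0 ≤ α) (n : ℕ) (w : L2) : ℝ :=
  inner ℝ (fluxVec α hα w) (cutInv α hα n (lowPass n (fourierL2 w)))

/-- The density of the dissipation in frequency space. -/
def dissDensity (α : ℝ) (w : L2) (ξ : E3) : ℝ := rieszSymbol (2 * α) ξ * ‖fourierL2 w ξ‖ ^ 2

lemma dissDensity_nonneg (α : ℝ) (w : L2) (ξ : E3) : 0 ≤ dissDensity α w ξ :=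
  mul_nonneg (rieszSymbol_nonneg _ _) (by positivity)

lemma aestronglyMeasurable_dissDensity (α : ℝ) (w : L2) :
    AEStronglyMeasurable (dissDensity α w) volume :=
  (measurable_rieszSymbol _).aestronglyMeasurable.mul
    ((Lp.aestronglyMeasurable (fourierL2 w)).norm.pow 2)

lemma lambdaNorm_sq (α : ℝ) (w : L2) :
    lambdaNorm α w ^ 2 = ∫⁻ ξ, ENNReal.ofReal (dissDensity α w ξ) := by
  have h := eLpNorm_natCast_pow (μ := (volume : Measure E3))
    (fun ξ => (2 * Real.pi * ‖ξ‖) ^ α • fourierL2 w ξ) 2 two_ne_zero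
  push_cast at h
  rw [lambdaNorm, rieszNorm, h]
  refine lintegral_congr fun ξ => ?_
  rw [← ofReal_norm, ← ENNReal.ofReal_pow (norm_nonneg _), norm_smul, mul_pow,
    Real.norm_of_nonneg (by positivity), dissDensity, rieszSymbol, mul_comm 2 α,
    Real.rpow_mul (by positivity), Real.rpow_two]

lemma integrable_dissDensity {α : ℝ} {w : L2} (h : lambdaNorm α w ≠ ⊤) :
    Integrable (dissDensity α w) := by
  refine ⟨aestronglyMeasurable_dissDensity α w, ?_⟩
  rw [hasFiniteIntegral_iff_ofReal (ae_of_all _ (dissDensity_nonneg α w)), ← lambdaNorm_sq]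
  exact ENNReal.pow_lt_top h.lt_top

lemma integral_dissDensity (α : ℝ) (w : L2) :
    ∫ ξ, dissDensity α w ξ = (lambdaNorm α w ^ 2).toReal := by
  rw [lambdaNorm_sq, integral_eq_lintegral_of_nonneg_ae (ae_of_all _ (dissDensity_nonneg α w))
    (aestronglyMeasurable_dissDensity α w)]

/-- The reciprocal weight in `cutInv` undoes the weight in the flux, so the test field is the
truncated velocity itself. -/
lemma energyFlux_eq {α : ℝ} (hα : 0 ≤ α) (n : ℕ) (w : L2) :
    energyFlux α hα n w = trilin (lowField n w) w w - ∫ ξ, cut n ξ * dissDensity α w ξ := by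
  have hE : cutInv α hα n (lowPass n (fourierL2 w))
      =ᵐ[volume] fun ξ => (cut n ξ * invWt α ξ) • fourierL2 w ξ := by
    filter_upwards [coeFn_cutInv hα n (lowPass n (fourierL2 w)), coeFn_lowPass n (fourierL2 w)]
      with ξ h1 h2
    rw [h1, h2, lowDensity, smul_smul, mul_right_comm, cut_mul_cut le_rfl]
  have h1 : wtDensity α (cutInv α hα n (lowPass n (fourierL2 w)))
      =ᵐ[volume] lowDensity n (fourierL2 w) := by
    filter_upwards [hE] with ξ h
    rw [wtDensity, h, lowDensity, smul_smul, mul_left_comm, wt_mul_invWt, mul_one]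
  rw [energyFlux, inner_fluxVec, synth_congr_ae h1]
  congr 1
  rw [L2.inner_def]
  refine integral_congr_ae ?_
  have h2 : dissOp α hα (fourierL2 w)
      =ᵐ[volume] fun ξ => (rieszSymbol (2 * α) ξ * wt α ξ) • fourierL2 w ξ := coeFn_mulOp _ _ _ _ _
  filter_upwards [hE, h2] with ξ h3 h4
  rw [h3, h4, real_inner_smul_left, real_inner_smul_right, real_inner_self_eq_norm_sq, dissDensity]
  calc rieszSymbol (2 * α) ξ * wt α ξ * (cut n ξ * invWt α ξ * ‖fourierL2 w ξ‖ ^ 2)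
      = cut n ξ * (rieszSymbol (2 * α) ξ * ‖fourierL2 w ξ‖ ^ 2) * (wt α ξ * invWt α ξ) := by ring
    _ = _ := by rw [wt_mul_invWt, mul_one]

lemma rpow_le_rpow_japanese {r s : ℝ} (ξ : E3) (hr : 0 ≤ r) (hrs : r ≤ s) :
    (2 * Real.pi * ‖ξ‖) ^ r ≤ (1 + (2 * Real.pi * ‖ξ‖) ^ 2) ^ (s / 2) := by
  have h1 : (1 : ℝ) ≤ 1 + (2 * Real.pi * ‖ξ‖) ^ 2 := by
    linarith [sq_nonneg (2 * Real.pi * ‖ξ‖)]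
  calc (2 * Real.pi * ‖ξ‖) ^ r ≤ ((1 + (2 * Real.pi * ‖ξ‖) ^ 2) ^ (2⁻¹ : ℝ)) ^ r := by
        refine Real.rpow_le_rpow (by positivity) ?_ hr
        rw [← one_div, ← Real.sqrt_eq_rpow]
        exact Real.le_sqrt_of_sq_le (by linarith)
    _ = (1 + (2 * Real.pi * ‖ξ‖) ^ 2) ^ (2⁻¹ * r) := by rw [← Real.rpow_mul (by positivity)]
    _ ≤ _ := Real.rpow_le_rpow_of_exponent_le h1 (by linarith)

lemma lambdaNorm_le_sobolevNorm {r s : ℝ} (hr : 0 ≤ r) (hrs : r ≤ s) (w : L2) :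
    lambdaNorm r w ≤ sobolevNorm s w := by
  refine eLpNorm_mono fun ξ => ?_
  rw [norm_smul, norm_smul, Real.norm_of_nonneg (by positivity), Real.norm_of_nonneg (by positivity)]
  gcongr
  exact rpow_le_rpow_japanese ξ hr hrs

lemma gradNorm_eq_lambdaNorm (w : L2) : gradNorm (fourierL2 w) = lambdaNorm 1 w := by
  simp only [gradNorm, lambdaNorm, rieszNorm, Real.rpow_one]

lemma abs_integral_cut_mul_dissDensity_le {α : ℝ} {w : L2} (h : lambdaNorm α w ≠ ⊤) (n : ℕ) :
    |∫ ξ, cut n ξ * dissDensity α w ξ| ≤ (lambdaNorm α w ^ 2).toReal := by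
  rw [← integral_dissDensity]
  refine norm_integral_le_of_norm_le (f := fun ξ => cut n ξ * dissDensity α w ξ)
    (integrable_dissDensity h) (ae_of_all _ fun ξ => ?_)
  rw [Real.norm_of_nonneg (mul_nonneg (cut_nonneg n ξ) (dissDensity_nonneg α w ξ))]
  exact mul_le_of_le_one_left (dissDensity_nonneg α w ξ) (cut_le_one n ξ)

lemma mul_le_sq_add_sq (a b : ℝ≥0∞) : a * b ≤ a ^ 2 + b ^ 2 := by
  rcases le_total a b with h | h
  · calc a * b ≤ b * b := by gcongr
      _ ≤ _ := by rw [← pow_two]; exact le_add_self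
  · calc a * b ≤ a * a := by gcongr
      _ ≤ _ := by rw [← pow_two]; exact le_self_add

/-- The bound is independent of `n`, as dominated convergence in time demands. The nonlinear term
contributes 3, from the gradient estimate, and the dissipation 1. -/
lemma enorm_energyFlux_le {α : ℝ} (hα : 1 ≤ α) (n : ℕ) {w : L2} (hS : sobolevNorm α w ≠ ⊤) :
    ‖energyFlux α (zero_le_one.trans hα) n w‖ₑ
      ≤ 4 * (sobolevNorm α w ^ 2 + eLpNorm w 4 volume ^ 4) := by
  have hα0 : 0 ≤ α := zero_le_one.trans hα
  have hl := lambdaNorm_le_sobolevNorm hα0 le_rfl w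
  rw [energyFlux_eq]
  refine (enorm_sub_le).trans ?_
  have h1 : ‖trilin (lowField n w) w w‖ₑ ≤ 3 * (sobolevNorm α w ^ 2 + eLpNorm w 4 volume ^ 4) := by
    refine (enorm_trilin_lowField_le n w).trans ?_
    rw [gradNorm_eq_lambdaNorm, mul_assoc, show 4 = 2 * 2 from rfl, pow_mul (eLpNorm w _ volume)]
    gcongr
    refine (mul_le_mul' (lambdaNorm_le_sobolevNorm zero_le_one hα w) le_rfl).trans
      (mul_le_sq_add_sq _ _)
  have h2 : ‖∫ ξ, cut n ξ * dissDensity α w ξ‖ₑ ≤ sobolevNorm α w ^ 2 := by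
    have h3 := abs_integral_cut_mul_dissDensity_le (ne_top_of_le_ne_top hS hl) n
    rw [← ofReal_norm]
    refine (ENNReal.ofReal_le_ofReal h3).trans ?_
    rw [ENNReal.ofReal_toReal (ENNReal.pow_ne_top (ne_top_of_le_ne_top hS hl))]
    gcongr
  calc _ ≤ 3 * (sobolevNorm α w ^ 2 + eLpNorm w 4 volume ^ 4)
        + (sobolevNorm α w ^ 2 + eLpNorm w 4 volume ^ 4) :=
        add_le_add h1 (h2.trans le_self_add)
    _ = _ := by ring

theorem tendsto_energyFlux {α : ℝ} (hα : 1 ≤ α) {w : L2} (hw : IsDivFree w)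
    (hS : sobolevNorm α w ≠ ⊤) (h4 : eLpNorm w 4 volume ≠ ⊤) :
    Tendsto (fun n => energyFlux α (zero_le_one.trans hα) n w) atTop
      (𝓝 (-(lambdaNorm α w ^ 2).toReal)) := by
  have hα0 : 0 ≤ α := zero_le_one.trans hα
  have hl : lambdaNorm α w ≠ ⊤ := ne_top_of_le_ne_top hS (lambdaNorm_le_sobolevNorm hα0 le_rfl w)
  have hg : gradNorm (fourierL2 w) ≠ ⊤ := by
    rw [gradNorm_eq_lambdaNorm]
    exact ne_top_of_le_ne_top hS (lambdaNorm_le_sobolevNorm zero_le_one hα w)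
  have hd : Tendsto (fun n => ∫ ξ, cut n ξ * dissDensity α w ξ) atTop
      (𝓝 (lambdaNorm α w ^ 2).toReal) := by
    rw [← integral_dissDensity]
    refine tendsto_integral_of_dominated_convergence (dissDensity α w)
      (fun n => (measurable_cut n).aestronglyMeasurable.mul (aestronglyMeasurable_dissDensity α w))
      (integrable_dissDensity hl) (fun n => ae_of_all _ fun ξ => ?_) (ae_of_all _ fun ξ => ?_)
    · rw [Real.norm_of_nonneg (mul_nonneg (cut_nonneg n ξ) (dissDensity_nonneg α w ξ))]
      exact mul_le_of_le_one_left (dissDensity_nonneg α w ξ) (cut_le_one n ξ)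
    · refine tendsto_const_nhds.congr' ?_
      filter_upwards [tendsto_cut ξ] with n hn
      rw [hn, one_mul]
  have h := (tendsto_trilin_lowField hw hg h4).sub hd
  rw [zero_sub] at h
  exact h.congr fun n => (energyFlux_eq hα0 n w).symm

/-- The truncated velocity is solenoidal, so the projection can be dropped: the pressure does no
work. -/
lemma inner_cutInv_projection {α : ℝ} (hα : 0 ≤ α) (n : ℕ) {w : L2} (hw : IsDivFree w) :
    inner ℝ (cutInv α hα n (solSpace.starProjection (fluxVec α hα w))) (lowPass n (fourierL2 w))
      = energyFlux α hα n w := by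
  have hE : cutInv α hα n (lowPass n (fourierL2 w)) ∈ solSpace := by
    refine mulOp_mem_solSpace ?_ _ _ _ _
    filter_upwards [sum_fourierL2_eq_zero hw, coeFn_lowPass n (fourierL2 w)] with ξ h1 h2
    simp only [h2, lowDensity, PiLp.smul_apply]
    simp_rw [smul_comm _ (cut n ξ)]
    rw [← Finset.smul_sum, h1, smul_zero]
  rw [cutInv, inner_mulOp_left, Submodule.inner_starProjection_left_eq_right]
  change inner ℝ _ (solSpace.starProjection (cutInv α hα n (lowPass n (fourierL2 w)))) = _
  rw [Submodule.starProjection_eq_self_iff.2 hE, energyFlux]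

/-! ### Weak continuity -/

/-- The half-open time interval `[0,T)`. -/
def timeIco (T : ℝ≥0∞) : Set ℝ := {t | 0 ≤ t ∧ ENNReal.ofReal t < T}

lemma timeInterval_subset_timeIco (T : ℝ≥0∞) : timeInterval T ⊆ timeIco T := fun _ ht => ⟨ht.1.le, ht.2⟩

lemma timeInterval_mem_nhdsGT {T : ℝ≥0∞} {t : ℝ} (ht : t ∈ timeIco T) : timeInterval T ∈ 𝓝[>] t := by
  have h : ∀ᶠ s in 𝓝 t, ENNReal.ofReal s < T :=
    ENNReal.continuous_ofReal.continuousAt.eventually_lt_const ht.2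
  filter_upwards [nhdsWithin_le_nhds h, self_mem_nhdsWithin] with s h1 h2
  exact ⟨ht.1.trans_lt h2, h1⟩

/-- Weakly continuous functions that agree almost everywhere agree everywhere. -/
theorem eqOn_of_weaklyContinuous {H : Type*} [NormedAddCommGroup H] [InnerProductSpace ℝ H]
    {T : ℝ≥0∞} {f g : ℝ → H} (hf : ∀ w : H, ContinuousOn (fun t => inner ℝ (f t) w) (timeIco T))
    (hg : ∀ w : H, ContinuousOn (fun t => inner ℝ (g t) w) (timeIco T))
    (h : f =ᵐ[volume.restrict (timeInterval T)] g) : Set.EqOn f g (timeIco T) := by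
  intro t ht
  have hI := timeInterval_mem_nhdsGT ht
  -- Every right neighbourhood of `t` has positive measure, so it contains times of agreement.
  -- Approach from the right covers `t = 0` as well.
  have hfreq : ∃ᶠ s in 𝓝[>] t, f s = g s := by
    intro hne
    obtain ⟨b, hb, hsub⟩ := (mem_nhdsGT_iff_exists_Ioo_subset).1 (inter_mem hI hne)
    have h1 : ∀ᵐ s, s ∈ timeInterval T → f s = g s :=
      (ae_restrict_iff' (isOpen_timeInterval T).measurableSet).1 h
    have h2 : volume (Set.Ioo t b) = 0 := by
      refine measure_mono_null (fun s hs => ?_) h1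
      exact fun hs' => (hsub hs).2 (hs' (hsub hs).1)
    rw [Real.volume_Ioo, ENNReal.ofReal_eq_zero] at h2
    exact absurd hb (by simpa using h2)
  refine ext_inner_right ℝ fun w => ?_
  have hle : 𝓝[>] t ≤ 𝓝[timeIco T] t :=
    le_inf nhdsWithin_le_nhds (le_principal_iff.2 (mem_of_superset hI (timeInterval_subset_timeIco T)))
  have hlim := (((hf w) t ht).mono_left hle).sub (((hg w) t ht).mono_left hle)
  have h0 := (isClosed_singleton (x := (0 : ℝ))).mem_of_frequently_of_tendsto
    (hfreq.mono fun s hs => by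
      rw [Set.mem_singleton_iff, hs, sub_self]) hlim
  exact sub_eq_zero.1 h0

/-! ### The energy equality -/

/-- A compatible family of truncations with convergent norms converges. -/
lemma exists_tendsto_of_lowPass {V : ℕ → LC} (h : ∀ m n, m ≤ n → lowPass m (V n) = V m) {L : ℝ}
    (hL : Tendsto (fun n => ‖V n‖ ^ 2) atTop (𝓝 L)) : ∃ E, Tendsto V atTop (𝓝 E) := by
  -- Pythagoras: truncation is an orthogonal projection, so the Cauchy property passes from the
  -- squared norms to the vectors.
  have key : ∀ m n, m ≤ n → ‖V n - V m‖ ^ 2 = ‖V n‖ ^ 2 - ‖V m‖ ^ 2 := fun m n hmn => by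
    have h1 : inner ℝ (V n) (V m) = ‖V m‖ ^ 2 := by
      rw [← real_inner_self_eq_norm_sq]
      conv_rhs => rw [← h m n hmn]
      rw [lowPass, inner_mulOp_left]
      change _ = inner ℝ (V n) (lowPass m (lowPass m (V n)))
      rw [h m n hmn, h m m le_rfl]
    rw [norm_sub_sq_real, h1]
    ring
  refine cauchySeq_tendsto_of_complete (Metric.cauchySeq_iff'.2 fun ε hε => ?_)
  obtain ⟨N, hN⟩ := Metric.cauchySeq_iff'.1 hL.cauchySeq (ε ^ 2) (by positivity)
  refine ⟨N, fun n hn => ?_⟩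
  have h1 := hN n hn
  rw [Real.dist_eq, ← key N n hn, abs_of_nonneg (by positivity)] at h1
  rw [dist_eq_norm]
  exact lt_of_pow_lt_pow_left₀ 2 hε.le h1

lemma cutInv_primitive {α : ℝ} (hα : 0 ≤ α) (n : ℕ) {g : ℝ → LC} (hg : AEStronglyMeasurable g volume)
    {C : ℝ} (hC : ∀ᵐ t, ‖g t‖ ≤ C) (v₀ : LC) (t : ℝ) :
    cutInv α hα n (primitive v₀ g t) = primitive (cutInv α hα n v₀) (fun τ => cutInv α hα n (g τ)) t := by
  rw [primitive, primitive, map_add, ← ContinuousLinearMap.intervalIntegral_comp_comm _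
    (intervalIntegrable_of_bdd hg hC 0 t)]

/-- The weakly continuous representative in frequency space and its energy. -/
theorem exists_energy_solution {α : ℝ} (hα : 1 ≤ α) {T : ℝ≥0∞} (hT : 0 < T) {u₀ : L2} {u : ℝ → L2}
    (hu : IsLerayHopf α T u₀ u) {G : ℝ → ℝ≥0∞}
    (hG : ∫⁻ t in timeInterval T, G t ≠ ⊤) (hGm : AEMeasurable G (volume.restrict (timeInterval T)))
    (h4 : ∀ᵐ t ∂volume.restrict (timeInterval T), eLpNorm (u t) 4 volume ^ 4 ≤ G t) :
    IntegrableOn (fun t => (lambdaNorm α (u t) ^ 2).toReal) (timeInterval T) ∧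
    ∃ E : ℝ → LC, (E =ᵐ[volume.restrict (timeInterval T)] fun t => fourierL2 (u t)) ∧
      (∀ w : LC, ContinuousOn (fun t => inner ℝ (E t) w) (timeIco T)) ∧
      ∀ t ∈ timeIco T, ‖E t‖ ^ 2
        = ‖u₀‖ ^ 2 - 2 * ∫ τ in (0 : ℝ)..t, (lambdaNorm α (u τ) ^ 2).toReal := by
  have hα0 : 0 ≤ α := zero_le_one.trans hα
  have hU := (isOpen_timeInterval T).measurableSet
  set J : ℝ → ℝ := fun t => (lambdaNorm α (u t) ^ 2).toReal with hJ
  obtain ⟨C, hC⟩ := exists_bound_solFlux hα0 hu.memLinf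
  have hgm := aestronglyMeasurable_solFlux (T := T) hα0 hu.memLinf.1
  set W : ℝ → LC := primitive (wtOp α hα0 (fourierL2 u₀)) (solFlux α hα0 T u) with hW
  have hWu := wtOp_ae_eq_primitive hα0 hT hu.memLinf hu.divFree hu.initDivFree hu.weak
  set S : ℝ → ℝ≥0∞ := fun t => sobolevNorm α (u t) with hS
  have hSm : AEMeasurable S (volume.restrict (timeInterval T)) := hu.memL2H.1.aemeasurable
  have hSi : ∫⁻ t in timeInterval T, S t ^ 2 ≠ ⊤ := by
    have h := lintegral_rpow_enorm_lt_top_of_eLpNorm_lt_top two_ne_zero (by norm_num) hu.memL2H.2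
    simpa using h.ne
  have hSt : ∀ᵐ t ∂volume.restrict (timeInterval T), S t ≠ ⊤ := by
    filter_upwards [ae_lt_top' (hSm.pow_const 2) hSi] with t ht h
    rw [h] at ht
    simp at ht
  have hGt : ∀ᵐ t ∂volume.restrict (timeInterval T), G t ≠ ⊤ := by
    filter_upwards [ae_lt_top' hGm hG] with t ht using ht.ne
  set D : ℝ → ℝ≥0∞ := fun t => 4 * (S t ^ 2 + G t) with hD
  have hSG : AEMeasurable (fun t => S t ^ 2 + G t) (volume.restrict (timeInterval T)) :=
    (hSm.pow_const 2).add hGm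
  have hDi : IntegrableOn (fun t => (D t).toReal) (timeInterval T) := by
    refine integrable_toReal_of_lintegral_ne_top (hSG.const_mul 4) ?_
    rw [lintegral_const_mul'' _ hSG, lintegral_add_left' (hSm.pow_const 2)]
    exact ENNReal.mul_ne_top (by norm_num) (ENNReal.add_ne_top.2 ⟨hSi, hG⟩)
  -- Written with `W`, which is continuous and defined at every time; the values agree with the
  -- energy flux of `u` almost everywhere.
  set F : ℕ → ℝ → ℝ := fun n τ => inner ℝ (cutInv α hα0 n (solFlux α hα0 T u τ)) (cutInv α hα0 n (W τ))
    with hF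
  have hFu : ∀ᵐ τ ∂volume.restrict (timeInterval T), ∀ n, F n τ = energyFlux α hα0 n (u τ) := by
    filter_upwards [hWu, hu.divFree, ae_restrict_mem hU] with τ h1 h2 h3 n
    simp only [hF]
    rw [hW, ← h1, cutInv_wtOp, solFlux, Set.indicator_of_mem h3, inner_cutInv_projection hα0 n h2]
  have hWc : Continuous W := continuous_primitive hgm hC _
  have hFm : ∀ n, AEStronglyMeasurable (F n) volume := fun n =>
    ((cutInv α hα0 n).continuous.comp_aestronglyMeasurable hgm).inner (𝕜 := ℝ)
      ((cutInv α hα0 n).continuous.comp hWc).aestronglyMeasurable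
  have hFD : ∀ᵐ τ ∂volume.restrict (timeInterval T), ∀ n, ‖F n τ‖ ≤ (D τ).toReal := by
    filter_upwards [hFu, hSt, hGt, h4] with τ h1 h2 h3 h5 n
    have hDt : D τ ≠ ⊤ := ENNReal.mul_ne_top (by norm_num)
      (ENNReal.add_ne_top.2 ⟨ENNReal.pow_ne_top h2, h3⟩)
    rw [← toReal_enorm]
    refine ENNReal.toReal_mono hDt ?_
    rw [h1]
    refine (enorm_energyFlux_le hα n h2).trans ?_
    simp only [hD, hS]
    gcongr
  have hFlim : ∀ᵐ τ ∂volume.restrict (timeInterval T), Tendsto (fun n => F n τ) atTop (𝓝 (-J τ)) := by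
    filter_upwards [hFu, hSt, hGt, h4, hu.divFree] with τ h1 h2 h3 h5 h6
    have h7 : eLpNorm (u τ) 4 volume ≠ ⊤ := fun h => by
      rw [h, ENNReal.top_pow four_ne_zero, top_le_iff] at h5
      exact h3 h5
    exact (tendsto_energyFlux hα h6 h2 h7).congr fun n => (h1 n).symm
  -- As an almost everywhere limit of the dominated functions `F n`, the dissipation is both
  -- measurable and integrable.
  have hJi : IntegrableOn (fun t => -J t) (timeInterval T) := by
    refine hDi.mono' (aestronglyMeasurable_of_tendsto_ae atTop (fun n => (hFm n).restrict) hFlim) ?_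
    filter_upwards [hFD, hFlim] with τ h1 h2
    exact le_of_tendsto h2.norm (Eventually.of_forall h1)
  refine ⟨by simpa using hJi.neg, ?_⟩
  set V : ℕ → ℝ → LC := fun n t => cutInv α hα0 n (W t) with hV
  have hVn : ∀ n t, ‖V n t‖ ^ 2 = ‖lowPass n (fourierL2 u₀)‖ ^ 2 + 2 * ∫ τ in (0 : ℝ)..t, F n τ := by
    intro n t
    have hb : ∀ᵐ τ, ‖cutInv α hα0 n (solFlux α hα0 T u τ)‖ ≤ ‖cutInv α hα0 n‖ * C := by
      filter_upwards [hC] with τ hτ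
      exact (ContinuousLinearMap.le_opNorm _ _).trans (by gcongr)
    have e : primitive (cutInv α hα0 n (wtOp α hα0 (fourierL2 u₀)))
        (fun τ => cutInv α hα0 n (solFlux α hα0 T u τ)) = V n :=
      funext fun τ => (cutInv_primitive hα0 n hgm hC _ τ).symm
    have h := norm_sq_primitive (g := fun τ => cutInv α hα0 n (solFlux α hα0 T u τ))
      ((cutInv α hα0 n).continuous.comp_aestronglyMeasurable hgm) hb
      (cutInv α hα0 n (wtOp α hα0 (fourierL2 u₀))) t
    rw [e, cutInv_wtOp] at h
    exact h
  have hlow : Tendsto (fun n => ‖lowPass n (fourierL2 u₀)‖ ^ 2) atTop (𝓝 (‖u₀‖ ^ 2)) := by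
    rw [← norm_fourierL2]
    exact (tendsto_lowPass _).norm.pow 2
  -- The truncated identity holds at every time, so this limit does too; exceptional times enter
  -- only inside the integral.
  have hVlim : ∀ t ∈ timeIco T, Tendsto (fun n => ‖V n t‖ ^ 2) atTop
      (𝓝 (‖u₀‖ ^ 2 - 2 * ∫ τ in (0 : ℝ)..t, J τ)) := by
    intro t ht
    have hsub : Set.uIoc 0 t ⊆ timeInterval T := by
      rw [Set.uIoc_of_le ht.1]
      exact Ioc_subset_timeInterval ht.2
    have hr : ∀ {P : ℝ → Prop}, (∀ᵐ τ ∂volume.restrict (timeInterval T), P τ) →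
        ∀ᵐ τ, τ ∈ Set.uIoc 0 t → P τ := fun {P} hP =>
      ((ae_restrict_iff' hU).1 hP).mono fun τ h1 h2 => h1 (hsub h2)
    have hI := intervalIntegral.tendsto_integral_filter_of_dominated_convergence (a := 0) (b := t)
      (μ := volume) (l := atTop) (F := F) (f := fun τ => -J τ) (fun τ => (D τ).toReal)
      (Eventually.of_forall fun n => (hFm n).restrict)
      (Eventually.of_forall fun n => hr (hFD.mono fun τ h => h n))
      (intervalIntegrable_iff.2 (hDi.mono_set hsub)) (hr hFlim)
    rw [intervalIntegral.integral_neg] at hI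
    simp only [hVn]
    have h := hlow.add (hI.const_mul 2)
    rwa [mul_neg, ← sub_eq_add_neg] at h
  have hcompat : ∀ t, ∀ m n, m ≤ n → lowPass m (V n t) = V m t := fun t m n hmn =>
    lowPass_cutInv hα0 hmn _
  have hex : ∀ t, ∃ E, t ∈ timeIco T → Tendsto (fun n => V n t) atTop (𝓝 E) := fun t => by
    by_cases ht : t ∈ timeIco T
    · obtain ⟨E, hE⟩ := exists_tendsto_of_lowPass (hcompat t) (hVlim t ht)
      exact ⟨E, fun _ => hE⟩
    · exact ⟨0, fun h => absurd h ht⟩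
  choose E hE using hex
  have hEn : ∀ t ∈ timeIco T, ‖E t‖ ^ 2 = ‖u₀‖ ^ 2 - 2 * ∫ τ in (0 : ℝ)..t, J τ := fun t ht =>
    tendsto_nhds_unique ((hE t ht).norm.pow 2) (hVlim t ht)
  refine ⟨E, ?_, fun w => ?_, hEn⟩
  · filter_upwards [hWu, ae_restrict_mem hU] with t h1 h2
    have h3 : ∀ n, V n t = lowPass n (fourierL2 (u t)) := fun n => by
      simp only [hV]
      rw [hW, ← h1, cutInv_wtOp]
    have h5 := hE t (timeInterval_subset_timeIco T h2)
    simp only [h3] at h5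
    exact tendsto_nhds_unique h5 (tendsto_lowPass _)
  · have hlowE : ∀ t ∈ timeIco T, ∀ m, lowPass m (E t) = V m t := fun t ht m => by
      have h1 := ((lowPass m).continuous.tendsto (E t)).comp (hE t ht)
      refine tendsto_nhds_unique h1 (tendsto_const_nhds.congr' ?_)
      filter_upwards [eventually_ge_atTop m] with n hn
      exact (hcompat t m n hn).symm
    have hbd : ∀ t ∈ timeIco T, ‖E t‖ ≤ ‖u₀‖ := fun t ht => by
      have h1 : 0 ≤ ∫ τ in (0 : ℝ)..t, J τ :=
        intervalIntegral.integral_nonneg ht.1 fun τ _ => ENNReal.toReal_nonneg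
      refine le_of_sq_le_sq ?_ (norm_nonneg _)
      rw [hEn t ht]
      linarith
    -- Truncation moves onto `w`: the error is `⟨E(t), w − lowPass m w⟩`, and `‖E(t)‖ ≤ ‖u₀‖` makes
    -- it small uniformly in `t`.
    refine TendstoUniformlyOn.continuousOn (F := fun m t => inner ℝ (V m t) w) (p := atTop) ?_
      (Frequently.of_forall fun m =>
        (((cutInv α hα0 m).continuous.comp hWc).inner continuous_const).continuousOn)
    rw [Metric.tendstoUniformlyOn_iff]
    intro ε hε
    have hw : Tendsto (fun m => ‖u₀‖ * ‖w - lowPass m w‖) atTop (𝓝 0) := by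
      have := ((tendsto_lowPass w).const_sub w).norm.const_mul ‖u₀‖
      simpa using this
    filter_upwards [hw.eventually_lt_const hε] with m hm t ht
    rw [Real.dist_eq, ← hlowE t ht m, lowPass, inner_mulOp_left]
    change |inner ℝ (E t) w - inner ℝ (E t) (lowPass m w)| < ε
    rw [← inner_sub_right]
    refine (abs_real_inner_le_norm _ _).trans_lt (lt_of_le_of_lt ?_ hm)
    gcongr
    exact hbd t ht

/-- A function satisfying the energy equality, with values in the real fields. -/
theorem exists_weaklyContinuousRep {α : ℝ} (hα : 1 ≤ α) {T : ℝ≥0∞} (hT : 0 < T) {u₀ : L2}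
    {u : ℝ → L2} (hu : IsLerayHopf α T u₀ u) {G : ℝ → ℝ≥0∞}
    (hG : ∫⁻ t in timeInterval T, G t ≠ ⊤) (hGm : AEMeasurable G (volume.restrict (timeInterval T)))
    (h4 : ∀ᵐ t ∂volume.restrict (timeInterval T), eLpNorm (u t) 4 volume ^ 4 ≤ G t) :
    ∃ v : ℝ → L2, IsWeaklyContinuousRep T u v ∧ ∀ t ∈ timeIco T,
      ‖v t‖ ^ 2 = ‖u₀‖ ^ 2 - 2 * ∫ τ in (0 : ℝ)..t, (lambdaNorm α (u τ) ^ 2).toReal := by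
  obtain ⟨-, E, hEu, hEw, hEn⟩ := exists_energy_solution hα hT hu hG hGm h4
  have hw : ∀ w : L2, ContinuousOn (fun t => inner ℝ (realLp (E t)) w) (timeIco T) := fun w => by
    refine (hEw (fourierL2 w)).congr fun t _ => ?_
    simp only
    rw [real_inner_comm, inner_realLp, real_inner_comm]
  have hae : (fun t => realLp (E t)) =ᵐ[volume.restrict (timeInterval T)] u := by
    filter_upwards [hEu] with t ht
    rw [ht, realLp_fourierL2]
  refine ⟨fun t => realLp (E t), ⟨hae, hw⟩, fun t ht => ?_⟩
  -- A priori `E t` is the transform of a real field only for almost every `t`. Weak continuity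
  -- extends this to all `t`, so `realLp` preserves its norm.
  have heq : Set.EqOn (fun t => fourierL2 (realLp (E t))) E (timeIco T) := by
    refine eqOn_of_weaklyContinuous (fun w => ?_) hEw ?_
    · refine (hw (realLp w)).congr fun s _ => ?_
      simp only
      rw [inner_realLp]
    · filter_upwards [hEu] with s hs
      rw [hs, realLp_fourierL2]
  simp only
  rw [← hEn t ht, ← norm_fourierL2]
  exact congrArg (fun F : LC => ‖F‖ ^ 2) (heq ht)

/-- The energy equality in terms of extended nonnegative reals. -/
lemma energy_equality_of_sq {α : ℝ} (hα : 1 ≤ α) {T : ℝ≥0∞} {u₀ : L2} {u v : ℝ → L2}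
    (hu : IsLerayHopf α T u₀ u)
    (hJ : IntegrableOn (fun t => (lambdaNorm α (u t) ^ 2).toReal) (timeInterval T))
    (hvu : v =ᵐ[volume.restrict (timeInterval T)] u) {t : ℝ} (ht : t ∈ timeIco T)
    (h : ‖v t‖ ^ 2 = ‖u₀‖ ^ 2 - 2 * ∫ τ in (0 : ℝ)..t, (lambdaNorm α (u τ) ^ 2).toReal) :
    ‖v t‖ₑ ^ 2 / 2 + ∫⁻ τ in Set.Ioo 0 t, lambdaNorm α (v τ) ^ 2 = ‖u₀‖ₑ ^ 2 / 2 := by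
  have hU := (isOpen_timeInterval T).measurableSet
  have hsub : Set.Ioc 0 t ⊆ timeInterval T := Ioc_subset_timeInterval ht.2
  have hSt : ∀ᵐ τ ∂volume.restrict (timeInterval T), lambdaNorm α (u τ) ≠ ⊤ := by
    have hSm : AEMeasurable (fun t => sobolevNorm α (u t)) (volume.restrict (timeInterval T)) :=
      hu.memL2H.1.aemeasurable
    have hSi : ∫⁻ t in timeInterval T, sobolevNorm α (u t) ^ 2 ≠ ⊤ := by
      have h := lintegral_rpow_enorm_lt_top_of_eLpNorm_lt_top two_ne_zero (by norm_num) hu.memL2H.2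
      simpa using h.ne
    filter_upwards [ae_lt_top' (hSm.pow_const 2) hSi] with τ hτ h
    have h1 := lambdaNorm_le_sobolevNorm (zero_le_one.trans hα) le_rfl (u τ)
    rw [h, top_le_iff] at h1
    rw [h1] at hτ
    simp at hτ
  have e1 : ∫⁻ τ in Set.Ioo 0 t, lambdaNorm α (v τ) ^ 2
      = ENNReal.ofReal (∫ τ in (0 : ℝ)..t, (lambdaNorm α (u τ) ^ 2).toReal) := by
    rw [intervalIntegral.integral_of_le ht.1, ofReal_integral_eq_lintegral_ofReal (hJ.mono_set hsub)
      (ae_of_all _ fun _ => ENNReal.toReal_nonneg), restrict_Ioo_eq_restrict_Ioc]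
    refine lintegral_congr_ae ?_
    filter_upwards [ae_restrict_of_ae_restrict_of_subset hsub hvu,
      ae_restrict_of_ae_restrict_of_subset hsub hSt] with τ h1 h2
    rw [h1, ENNReal.ofReal_toReal (ENNReal.pow_ne_top h2)]
  have e2 : ∀ w : L2, ‖w‖ₑ ^ 2 / 2 = ENNReal.ofReal (‖w‖ ^ 2 / 2) := fun w => by
    rw [ENNReal.ofReal_div_of_pos two_pos, ENNReal.ofReal_pow (norm_nonneg _), ofReal_norm,
      ENNReal.ofReal_ofNat]
  have h0 : 0 ≤ ∫ τ in (0 : ℝ)..t, (lambdaNorm α (u τ) ^ 2).toReal :=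
    intervalIntegral.integral_nonneg ht.1 fun τ _ => ENNReal.toReal_nonneg
  rw [e1, e2, e2, ← ENNReal.ofReal_add (by positivity) h0, h]
  congr 1
  ring

end FracNS

end

/-! ### The energy equality under the multiplier condition -/

theorem corollary1p2 (α β θ : ℝ) (hα : 1 ≤ α) (hβ : 0 ≤ β) (hθ : 0 ≤ θ)
    (hlow : 1 / 2 ≤ β + θ) (hupp : β + θ ≤ 1)
    (T : ℝ≥0∞) (hT : 0 < T) (u₀ : FracNS.L2) (u : ℝ → FracNS.L2)
    (hu : FracNS.IsLerayHopf α T u₀ u)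
    (hmult : FracNS.MemLqMultiplier T
      (ENNReal.ofReal (2 * α * (β + θ)) / ENNReal.ofReal (α - θ))
      (θ / (β + θ)) (ENNReal.ofReal (2 * (β + θ)))
      (fun t x => ‖u t x‖ ^ (2 / (β + θ) - 2) • u t x)) :
    (∃ v : ℝ → FracNS.L2, FracNS.IsWeaklyContinuousRep T u v) ∧
      ∀ v : ℝ → FracNS.L2, FracNS.IsWeaklyContinuousRep T u v →
        ∀ t : ℝ, 0 ≤ t → ENNReal.ofReal t < T →
          ‖v t‖ₑ ^ 2 / 2 + ∫⁻ τ in Set.Ioo 0 t, FracNS.lambdaNorm α (v τ) ^ 2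
            = ‖u₀‖ₑ ^ 2 / 2 := by
  have hα0 : 0 < α := by linarith
  obtain ⟨B, hB0, hB⟩ := FracNS.exists_norm_fluxVec_le hα0.le hu.memLinf
  -- Here `γ = β + θ`. The multiplier condition is used only to obtain this integrable majorant of
  -- `‖u(t)‖₄⁴`.
  obtain ⟨G, hGm, hG, h4⟩ := FracNS.exists_dominating hα hlow hupp hθ (by linarith)
    (hB.mono fun t ht => ht.1) hu.memL2H hmult.2
  obtain ⟨hJ, -⟩ := FracNS.exists_energy_solution hα hT hu hG hGm h4
  obtain ⟨v, hv, hvn⟩ := FracNS.exists_weaklyContinuousRep hα hT hu hG hGm h4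
  refine ⟨⟨v, hv⟩, fun v' hv' t ht0 htT => ?_⟩
  have ht : t ∈ FracNS.timeIco T := ⟨ht0, htT⟩
  -- Any weakly continuous representative equals the constructed one at every time of `[0,T)`, and
  -- so inherits its energy identity.
  have heq : Set.EqOn v' v (FracNS.timeIco T) :=
    FracNS.eqOn_of_weaklyContinuous hv'.2 hv.2 (hv'.1.trans hv.1.symm)
  exact FracNS.energy_equality_of_sq hα hu hJ hv'.1 ht (by rw [heq ht, hvn t ht])
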